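/- **Normal Form Lemma.** Let $d,N\in\mathbb N$, $0<\delta<\tfrac12$, $0<\beta<1$, $\varepsilon_0>0$, and put $a:=1-2\delta$, $\mathbb T^d:=\mathbb R^d/2\pi\mathbb Z^d$, $H_0(p):=\sum_{j=1}^d p_j^2/2$ and $K(\varepsilon):=\lfloor\varepsilon^{-\beta}\rfloor+1$. A family $f=\{f_\varepsilon\}_{0<\varepsilon<\varepsilon_0}$ of real functions $f_\varepsilon\in C^\infty(\mathbb R^d\times\mathbb T^d)$ is a *symbol of order* $m\in\mathbb R$, written $f\in\mathcal P^{m,\delta}$, if for all $\alpha,\gamma\in\mathbb N^d$ there is $C_{\alpha,\gamma}>0$ with $$\sup_{0<\varepsilon<\varepsilon_0}\ \sup_{(p,q)\in\mathbb R^d\times\mathbb T^d}\left|\frac{\partial_p^\alpha\partial_q^\gamma f_\varepsilon(p,q)}{\varepsilon^{m}}\,\varepsilon^{|\alpha|\delta}\right|\le C_{\alpha,\gamma}.$$ Let $\hat f_k(\varepsilon,p)=(2\pi)^{-d}\int_{\mathbb T^d}f_\varepsilon(p,q)e^{-\mathrm i k\cdot q}\,dq$. A family $Z_\varepsilon:\mathbb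 R^d\times\mathbb T^d\to\mathbb R$ is *in normal form* if, for all $0<\varepsilon<\varepsilon_0$, $Z_\varepsilon(p,q)=\sum_{|k|\le K(\varepsilon)}\hat Z_k(\varepsilon,p)e^{\mathrm i k\cdot q}$ (with $|k|$ the Euclidean length) and, for every $k\in\mathbb Z^d\setminus\{0\}$ and $p\in\mathbb R^d$, $\hat Z_k(\varepsilon,p)\ne0$ implies $|p\cdot k|\le\varepsilon^\delta$. The *Lie transform* generated by $g$ is the time-one map of the (globally defined) flow of the Hamiltonian vector field $\dot p=-\partial_q g$, $\dot q=\partial_p g$. Let $H_\varepsilon=H_0+P_\varepsilon$ with $P\in\mathcal P^{1,\delta}$. Then there exist canonical transformations ($C^\infty$ symplectic diffeomorphisms) $\mathcal T=\mathcal T_\varepsilon$ of $\mathbb R^d\times\mathbb T^d$, $0<\varepsilon<\varepsilon_0$, each a composition $\mathcal T_\varepsilon=\Phi^1_{g_{1,\varepsilon}}\circ\cdots\circ\Phi^1_{g_{N,\varepsilon}}$ of Lie transforms generated by symbols $g_j\in\mathcal P^{1+a(j-1)-\delta,\,\delta}$, such that $$H_\varepsilon\circ\mathcal T_\varepsilon=H_0+\sum_{j=1}^N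 Z_{j,\varepsilon}+\mathcal R^{(N)}_\varepsilon ,$$ where each $Z_j\in\mathcal P^{1+a(j-1),\delta}$ is in normal form and $\mathcal R^{(N)}_\varepsilon\in C^\infty(\mathbb R^d\times\mathbb T^d)$ satisfies, for all $\alpha,\gamma\in\mathbb N^d$ with $|\alpha|+|\gamma|\le1$, $$\sup_{0<\varepsilon<\varepsilon_0}\ \sup_{(p,q)}\left|\frac{\partial_p^\alpha\partial_q^\gamma\mathcal R^{(N)}_\varepsilon(p,q)}{\varepsilon^{1+Na}}\right|\varepsilon^{|\alpha|\delta}\le C_{\alpha,\gamma}<\infty .$$ Furthermore, for every $m\in\mathbb R$ and every $f\in\mathcal P^{m,\delta}$ there is $C>0$ such that, for all $0<\varepsilon<\varepsilon_0$, $$\sup_{(p,q)}\left|f_\varepsilon\circ\mathcal T_\varepsilon-f_\varepsilon\right|\le C\,\varepsilon^{m+1-2\delta},$$ and for every $j=1,\dots,d$ there is $C>0$ such that, for all $0<\varepsilon<\varepsilon_0$, $$\sup_{(p,q)}\left|p_j\circ\mathcal T_\varepsilon-p_j\right|\le C\,\varepsilon^{1-\delta}.$$ -/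

import Mathlib

/-!
The phase space is `ℝ^d × 𝕋^d` with `𝕋^d = ℝ^d / 2πℤ^d`. Functions on it are functions of
`(p, q) ∈ ℝ^d × ℝ^d` that are `2πℤ^d`-periodic in `q`; maps of it are represented by their lifts to
`ℝ^d × ℝ^d`. A point is `x = (p, q)`, so `x.1 = p` and `x.2 = q`.
-/

namespace NormalFormLemma

open scoped ContDiff

noncomputable section

/-- Universal cover of `ℝ^d × 𝕋^d`. -/
abbrev Phase (d : ℕ) : Type := (Fin d → ℝ) × (Fin d → ℝ)

/-- The vector `(0, 2πk)`. -/
def shift {d : ℕ} (k : Fin d → ℤ) : Phase d :=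
  (0, fun j => 2 * Real.pi * (k j : ℝ))

/-- `f` is a function on `ℝ^d × 𝕋^d`. -/
def IsPeriodic {d : ℕ} (f : Phase d → ℝ) : Prop :=
  ∀ (k : Fin d → ℤ) (x : Phase d), f (x + shift k) = f x

/-- `∂f/∂p_j`. -/
def partialP {d : ℕ} (j : Fin d) (f : Phase d → ℝ) : Phase d → ℝ :=
  fun x => fderiv ℝ f x (Pi.single j 1, 0)

/-- `∂f/∂q_j`. -/
def partialQ {d : ℕ} (j : Fin d) (f : Phase d → ℝ) : Phase d → ℝ :=
  fun x => fderiv ℝ f x (0, Pi.single j 1)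

/-- `∂_p^α f = ∂_{p_1}^{α_1} ⋯ ∂_{p_d}^{α_d} f`. -/
def multiP {d : ℕ} (α : Fin d → ℕ) (f : Phase d → ℝ) : Phase d → ℝ :=
  (List.finRange d).foldr (fun j g => (partialP j)^[α j] g) f

/-- `∂_q^β f = ∂_{q_1}^{β_1} ⋯ ∂_{q_d}^{β_d} f`. -/
def multiQ {d : ℕ} (β : Fin d → ℕ) (f : Phase d → ℝ) : Phase d → ℝ :=
  (List.finRange d).foldr (fun j g => (partialQ j)^[β j] g) f

/-- `∂_p^α ∂_q^β f`. -/
def mixedPartial {d : ℕ} (α β : Fin d → ℕ) (f : Phase d → ℝ) : Phase d → ℝ :=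
  multiP α (multiQ β f)

/-- The family `f ε`, `0 < ε < ε₀`, is a symbol of order `m`, that is, of class `𝒫^{m,δ}`. -/
structure IsSymbol {d : ℕ} (ε₀ δ m : ℝ) (f : ℝ → Phase d → ℝ) : Prop where
  smooth : ∀ ε ∈ Set.Ioo 0 ε₀, ContDiff ℝ ∞ (f ε)
  periodic : ∀ ε ∈ Set.Ioo 0 ε₀, IsPeriodic (f ε)
  bound : ∀ α β : Fin d → ℕ, ∃ C > 0, ∀ ε ∈ Set.Ioo 0 ε₀, ∀ x : Phase d,
    |mixedPartial α β (f ε) x / ε ^ m * ε ^ (((∑ j, α j : ℕ) : ℝ) * δ)| ≤ C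

/-- The family `R ε` is a remainder of order `N`: the symbol estimates of order `1 + N(1-2δ)` hold
for the derivatives of order at most one. -/
structure IsRemainder {d : ℕ} (ε₀ δ : ℝ) (N : ℕ) (R : ℝ → Phase d → ℝ) : Prop where
  smooth : ∀ ε ∈ Set.Ioo 0 ε₀, ContDiff ℝ ∞ (R ε)
  periodic : ∀ ε ∈ Set.Ioo 0 ε₀, IsPeriodic (R ε)
  bound : ∀ α β : Fin d → ℕ, ∑ j, α j + ∑ j, β j ≤ 1 →
    ∃ C > 0, ∀ ε ∈ Set.Ioo 0 ε₀, ∀ x : Phase d,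
      |mixedPartial α β (R ε) x / ε ^ (1 + N * (1 - 2 * δ))|
        * ε ^ (((∑ j, α j : ℕ) : ℝ) * δ) ≤ C

/-- `K(ε) = [ε^{-β}] + 1`. -/
def cutoff (β ε : ℝ) : ℕ := ⌊1 / ε ^ β⌋₊ + 1

/-- The integer vectors `k` of Euclidean length at most `K`. -/
def modes (d K : ℕ) : Finset (Fin d → ℤ) :=
  (Fintype.piFinset fun _ : Fin d => Finset.Icc (-(K : ℤ)) K).filter
    fun k => ∑ j, k j ^ 2 ≤ (K : ℤ) ^ 2

theorem mem_modes {d K : ℕ} {k : Fin d → ℤ} :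
    k ∈ modes d K ↔ ∑ j, k j ^ 2 ≤ (K : ℤ) ^ 2 := by
  simp only [modes, Finset.mem_filter, Fintype.mem_piFinset, Finset.mem_Icc, and_iff_right_iff_imp]
  intro h j
  have h1 : k j ^ 2 ≤ (K : ℤ) ^ 2 :=
    (Finset.single_le_sum (f := fun i => k i ^ 2) (fun i _ => sq_nonneg (k i))
      (Finset.mem_univ j)).trans h
  exact abs_le.mp (abs_le_of_sq_le_sq h1 (by positivity))

/-- `v · k`. -/
def dotInt {d : ℕ} (v : Fin d → ℝ) (k : Fin d → ℤ) : ℝ := ∑ j, v j * (k j : ℝ)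

/-- The Fourier coefficient `(2π)^{-d} ∫_{𝕋^d} f(p, q) e^{-i k·q} dq`. -/
def fourierCoef {d : ℕ} (f : Phase d → ℝ) (k : Fin d → ℤ) (p : Fin d → ℝ) : ℂ :=
  (1 / (2 * Real.pi) ^ d : ℝ) *
    ∫ q in Set.Icc (0 : Fin d → ℝ) (fun _ => 2 * Real.pi),
      (f (p, q) : ℂ) * Complex.exp (-Complex.I * (dotInt q k : ℂ))

/-- The family `Z ε` is in (resonant) normal form. -/
def IsNormalForm {d : ℕ} (ε₀ δ β : ℝ) (Z : ℝ → Phase d → ℝ) : Prop :=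
  ∀ ε ∈ Set.Ioo 0 ε₀,
    (∀ p q : Fin d → ℝ, (Z ε (p, q) : ℂ) =
      ∑ k ∈ modes d (cutoff β ε),
        fourierCoef (Z ε) k p * Complex.exp (Complex.I * (dotInt q k : ℂ))) ∧
    ∀ (k : Fin d → ℤ) (p : Fin d → ℝ), k ≠ 0 → fourierCoef (Z ε) k p ≠ 0 →
      |dotInt p k| ≤ ε ^ δ

/-- `H₀(p) = ∑ p_j² / 2`. -/
def freeHam {d : ℕ} (x : Phase d) : ℝ := ∑ j, x.1 j ^ 2 / 2

/-- The Hamiltonian vector field `X_g = (-∂g/∂q, ∂g/∂p)`. -/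
def hamVF {d : ℕ} (g : Phase d → ℝ) (x : Phase d) : Phase d :=
  (fun j => -partialQ j g x, fun j => partialP j g x)

/-- `Φ` is the globally defined flow of `X_g`. -/
def IsHamFlow {d : ℕ} (g : Phase d → ℝ) (Φ : ℝ → Phase d → Phase d) : Prop :=
  ∀ x, Φ 0 x = x ∧ ∀ t, HasDerivAt (fun s => Φ s x) (hamVF g (Φ t x)) t

/-- `L` is the Lie transform generated by `g`, i.e. the time-one flow of `X_g`. -/
def IsLieTransform {d : ℕ} (g : Phase d → ℝ) (L : Phase d → Phase d) : Prop :=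
  ∃ Φ : ℝ → Phase d → Phase d, IsHamFlow g Φ ∧ L = Φ 1

/-- The composition `L 1 ∘ L 2 ∘ ⋯ ∘ L n`. -/
def compUpTo {X : Type} (L : ℕ → X → X) : ℕ → X → X
  | 0 => id
  | n + 1 => compUpTo L n ∘ L (n + 1)

/-- The symplectic form `∑ dp_j ∧ dq_j`. -/
def symp {d : ℕ} (u v : Phase d) : ℝ := ∑ j, (u.1 j * v.2 j - u.2 j * v.1 j)

/-- `T` induces a map of `ℝ^d × 𝕋^d`. -/
def Descends {d : ℕ} (T : Phase d → Phase d) : Prop :=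
  ∀ (x : Phase d) (k : Fin d → ℤ), ∃ l : Fin d → ℤ, T (x + shift k) = T x + shift l

/-- `T` is (the lift of) a canonical transformation of `ℝ^d × 𝕋^d`: a smooth diffeomorphism which
preserves the symplectic form. -/
structure IsCanonical {d : ℕ} (T : Phase d → Phase d) : Prop where
  smooth : ContDiff ℝ ∞ T
  descends : Descends T
  exists_inverse : ∃ S : Phase d → Phase d, ContDiff ℝ ∞ S ∧ Descends S ∧
    Function.LeftInverse S T ∧ Function.RightInverse S T
  symplectic : ∀ x u v : Phase d, symp (fderiv ℝ T x u) (fderiv ℝ T x v) = symp u v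

end

end NormalFormLemma

/-!
Dilating the actions by `ε ^ δ` turns a symbol of order `m` into `ε ^ m` times a family which is
bounded together with all its derivatives, and turns `H₀` into `ε ^ (2δ) H₀`. A Poisson bracket
costs one derivative in the actions, that is, a factor `ε ^ (-δ)`.

Each step removes the non-resonant part of the current perturbation `R` of order `m ≥ 1`. In the
dilated actions `y`, the homological equation `y · ∂_q g = R - Z` is solved mode by mode: a smooth
function of `y · k`, equal to `1` near `0` and supported in `[-1, 1]`, splits the `k`-th mode into a
resonant part, which goes to `Z`, and a part on which the divisor is bounded below. The Fourier
modes beyond `K(ε) ≥ ε ^ (-β)` gain any power of `ε`, so they belong to the next perturbation. The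
generator `g` has order `m - δ`, hence its Lie transform is within `ε ^ (1 - 2δ)` of the identity
in the dilated variables, and each term of the Lie expansion of the transformed Hamiltonian beyond
the homological equation has order `m + 1 - 2δ`.
-/

namespace NormalFormLemma

open Set Filter
open scoped ContDiff NNReal Topology

noncomputable section

section UnifBdd

variable {ι κ : Type*} {E V W U : Type} [NormedAddCommGroup E] [NormedSpace ℝ E]
  [NormedAddCommGroup V] [NormedSpace ℝ V] [NormedAddCommGroup W] [NormedSpace ℝ W]
  [NormedAddCommGroup U] [NormedSpace ℝ U] {n : ℕ}

/-- The maps `F i` have derivatives of orders `1, …, n` that are bounded uniformly in `i`, and their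
`n`-th derivatives are Lipschitz uniformly in `i`. Unlike a bound on the derivatives up to order
`n + 1`, this condition passes from a vector field to its flow. -/
def UnifMap {ι : Type*} {E : Type} [NormedAddCommGroup E] [NormedSpace ℝ E] :
    ℕ → ∀ {V : Type} [NormedAddCommGroup V] [NormedSpace ℝ V], (ι → E → V) → Prop
  | 0, _, _, _, F => ∃ K, ∀ i, LipschitzWith K (F i)
  | n + 1, _, _, _, F => (∀ i, Differentiable ℝ (F i)) ∧
      (∃ C : ℝ≥0, ∀ i x, ‖fderiv ℝ (F i) x‖ ≤ C) ∧ UnifMap n (fun i => fderiv ℝ (F i))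

/-- The family `F` is bounded in `C^{n,1}`. -/
structure UnifBdd (n : ℕ) (F : ι → E → V) : Prop where
  bounded : ∃ C : ℝ≥0, ∀ i x, ‖F i x‖ ≤ C
  unifMap : UnifMap n F

/-- The family `F` is bounded in `C^n` for every `n`. -/
def UnifSmooth (F : ι → E → V) : Prop := ∀ n, UnifBdd n F

theorem unifMap_succ {F : ι → E → V} :
    UnifMap (n + 1) F ↔ (∀ i, Differentiable ℝ (F i)) ∧ UnifBdd n (fun i => fderiv ℝ (F i)) :=
  ⟨fun h => ⟨h.1, h.2.1, h.2.2⟩, fun h => ⟨h.1, h.2.1, h.2.2⟩⟩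

namespace UnifMap

variable {F : ι → E → V}

theorem lipschitz (h : UnifMap n F) : ∃ K, ∀ i, LipschitzWith K (F i) := by
  cases n with
  | zero => exact h
  | succ n =>
    obtain ⟨hd, ⟨C, hC⟩, -⟩ := h
    exact ⟨C, fun i => lipschitzWith_of_nnnorm_fderiv_le (hd i) (hC i)⟩

theorem of_succ (h : UnifMap (n + 1) F) : UnifMap n F := by
  induction n generalizing V with
  | zero => exact h.lipschitz
  | succ n ih => exact ⟨h.1, h.2.1, ih h.2.2⟩

theorem reindex (h : UnifMap n F) (φ : κ → ι) : UnifMap n (fun k => F (φ k)) := by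
  induction n generalizing V with
  | zero => exact h.imp fun _ hK k => hK (φ k)
  | succ n ih => exact ⟨fun _ => h.1 _, h.2.1.imp fun _ hC k => hC _, ih h.2.2⟩

theorem contDiff (h : UnifMap n F) (i : ι) : ContDiff ℝ n (F i) := by
  induction n generalizing V with
  | zero =>
    obtain ⟨K, hK⟩ := h
    exact contDiff_zero.2 (hK i).continuous
  | succ n ih =>
    exact_mod_cast (contDiff_succ_iff_fderiv (n := n)).2 ⟨h.1 i, by simp, ih h.2.2⟩

end UnifMap

namespace UnifBdd

variable {F G : ι → E → V}

theorem differentiable (h : UnifBdd (n + 1) F) (i : ι) : Differentiable ℝ (F i) :=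
  h.unifMap.1 i

protected theorem fderiv (h : UnifBdd (n + 1) F) : UnifBdd n (fun i => fderiv ℝ (F i)) :=
  (unifMap_succ.1 h.unifMap).2

theorem hasFDerivAt (h : UnifBdd (n + 1) F) (i : ι) (x : E) :
    HasFDerivAt (F i) (fderiv ℝ (F i) x) x :=
  (h.unifMap.1 i x).hasFDerivAt

theorem of_hasFDerivAt {F' : ι → E → E →L[ℝ] V} (hF : ∃ C : ℝ≥0, ∀ i x, ‖F i x‖ ≤ C)
    (hd : ∀ i x, HasFDerivAt (F i) (F' i x) x) (h : UnifBdd n F') : UnifBdd (n + 1) F := by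
  obtain rfl : F' = fun i => fderiv ℝ (F i) :=
    funext fun i => funext fun x => (hd i x).fderiv.symm
  exact ⟨hF, unifMap_succ.2 ⟨fun i x => (hd i x).differentiableAt, h⟩⟩

theorem of_succ (h : UnifBdd (n + 1) F) : UnifBdd n F := ⟨h.bounded, h.unifMap.of_succ⟩

theorem reindex (h : UnifBdd n F) (φ : κ → ι) : UnifBdd n (fun k => F (φ k)) :=
  ⟨h.bounded.imp fun _ hC _ => hC _, h.unifMap.reindex φ⟩

protected theorem const {c : ι → V} {C : ℝ} (hc : ∀ i, ‖c i‖ ≤ C) :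
    UnifBdd n (fun i (_ : E) => c i) := by
  have hb : ∃ C : ℝ≥0, ∀ (i : ι) (_ : E), ‖c i‖ ≤ C :=
    ⟨C.toNNReal, fun i _ => (hc i).trans (Real.le_coe_toNNReal C)⟩
  induction n generalizing V C with
  | zero => exact ⟨hb, 0, fun i => LipschitzWith.const _⟩
  | succ n ih =>
    exact of_hasFDerivAt hb (fun i x => hasFDerivAt_const _ x)
      (ih (C := 0) (by simp) ⟨0, by simp⟩)

theorem add (hF : UnifBdd n F) (hG : UnifBdd n G) : UnifBdd n (fun i x => F i x + G i x) := by
  have hb : ∃ C : ℝ≥0, ∀ i x, ‖F i x + G i x‖ ≤ C := by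
    obtain ⟨C, hC⟩ := hF.bounded
    obtain ⟨D, hD⟩ := hG.bounded
    exact ⟨C + D, fun i x => norm_add_le_of_le (hC i x) (hD i x)⟩
  induction n generalizing V with
  | zero =>
    obtain ⟨K, hK⟩ := hF.unifMap
    obtain ⟨L, hL⟩ := hG.unifMap
    exact ⟨hb, K + L, fun i => (hK i).add (hL i)⟩
  | succ n ih =>
    obtain ⟨C, hC⟩ := hF.fderiv.bounded
    obtain ⟨D, hD⟩ := hG.fderiv.bounded
    exact of_hasFDerivAt hb (fun i x => (hF.hasFDerivAt i x).add (hG.hasFDerivAt i x))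
      (ih hF.fderiv hG.fderiv ⟨C + D, fun i x => norm_add_le_of_le (hC i x) (hD i x)⟩)

theorem exists_bound_bilin (B : V →L[ℝ] W →L[ℝ] U) {F : ι → E → V} {G : ι → E → W}
    (hF : UnifBdd n F) (hG : UnifBdd n G) : ∃ C : ℝ≥0, ∀ i x, ‖B (F i x) (G i x)‖ ≤ C := by
  obtain ⟨C, hC⟩ := hF.bounded
  obtain ⟨D, hD⟩ := hG.bounded
  exact ⟨‖B‖₊ * C * D, fun i x => B.le_of_opNorm₂_le_of_le le_rfl (hC i x) (hD i x)⟩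

theorem lipschitz_bilin (B : V →L[ℝ] W →L[ℝ] U) {F : ι → E → V} {G : ι → E → W}
    (hF : UnifBdd n F) (hG : UnifBdd n G) :
    ∃ K, ∀ i, LipschitzWith K (fun x => B (F i x) (G i x)) := by
  obtain ⟨C, hC⟩ := hF.bounded
  obtain ⟨D, hD⟩ := hG.bounded
  obtain ⟨K, hK⟩ := hF.unifMap.lipschitz
  obtain ⟨L, hL⟩ := hG.unifMap.lipschitz
  refine ⟨‖B‖₊ * K * D + ‖B‖₊ * C * L, fun i => lipschitzWith_iff_norm_sub_le.2 fun x y => ?_⟩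
  calc ‖B (F i x) (G i x) - B (F i y) (G i y)‖
      = ‖B (F i x - F i y) (G i x) + B (F i y) (G i x - G i y)‖ := by simp
    _ ≤ ‖B‖ * (K * ‖x - y‖) * D + ‖B‖ * C * (L * ‖x - y‖) :=
        norm_add_le_of_le
          (B.le_of_opNorm₂_le_of_le le_rfl ((hK i).norm_sub_le x y) (hD i x))
          (B.le_of_opNorm₂_le_of_le le_rfl (hC i y) ((hL i).norm_sub_le x y))
    _ = _ := by push_cast; ring

theorem bilin (B : V →L[ℝ] W →L[ℝ] U) {F : ι → E → V} {G : ι → E → W}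
    (hF : UnifBdd n F) (hG : UnifBdd n G) : UnifBdd n (fun i x => B (F i x) (G i x)) := by
  induction n generalizing V W U with
  | zero => exact ⟨exists_bound_bilin B hF hG, lipschitz_bilin B hF hG⟩
  | succ n ih =>
    exact of_hasFDerivAt (exists_bound_bilin B hF hG)
      (fun i x => B.hasFDerivAt_of_bilinear (hF.hasFDerivAt i x) (hG.hasFDerivAt i x))
      ((ih (B.precompR E) hF.of_succ hG.fderiv).add (ih (B.precompL E) hF.fderiv hG.of_succ))

theorem clm (h : UnifBdd n F) (L : V →L[ℝ] W) : UnifBdd n (fun i x => L (F i x)) :=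
  bilin (ContinuousLinearMap.id ℝ (V →L[ℝ] W)) (UnifBdd.const fun _ : ι => le_refl ‖L‖) h

theorem smul {f : ι → E → ℝ} (hf : UnifBdd n f) (h : UnifBdd n F) :
    UnifBdd n (fun i x => f i x • F i x) :=
  bilin (ContinuousLinearMap.lsmul ℝ ℝ) hf h

theorem const_smul (h : UnifBdd n F) {c : ι → ℝ} {C : ℝ} (hc : ∀ i, |c i| ≤ C) :
    UnifBdd n (fun i x => c i • F i x) :=
  (UnifBdd.const hc).smul h

theorem mul {f g : ι → E → ℝ} (hf : UnifBdd n f) (hg : UnifBdd n g) :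
    UnifBdd n (fun i x => f i x * g i x) :=
  hf.smul hg

theorem neg (h : UnifBdd n F) : UnifBdd n (fun i x => -F i x) :=
  h.clm (-ContinuousLinearMap.id ℝ V)

theorem sub (hF : UnifBdd n F) (hG : UnifBdd n G) : UnifBdd n (fun i x => F i x - G i x) := by
  simpa only [sub_eq_add_neg] using hF.add hG.neg

theorem sum {G : κ → ι → E → V} (s : Finset κ) (hG : ∀ k ∈ s, UnifBdd n (G k)) :
    UnifBdd n (fun i x => ∑ k ∈ s, G k i x) := by
  induction s using Finset.cons_induction with
  | empty => exact UnifBdd.const (c := fun _ => 0) (C := 0) (by simp)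
  | cons k s hk ih =>
    simp only [Finset.sum_cons]
    exact (hG k (Finset.mem_cons_self k s)).add
      (ih fun l hl => hG l (Finset.mem_cons_of_mem hl))

theorem weighted_sum {s : ι → Finset κ} {c : κ → ℝ} {M : ℝ≥0}
    (hM : ∀ i, ∑ k ∈ s i, |c k| ≤ M) {F : ι × κ → E → V} (hF : UnifBdd n F) :
    UnifBdd n (fun i x => ∑ k ∈ s i, c k • F (i, k) x) := by
  have norm_le {X : Type} [NormedAddCommGroup X] [NormedSpace ℝ X] (i : ι) {v : κ → X} {C : ℝ}
      (hC0 : 0 ≤ C) (hC : ∀ k, ‖v k‖ ≤ C) : ‖∑ k ∈ s i, c k • v k‖ ≤ M * C := calc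
    ‖∑ k ∈ s i, c k • v k‖ ≤ ∑ k ∈ s i, |c k| * C :=
        norm_sum_le_of_le _ fun k _ => (norm_smul _ _).trans_le
          (mul_le_mul_of_nonneg_left (hC k) (abs_nonneg _))
    _ ≤ M * C := by
        rw [← Finset.sum_mul]
        exact mul_le_mul_of_nonneg_right (hM i) hC0
  have hb : ∃ C : ℝ≥0, ∀ i x, ‖∑ k ∈ s i, c k • F (i, k) x‖ ≤ C := by
    obtain ⟨C, hC⟩ := hF.bounded
    exact ⟨M * C, fun i x => norm_le i C.2 fun k => hC _ _⟩
  induction n generalizing V with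
  | zero =>
    obtain ⟨K, hK⟩ := hF.unifMap
    refine ⟨hb, M * K, fun i => lipschitzWith_iff_norm_sub_le.2 fun x y => ?_⟩
    simp only [← Finset.sum_sub_distrib, ← smul_sub]
    push_cast [mul_assoc]
    exact norm_le i (by positivity) fun k => (hK _).norm_sub_le x y
  | succ n ih =>
    obtain ⟨C, hC⟩ := hF.fderiv.bounded
    exact of_hasFDerivAt hb
      (fun i x => HasFDerivAt.fun_sum fun k _ => (hF.hasFDerivAt (i, k) x).const_smul (c k))
      (ih hF.fderiv ⟨M * C, fun i x => norm_le i C.2 fun k => hC _ _⟩)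

theorem comp {F : ι → W → V} {φ : ι → E → W} (hF : UnifBdd n F) (hφ : UnifMap n φ) :
    UnifBdd n (fun i x => F i (φ i x)) := by
  have hb : ∃ C : ℝ≥0, ∀ i x, ‖F i (φ i x)‖ ≤ C := hF.bounded.imp fun _ hC i x => hC i _
  induction n generalizing V with
  | zero =>
    obtain ⟨K, hK⟩ := hF.unifMap
    obtain ⟨L, hL⟩ := hφ
    exact ⟨hb, K * L, fun i => (hK i).comp (hL i)⟩
  | succ n ih =>
    exact of_hasFDerivAt hb (fun i x => (hF.hasFDerivAt i _).comp x (hφ.1 i x).hasFDerivAt)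
      (bilin (ContinuousLinearMap.compL ℝ E W V)
        (ih hF.fderiv hφ.of_succ (hF.fderiv.bounded.imp fun _ hC i x => hC i _))
        (unifMap_succ.1 hφ).2)

end UnifBdd

namespace UnifSmooth

variable {F : ι → E → V}

theorem contDiff (h : UnifSmooth F) (i : ι) : ContDiff ℝ ∞ (F i) :=
  contDiff_infty.2 fun n => (h n).unifMap.contDiff i

protected theorem fderiv (h : UnifSmooth F) : UnifSmooth (fun i => fderiv ℝ (F i)) :=
  fun n => (h (n + 1)).fderiv

end UnifSmooth

end UnifBdd

section ODE

variable {ι : Type*} {E V : Type} [NormedAddCommGroup E] [NormedSpace ℝ E]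
  [NormedAddCommGroup V] [NormedSpace ℝ V] {n : ℕ}

theorem norm_le_of_norm_deriv_le {y y' : ℝ → V} {K c : ℝ≥0}
    (hy : ∀ t ∈ Icc (0 : ℝ) 1, HasDerivWithinAt y (y' t) (Icc 0 1) t)
    (hy' : ∀ t ∈ Icc (0 : ℝ) 1, ‖y' t‖ ≤ K * ‖y t‖ + c) {t : ℝ} (ht : t ∈ Icc (0 : ℝ) 1) :
    ‖y t‖ ≤ (‖y 0‖ + c) * Real.exp (K + 1) := by
  have hgronwall := norm_le_gronwallBound_of_norm_deriv_right_le (δ := ‖y 0‖) (K := K + 1) (ε := c)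
    (fun t ht => (hy t ht).continuousWithinAt)
    (fun t ht => (hy t (Ico_subset_Icc_self ht)).mono_of_mem_nhdsWithin
      (Icc_mem_nhdsGE_of_mem ht)) le_rfl
    (fun t ht => (hy' t (Ico_subset_Icc_self ht)).trans (by linarith [norm_nonneg (y t)])) t ht
  rw [gronwallBound_of_K_ne_0 (by positivity), sub_zero] at hgronwall
  have hexp : Real.exp ((K + 1) * t) ≤ Real.exp (K + 1) :=
    Real.exp_le_exp.2 (mul_le_of_le_one_right (by positivity) ht.2)
  have hexp' : 1 ≤ Real.exp ((K + 1) * t) := Real.one_le_exp (mul_nonneg (by positivity) ht.1)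
  calc ‖y t‖ ≤ ‖y 0‖ * Real.exp ((K + 1) * t) + c / (K + 1) * (Real.exp ((K + 1) * t) - 1) :=
        hgronwall
    _ ≤ ‖y 0‖ * Real.exp (K + 1) + c * Real.exp (K + 1) := by
      gcongr
      · exact div_le_self c.2 (by simp)
      · linarith
    _ = _ := by ring

theorem norm_le_of_linear_ode {A : ℝ → V →L[ℝ] V} {b w : ℝ → V} {K c : ℝ≥0}
    (hw : IsIntegralCurveOn w (fun t v => A t v + b t) (Icc 0 1))
    (hA : ∀ t ∈ Icc (0 : ℝ) 1, ‖A t‖ ≤ K) (hb : ∀ t ∈ Icc (0 : ℝ) 1, ‖b t‖ ≤ c) {t : ℝ}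
    (ht : t ∈ Icc (0 : ℝ) 1) : ‖w t‖ ≤ (‖w 0‖ + c) * Real.exp (K + 1) :=
  norm_le_of_norm_deriv_le hw
    (fun t ht => norm_add_le_of_le ((A t).le_of_opNorm_le (hA t ht) _) (hb t ht)) ht

theorem exists_lipschitz_truncation [FiniteDimensional ℝ V] {R : ℝ} (hR : 0 < R) :
    ∃ (χ : V → V) (K M : ℝ≥0), LipschitzWith K χ ∧ (∀ w, ‖χ w‖ ≤ M) ∧ (∀ w, ‖χ w‖ ≤ ‖w‖) ∧
      ∀ w, ‖w‖ ≤ R → χ w = w := by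
  let f : ContDiffBump (0 : V) := ⟨R, R + 1, hR, lt_add_one R⟩
  have hsmooth : ContDiff ℝ 1 fun w => f w • w := f.contDiff.smul contDiff_id
  have hsupp : HasCompactSupport fun w => f w • w := f.hasCompactSupport.smul_right
  obtain ⟨K, hK⟩ := hsmooth.lipschitzWith_of_hasCompactSupport hsupp one_ne_zero
  obtain ⟨M, hM⟩ := hsupp.exists_bound_of_continuous hsmooth.continuous
  refine ⟨fun w => f w • w, K, M.toNNReal, hK, fun w => (hM w).trans (Real.le_coe_toNNReal M),
    fun w => ?_, fun w hw => ?_⟩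
  · rw [norm_smul, Real.norm_of_nonneg f.nonneg]
    exact mul_le_of_le_one_left (norm_nonneg w) f.le_one
  · simp only [f.one_of_mem_closedBall (mem_closedBall_zero_iff.2 hw), one_smul]

theorem exists_linear_ode_solution [FiniteDimensional ℝ V] {A : ℝ → V →L[ℝ] V} {b : ℝ → V}
    (hA : ContinuousOn A (Icc 0 1)) (hb : ContinuousOn b (Icc 0 1)) (w₀ : V) :
    ∃ w : ℝ → V, w 0 = w₀ ∧ IsIntegralCurveOn w (fun t v => A t v + b t) (Icc 0 1) := by
  have : CompleteSpace V := FiniteDimensional.complete ℝ V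
  obtain ⟨CA, hCA⟩ := isCompact_Icc.exists_bound_of_continuousOn hA
  obtain ⟨Cb, hCb⟩ := isCompact_Icc.exists_bound_of_continuousOn hb
  replace hCA : ∀ t ∈ Icc (0 : ℝ) 1, ‖A t‖ ≤ CA.toNNReal :=
    fun t ht => (hCA t ht).trans (Real.le_coe_toNNReal CA)
  replace hCb : ∀ t ∈ Icc (0 : ℝ) 1, ‖b t‖ ≤ Cb.toNNReal :=
    fun t ht => (hCb t ht).trans (Real.le_coe_toNNReal Cb)
  -- Truncated outside the ball that Gronwall's inequality confines solutions to, the equation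
  -- has the same solutions and its right-hand side is bounded.
  set R : ℝ := (‖w₀‖ + Cb.toNNReal) * Real.exp (CA.toNNReal + 1) + 1
  obtain ⟨χ, K, M, hlip, hM, hle, heq⟩ :=
    exists_lipschitz_truncation (V := V) (R := R) (by positivity)
  have hpl : IsPicardLindelof (fun t v => A t (χ v) + b t)
      (⟨0, left_mem_Icc.2 zero_le_one⟩ : Icc (0 : ℝ) 1) w₀ (CA.toNNReal * M + Cb.toNNReal) 0
      (CA.toNNReal * M + Cb.toNNReal) (CA.toNNReal * K) :=
    { lipschitzOnWith := fun t ht =>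
        ((((A t).lipschitz.weaken (hCA t ht)).comp hlip).add (LipschitzWith.const (b t))
          |>.weaken (by simp)).lipschitzOnWith
      continuousOn := fun v _ => (hA.clm_apply continuousOn_const).add hb
      norm_le := fun t ht v _ => by
        push_cast
        exact norm_add_le_of_le ((A t).le_of_opNorm_le_of_le (hCA t ht) (hM v)) (hCb t ht)
      mul_max_le := by simp }
  obtain ⟨w, hw₀, hw⟩ := hpl.exists_eq_forall_mem_Icc_hasDerivWithinAt₀
  have hwR : ∀ t ∈ Icc (0 : ℝ) 1, ‖w t‖ ≤ R := fun t ht => by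
    refine (norm_le_of_norm_deriv_le hw (fun t ht => norm_add_le_of_le
      ((A t).le_of_opNorm_le_of_le (hCA t ht) (hle _)) (hCb t ht)) ht).trans ?_
    rw [show w 0 = w₀ from hw₀]
    exact (lt_add_one _).le
  exact ⟨w, hw₀, fun t ht => by simpa only [heq _ (hwR t ht)] using hw t ht⟩

theorem exists_global_flow [CompleteSpace V] {X : V → V} {L K : ℝ≥0} (hX : ContDiff ℝ 1 X)
    (hL : ∀ x, ‖X x‖ ≤ L) (hK : LipschitzWith K X) :
    ∃ Φ : ℝ → V → V, ∀ x, Φ 0 x = x ∧ ∀ t, HasDerivAt (fun s => Φ s x) (X (Φ t x)) t := by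
  have hlocal : ∀ x, ∃ γ : ℝ → V, γ 0 = x ∧
      IsMIntegralCurveOn (I := modelWithCornersSelf ℝ V) γ X (Ioo (-1) 1) := fun x => by
    have hpl : IsPicardLindelof (fun _ => X) (⟨0, by norm_num⟩ : Icc (-1 : ℝ) 1) x L 0 L K :=
      .of_time_independent (fun y _ => hL y) hK.lipschitzOnWith (by simp)
    obtain ⟨γ, hγ₀, hγ⟩ := hpl.exists_eq_forall_mem_Icc_hasDerivWithinAt₀
    exact ⟨γ, hγ₀, fun t ht => ((hγ t (Ioo_subset_Icc_self ht)).mono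
      Ioo_subset_Icc_self).hasFDerivWithinAt.hasMFDerivWithinAt⟩
  choose γ hγ₀ hγ using exists_isMIntegralCurve_of_isMIntegralCurveOn
    (contMDiff_vectorSpace_iff_contDiff.2 hX) one_pos hlocal
  refine ⟨fun t x => γ x t, fun x => ⟨hγ₀ x, fun t => ?_⟩⟩
  have hderiv : HasFDerivAt (γ x) ((1 : ℝ →L[ℝ] ℝ).smulRight (X (γ x t))) t :=
    (hγ x t).hasFDerivAt
  simpa using hderiv.hasDerivAt

theorem UnifBdd.taylor {F : ι → E → V} (h : UnifBdd (n + 1) F) :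
    ∃ C : ℝ≥0, ∀ i x z, ‖F i z - F i x - fderiv ℝ (F i) x (z - x)‖ ≤ C * ‖z - x‖ ^ 2 := by
  obtain ⟨C, hC⟩ := h.fderiv.unifMap.lipschitz
  refine ⟨C, fun i x z => ?_⟩
  rw [sq, ← mul_assoc]
  exact (convex_segment x z).norm_image_sub_le_of_norm_fderiv_le'
    (fun y _ => (h.hasFDerivAt i y).differentiableAt)
    (fun y hy => ((hC i).norm_sub_le y x).trans
      (mul_le_mul_of_nonneg_left (norm_sub_le_of_mem_segment hy) C.2))
    (left_mem_segment ℝ x z) (right_mem_segment ℝ x z)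

theorem UnifBdd.norm_slope_sub_le {F : ι → E → V} (h : UnifBdd (n + 1) F) (v : E) :
    ∃ C : ℝ≥0, ∀ i x, ∀ r > 0,
      ‖r⁻¹ • (F i (x + r • v) - F i x) - fderiv ℝ (F i) x v‖ ≤ C * r := by
  obtain ⟨C, hC⟩ := h.taylor
  refine ⟨C * ‖v‖₊ ^ 2, fun i x r hr => ?_⟩
  have hslope : r⁻¹ • (F i (x + r • v) - F i x) - fderiv ℝ (F i) x v =
      r⁻¹ • (F i (x + r • v) - F i x - fderiv ℝ (F i) x (r • v)) := by
    rw [smul_sub _ _ (fderiv ℝ (F i) x (r • v)), map_smul, inv_smul_smul₀ hr.ne']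
  have hC' := hC i x (x + r • v)
  rw [add_sub_cancel_left, norm_smul, Real.norm_of_nonneg hr.le] at hC'
  calc _ ≤ r⁻¹ * (C * (r * ‖v‖) ^ 2) := by
        rw [hslope, norm_smul, norm_inv, Real.norm_of_nonneg hr.le]
        gcongr
    _ = _ := by
        push_cast
        field_simp

theorem UnifBdd.continuous_fderiv [FiniteDimensional ℝ E] {T : Type*} [TopologicalSpace T]
    {F : T → E → V} (h : UnifBdd (n + 1) F) (hc : ∀ x, Continuous fun t => F t x) (x : E) :
    Continuous fun t => fderiv ℝ (F t) x := by
  rw [continuous_clm_apply]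
  intro v
  obtain ⟨C, hC⟩ := h.norm_slope_sub_le v
  refine continuous_of_uniform_approx_of_continuous fun u hu => ?_
  obtain ⟨e, he, hu⟩ := Metric.mem_uniformity_dist.1 hu
  have hr : 0 < e / (C + 1) := by positivity
  refine ⟨fun t => (e / (C + 1))⁻¹ • (F t (x + (e / (C + 1)) • v) - F t x),
    ((hc _).sub (hc _)).const_smul _, fun t => hu ?_⟩
  rw [dist_eq_norm, norm_sub_rev]
  calc _ ≤ C * (e / (C + 1)) := hC t x _ hr
    _ < (C + 1) * (e / (C + 1)) := by gcongr; linarith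
    _ = e := by field_simp

theorem hasFDerivAt_of_variation {y y' : ℝ → E → V} {v : ℝ → E →L[ℝ] V} {A : ℝ → V →L[ℝ] V}
    {B : ℝ → E →L[ℝ] V} {x : E} {K C : ℝ≥0}
    (hy : ∀ z, ∀ t ∈ Icc (0 : ℝ) 1, HasDerivWithinAt (fun s => y s z) (y' t z) (Icc 0 1) t)
    (hv : IsIntegralCurveOn v (fun t v => (A t).comp v + B t) (Icc 0 1))
    (hA : ∀ t ∈ Icc (0 : ℝ) 1, ‖A t‖ ≤ K)
    (hy' : ∀ t ∈ Icc (0 : ℝ) 1, ∀ z,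
      ‖y' t z - y' t x - A t (y t z - y t x) - B t (z - x)‖ ≤ C * ‖z - x‖ ^ 2)
    (h0 : HasFDerivAt (y 0) (v 0) x) {t : ℝ}
    (ht : t ∈ Icc (0 : ℝ) 1) : HasFDerivAt (y t) (v t) x := by
  have hremainder : ∀ z, ‖y t z - y t x - v t (z - x)‖ ≤
      Real.exp (K + 1) * (‖y 0 z - y 0 x - v 0 (z - x)‖ + C * ‖z - x‖ ^ 2) := fun z => by
    rw [mul_comm]
    refine norm_le_of_linear_ode (A := A) (w := fun s => y s z - y s x - v s (z - x))
      (b := fun s => y' s z - y' s x - A s (y s z - y s x) - B s (z - x)) (c := C * ‖z - x‖₊ ^ 2)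
      (fun s hs => (((hy z s hs).fun_sub (hy x s hs)).fun_sub ((hv s hs).clm_apply
        (hasDerivWithinAt_const s _ (z - x)))).congr_deriv ?_)
      hA (fun s hs => by simpa using hy' s hs z) ht
    simp only [add_apply, ContinuousLinearMap.comp_apply, map_sub, map_zero]
    abel
  rw [hasFDerivAt_iff_isLittleO] at h0 ⊢
  have hsq : (fun z => ‖z - x‖ ^ 2) =o[𝓝 x] fun z => z - x :=
    (Asymptotics.isLittleO_norm_pow_id one_lt_two).comp_tendsto
      (tendsto_sub_nhds_zero_iff.2 tendsto_id)
  refine (Asymptotics.IsBigO.of_bound (Real.exp (K + 1)) (.of_forall fun z => ?_)).trans_isLittleO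
    (h0.norm_left.add (hsq.const_mul_left (C : ℝ)))
  exact (hremainder z).trans (by gcongr; exact le_abs_self _)

end ODE

section FlowRegularity

variable {ι : Type*} {E V : Type} [NormedAddCommGroup E] [NormedSpace ℝ E]
  [NormedAddCommGroup V] [NormedSpace ℝ V] {n : ℕ}

theorem isIntegralCurveOn_congr {v : ℝ → V → V} {γ γ' : ℝ → V} {s : Set ℝ}
    (h : IsIntegralCurveOn γ v s) (heq : EqOn γ' γ s) : IsIntegralCurveOn γ' v s :=
  fun t ht => heq ht ▸ (h t ht).congr heq (heq ht)

/-- The time-dependent family `w`, restricted to times in `[0, 1]`, with time as part of the index: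
bounds on it are uniform in time. -/
abbrev timeFamily (w : ι → ℝ → E → V) : ι × Icc (0 : ℝ) 1 → E → V := fun a x => w a.1 a.2 x

/-- On `[0, 1]` the functions `w i · x` solve the linear equation `w' = A w + b`, whose
coefficients are continuous in time. -/
structure SolvesLinearODE (A : ι → ℝ → E → V →L[ℝ] V) (b w : ι → ℝ → E → V) : Prop where
  continuousOn_coeff : ∀ i x, ContinuousOn (fun t => A i t x) (Icc 0 1)
  continuousOn_inhom : ∀ i x, ContinuousOn (fun t => b i t x) (Icc 0 1)
  isIntegralCurveOn : ∀ i x,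
    IsIntegralCurveOn (fun t => w i t x) (fun t v => A i t x v + b i t x) (Icc 0 1)

namespace SolvesLinearODE

variable {A : ι → ℝ → E → V →L[ℝ] V} {b w : ι → ℝ → E → V}

theorem exists_bound (hw : SolvesLinearODE A b w) (hA : UnifBdd n (timeFamily A))
    (hb : UnifBdd n (timeFamily b)) (hw₀ : UnifBdd n (fun i x => w i 0 x)) :
    ∃ C : ℝ≥0, ∀ a x, ‖timeFamily w a x‖ ≤ C := by
  obtain ⟨CA, hCA⟩ := hA.bounded
  obtain ⟨Cb, hCb⟩ := hb.bounded
  obtain ⟨C₀, hC₀⟩ := hw₀.bounded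
  refine ⟨(C₀ + Cb) * (Real.exp (CA + 1)).toNNReal, fun a x => ?_⟩
  refine (norm_le_of_linear_ode (hw.isIntegralCurveOn a.1 x) (fun t ht => hCA (a.1, ⟨t, ht⟩) x)
    (fun t ht => hCb (a.1, ⟨t, ht⟩) x) a.2.2).trans ?_
  push_cast [Real.coe_toNNReal _ (Real.exp_pos _).le]
  gcongr
  exact hC₀ _ _

theorem exists_lipschitz (hw : SolvesLinearODE A b w) (hA : UnifBdd n (timeFamily A))
    (hb : UnifBdd n (timeFamily b)) (hw₀ : UnifBdd n (fun i x => w i 0 x)) :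
    ∃ K, ∀ a, LipschitzWith K (timeFamily w a) := by
  obtain ⟨CA, hCA⟩ := hA.bounded
  obtain ⟨KA, hKA⟩ := hA.unifMap.lipschitz
  obtain ⟨Kb, hKb⟩ := hb.unifMap.lipschitz
  obtain ⟨K₀, hK₀⟩ := hw₀.unifMap.lipschitz
  obtain ⟨M, hM⟩ := hw.exists_bound hA hb hw₀
  refine ⟨(K₀ + (KA * M + Kb)) * (Real.exp (CA + 1)).toNNReal, fun a =>
    lipschitzWith_iff_norm_sub_le.2 fun x z => ?_⟩
  have hdiff : IsIntegralCurveOn (fun t => w a.1 t x - w a.1 t z) (fun t v =>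
      A a.1 t x v + ((A a.1 t x - A a.1 t z) (w a.1 t z) + (b a.1 t x - b a.1 t z))) (Icc 0 1) :=
    fun t ht => ((hw.isIntegralCurveOn a.1 x t ht).fun_sub
      (hw.isIntegralCurveOn a.1 z t ht)).congr_deriv (by simp only [map_sub, sub_apply]; abel)
  refine (norm_le_of_linear_ode hdiff (c := (KA * M + Kb) * ‖x - z‖₊)
    (fun t ht => hCA (a.1, ⟨t, ht⟩) x) (fun t ht => ?_) a.2.2).trans ?_
  · push_cast
    rw [add_mul, mul_right_comm]
    exact norm_add_le_of_le (ContinuousLinearMap.le_of_opNorm_le_of_le _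
      ((hKA (a.1, ⟨t, ht⟩)).norm_sub_le x z) (hM (a.1, ⟨t, ht⟩) z))
      ((hKb (a.1, ⟨t, ht⟩)).norm_sub_le x z)
  · push_cast [Real.coe_toNNReal _ (Real.exp_pos _).le]
    rw [mul_right_comm, add_mul (K₀ : ℝ)]
    gcongr
    exact (hK₀ a.1).norm_sub_le x z

/-- The inhomogeneity `(∂_x A) w + ∂_x b` of the equation satisfied by `∂_x w`. -/
def derivInhom (A : ι → ℝ → E → V →L[ℝ] V) (b w : ι → ℝ → E → V) (i : ι) (t : ℝ) (x : E) :
    E →L[ℝ] V :=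
  (fderiv ℝ (A i t) x).flip (w i t x) + fderiv ℝ (b i t) x

theorem unifBdd_derivInhom (hA : UnifBdd (n + 1) (timeFamily A))
    (hb : UnifBdd (n + 1) (timeFamily b)) (hw : UnifBdd n (timeFamily w)) :
    UnifBdd n (timeFamily (derivInhom A b w)) :=
  (UnifBdd.bilin (ContinuousLinearMap.flipₗᵢ ℝ E V V).toContinuousLinearEquiv.toContinuousLinearMap
    hA.fderiv hw).add hb.fderiv

theorem exists_norm_variation_le (hw : SolvesLinearODE A b w) (hA : UnifBdd (n + 1) (timeFamily A))
    (hb : UnifBdd (n + 1) (timeFamily b)) (hw₀ : UnifBdd (n + 1) (fun i x => w i 0 x)) :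
    ∃ C : ℝ≥0, ∀ i, ∀ t ∈ Icc (0 : ℝ) 1, ∀ x z,
      ‖A i t z (w i t z) + b i t z - (A i t x (w i t x) + b i t x) - A i t x (w i t z - w i t x) -
        derivInhom A b w i t x (z - x)‖ ≤ C * ‖z - x‖ ^ 2 := by
  obtain ⟨KA, hKA⟩ := hA.unifMap.lipschitz
  obtain ⟨TA, hTA⟩ := hA.taylor
  obtain ⟨Tb, hTb⟩ := hb.taylor
  obtain ⟨M, hM⟩ := hw.exists_bound hA hb hw₀
  obtain ⟨Kw, hKw⟩ := hw.exists_lipschitz hA hb hw₀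
  refine ⟨KA * Kw + TA * M + Tb, fun i t ht x z => ?_⟩
  let a : ι × Icc (0 : ℝ) 1 := (i, ⟨t, ht⟩)
  have hsplit : A i t z (w i t z) + b i t z - (A i t x (w i t x) + b i t x) -
        A i t x (w i t z - w i t x) - derivInhom A b w i t x (z - x) =
      (A i t z - A i t x) (w i t z - w i t x) +
        (A i t z - A i t x - fderiv ℝ (A i t) x (z - x)) (w i t x) +
        (b i t z - b i t x - fderiv ℝ (b i t) x (z - x)) := by
    simp only [derivInhom, map_sub, sub_apply, add_apply, ContinuousLinearMap.flip_apply]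
    abel
  rw [hsplit]
  refine (norm_add_le_of_le (norm_add_le_of_le
    (ContinuousLinearMap.le_of_opNorm_le_of_le _ ((hKA a).norm_sub_le z x)
      ((hKw a).norm_sub_le z x))
    (ContinuousLinearMap.le_of_opNorm_le_of_le _ (hTA a x z) (hM a x))) (hTb a x z)).trans_eq ?_
  push_cast
  ring

variable [FiniteDimensional ℝ E]

theorem continuousOn_fderiv {F : ι → ℝ → E → V} (h : UnifBdd (n + 1) (timeFamily F))
    (hc : ∀ i x, ContinuousOn (fun t => F i t x) (Icc 0 1)) (i : ι) (x : E) :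
    ContinuousOn (fun t => fderiv ℝ (F i t) x) (Icc 0 1) := by
  rw [continuousOn_iff_continuous_domRestrict]
  exact (h.reindex fun t : Icc (0 : ℝ) 1 => (i, t)).continuous_fderiv
    (fun x => continuousOn_iff_continuous_domRestrict.1 (hc i x)) x

theorem continuousOn_derivInhom (hw : SolvesLinearODE A b w) (hA : UnifBdd (n + 1) (timeFamily A))
    (hb : UnifBdd (n + 1) (timeFamily b)) (i : ι) (x : E) :
    ContinuousOn (fun t => derivInhom A b w i t x) (Icc 0 1) :=
  (((ContinuousLinearMap.flipₗᵢ ℝ E V V).continuous.comp_continuousOn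
    (continuousOn_fderiv hA hw.continuousOn_coeff i x)).clm_apply
      fun t ht => (hw.isIntegralCurveOn i x t ht).continuousWithinAt).add
    (continuousOn_fderiv hb hw.continuousOn_inhom i x)

theorem differentiable_and_fderiv [FiniteDimensional ℝ V] (hw : SolvesLinearODE A b w)
    (hA : UnifBdd (n + 1) (timeFamily A)) (hb : UnifBdd (n + 1) (timeFamily b))
    (hw₀ : UnifBdd (n + 1) (fun i x => w i 0 x)) :
    (∀ a, Differentiable ℝ (timeFamily w a)) ∧
      SolvesLinearODE (fun i t x => ContinuousLinearMap.compL ℝ E V V (A i t x))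
        (derivInhom A b w) (fun i t => fderiv ℝ (w i t)) := by
  have hcoeff : ∀ i x, ContinuousOn (fun t => ContinuousLinearMap.compL ℝ E V V (A i t x))
      (Icc 0 1) := fun i x =>
    (ContinuousLinearMap.compL ℝ E V V).continuous.comp_continuousOn (hw.continuousOn_coeff i x)
  have hinhom := hw.continuousOn_derivInhom hA hb
  choose v hv₀ hv using fun i x =>
    exists_linear_ode_solution (hcoeff i x) (hinhom i x) (fderiv ℝ (w i 0) x)
  obtain ⟨CA, hCA⟩ := hA.bounded
  obtain ⟨C, hC⟩ := hw.exists_norm_variation_le hA hb hw₀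
  have hderiv : ∀ i x, ∀ t ∈ Icc (0 : ℝ) 1, HasFDerivAt (w i t) (v i x t) x := fun i x t ht =>
    hasFDerivAt_of_variation (hw.isIntegralCurveOn i) (hv i x)
      (fun t ht => hCA (i, ⟨t, ht⟩) x) (fun t ht z => hC i t ht x z)
      (by rw [hv₀]; exact hw₀.hasFDerivAt i x) ht
  exact ⟨fun a x => (hderiv a.1 x a.2 a.2.2).differentiableAt, hcoeff, hinhom, fun i x =>
    isIntegralCurveOn_congr (hv i x) fun t ht => (hderiv i x t ht).fderiv⟩

theorem unifBdd [FiniteDimensional ℝ V] (hw : SolvesLinearODE A b w)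
    (hA : UnifBdd n (timeFamily A)) (hb : UnifBdd n (timeFamily b))
    (hw₀ : UnifBdd n (fun i x => w i 0 x)) : UnifBdd n (timeFamily w) := by
  induction n generalizing V with
  | zero => exact ⟨hw.exists_bound hA hb hw₀, hw.exists_lipschitz hA hb hw₀⟩
  | succ n ih =>
    obtain ⟨hdiff, hfderiv⟩ := hw.differentiable_and_fderiv hA hb hw₀
    exact .of_hasFDerivAt (hw.exists_bound hA hb hw₀) (fun a x => (hdiff a x).hasFDerivAt)
      (ih hfderiv
        (hA.of_succ.clm (W := (E →L[ℝ] V) →L[ℝ] E →L[ℝ] V) (ContinuousLinearMap.compL ℝ E V V))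
        (unifBdd_derivInhom hA hb (ih hw hA.of_succ hb.of_succ hw₀.of_succ)) hw₀.fderiv)

end SolvesLinearODE

theorem UnifSmooth.timeIntegral [FiniteDimensional ℝ E] [FiniteDimensional ℝ V]
    {b w : ι → ℝ → E → V} (hb : UnifSmooth (timeFamily b))
    (hbc : ∀ i x, ContinuousOn (fun t => b i t x) (Icc 0 1)) (hw₀ : ∀ i x, w i 0 x = 0)
    (hw : ∀ i x, ∀ t ∈ Icc (0 : ℝ) 1,
      HasDerivWithinAt (fun s => w i s x) (b i t x) (Icc 0 1) t) :
    UnifSmooth (timeFamily w) := fun n =>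
  SolvesLinearODE.unifBdd (A := fun _ _ _ => 0)
    ⟨fun _ _ => continuousOn_const, hbc, fun i x t ht => by simpa using hw i x t ht⟩
    (.const (c := fun _ => 0) (C := 0) (by simp)) (hb n)
    (by simpa only [hw₀] using .const (c := fun _ => 0) (C := 0) (by simp))

variable {X : ι → E → E} {Φ : ι → ℝ → E → E}

theorem flow_lipschitz {K : ℝ≥0} (hX : ∀ i, LipschitzWith K (X i)) (hΦ₀ : ∀ i x, Φ i 0 x = x)
    (hΦ : ∀ i x, IsIntegralCurveOn (fun t => Φ i t x) (fun _ => X i) (Icc 0 1)) :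
    ∃ L, ∀ a, LipschitzWith L (timeFamily Φ a) := by
  refine ⟨(Real.exp (K + 1)).toNNReal, fun a =>
    lipschitzWith_iff_norm_sub_le.2 fun x y => ?_⟩
  have h := norm_le_of_norm_deriv_le (K := K) (c := 0)
    (fun t ht => (hΦ a.1 x t ht).fun_sub (hΦ a.1 y t ht))
    (fun t _ => by simpa using (hX a.1).norm_sub_le _ _) a.2.2
  simpa [hΦ₀, mul_comm, (Real.exp_pos _).le] using h

variable [FiniteDimensional ℝ E]

theorem flow_differentiable_and_fderiv (hX : UnifBdd (n + 2) X) (hΦ₀ : ∀ i x, Φ i 0 x = x)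
    (hΦ : ∀ i x, IsIntegralCurveOn (fun t => Φ i t x) (fun _ => X i) (Icc 0 1)) :
    (∀ a, Differentiable ℝ (timeFamily Φ a)) ∧
      SolvesLinearODE (fun i t x => ContinuousLinearMap.compL ℝ E E E (fderiv ℝ (X i) (Φ i t x)))
        (fun _ _ _ => 0) (fun i t => fderiv ℝ (Φ i t)) := by
  have hcoeff : ∀ i x, ContinuousOn
      (fun t => ContinuousLinearMap.compL ℝ E E E (fderiv ℝ (X i) (Φ i t x))) (Icc 0 1) :=
    fun i x => ((ContinuousLinearMap.compL ℝ E E E).continuous.comp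
      (hX.fderiv.unifMap.contDiff i).continuous).comp_continuousOn
        fun t ht => (hΦ i x t ht).continuousWithinAt
  choose v hv₀ hv using fun i x => exists_linear_ode_solution (hcoeff i x)
    (continuousOn_const (c := 0)) (ContinuousLinearMap.id ℝ E)
  obtain ⟨C, hC⟩ := hX.fderiv.bounded
  obtain ⟨K, hK⟩ := hX.unifMap.lipschitz
  obtain ⟨T, hT⟩ := hX.taylor
  obtain ⟨L, hL⟩ := flow_lipschitz hK hΦ₀ hΦ
  have hderiv : ∀ i x, ∀ t ∈ Icc (0 : ℝ) 1, HasFDerivAt (Φ i t) (v i x t) x := fun i x t ht => by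
    refine hasFDerivAt_of_variation (C := T * L ^ 2) (hΦ i) (hv i x) (fun t _ => hC i _)
      (fun t ht z => ?_) ?_ ht
    · calc _ ≤ T * ‖Φ i t z - Φ i t x‖ ^ 2 := by simpa using hT i (Φ i t x) (Φ i t z)
        _ ≤ T * (L * ‖z - x‖) ^ 2 := by gcongr; exact (hL (i, ⟨t, ht⟩)).norm_sub_le z x
        _ = _ := by push_cast; ring
    · rw [hv₀, show Φ i 0 = id from funext (hΦ₀ i)]
      exact hasFDerivAt_id x
  exact ⟨fun a x => (hderiv a.1 x a.2 a.2.2).differentiableAt, hcoeff,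
    fun _ _ => continuousOn_const, fun i x =>
      isIntegralCurveOn_congr (hv i x) fun t ht => (hderiv i x t ht).fderiv⟩

theorem unifMap_flow (hX : UnifSmooth X) (hΦ₀ : ∀ i x, Φ i 0 x = x)
    (hΦ : ∀ i x, IsIntegralCurveOn (fun t => Φ i t x) (fun _ => X i) (Icc 0 1)) (n : ℕ) :
    UnifMap n (timeFamily Φ) := by
  obtain ⟨hdiff, hfderiv⟩ := flow_differentiable_and_fderiv (hX 2) hΦ₀ hΦ
  induction n with
  | zero =>
    obtain ⟨K, hK⟩ := (hX 0).unifMap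
    exact flow_lipschitz hK hΦ₀ hΦ
  | succ n ih =>
    refine unifMap_succ.2
      ⟨hdiff, hfderiv.unifBdd ?_ (.const (c := fun _ => 0) (C := 0) (by simp)) ?_⟩
    · exact (((hX.fderiv n).reindex Prod.fst).comp ih).clm (ContinuousLinearMap.compL ℝ E E E)
    · simp only [show ∀ i, Φ i 0 = id from fun i => funext (hΦ₀ i), fderiv_id]
      exact .const fun _ => le_rfl

end FlowRegularity

section CoordinateDerivatives

variable {d : ℕ}

/-- The coordinate directions of `Phase d`: `Sum.inl j` is `p_j` and `Sum.inr j` is `q_j`. -/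
def coordDir : Fin d ⊕ Fin d → Phase d
  | Sum.inl j => (Pi.single j 1, 0)
  | Sum.inr j => (0, Pi.single j 1)

/-- The linear functional reading off a coordinate. -/
def coordProj : Fin d ⊕ Fin d → (Phase d →L[ℝ] ℝ)
  | Sum.inl j => (ContinuousLinearMap.proj j).comp (ContinuousLinearMap.fst ℝ _ _)
  | Sum.inr j => (ContinuousLinearMap.proj j).comp (ContinuousLinearMap.snd ℝ _ _)

/-- The partial derivative in a coordinate direction. -/
def coordDeriv (a : Fin d ⊕ Fin d) (f : Phase d → ℝ) : Phase d → ℝ :=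
  fun x => fderiv ℝ f x (coordDir a)

/-- The iterated partial derivative along a word of coordinate directions. -/
def wordDeriv (w : List (Fin d ⊕ Fin d)) (f : Phase d → ℝ) : Phase d → ℝ :=
  w.foldr coordDeriv f

/-- The word of the derivative `∂_p^α ∂_q^β`. -/
def multiWord (α β : Fin d → ℕ) : List (Fin d ⊕ Fin d) :=
  ((List.finRange d).flatMap fun j => List.replicate (α j) (Sum.inl j)) ++
    (List.finRange d).flatMap fun j => List.replicate (β j) (Sum.inr j)

theorem wordDeriv_append (w w' : List (Fin d ⊕ Fin d)) (f : Phase d → ℝ) :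
    wordDeriv (w ++ w') f = wordDeriv w (wordDeriv w' f) := List.foldr_append ..

theorem contDiff_coordDeriv (a : Fin d ⊕ Fin d) {f : Phase d → ℝ} (hf : ContDiff ℝ ∞ f) :
    ContDiff ℝ ∞ (coordDeriv a f) :=
  (hf.fderiv_right (m := ∞) (by simp)).clm_apply contDiff_const

theorem contDiff_wordDeriv (w : List (Fin d ⊕ Fin d)) {f : Phase d → ℝ} (hf : ContDiff ℝ ∞ f) :
    ContDiff ℝ ∞ (wordDeriv w f) := by
  induction w with
  | nil => exact hf
  | cons a w ih => exact contDiff_coordDeriv a ih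

theorem isSymmSndFDerivAt_of_contDiff {E V : Type*} [NormedAddCommGroup E] [NormedSpace ℝ E]
    [NormedAddCommGroup V] [NormedSpace ℝ V] {f : E → V} (hf : ContDiff ℝ ∞ f) (x : E) :
    IsSymmSndFDerivAt ℝ f x :=
  hf.contDiffAt.isSymmSndFDerivAt <| by
    rw [minSmoothness_of_isRCLikeNormedField]
    exact WithTop.coe_le_coe.2 le_top

theorem coordDeriv_comm (a b : Fin d ⊕ Fin d) {f : Phase d → ℝ} (hf : ContDiff ℝ ∞ f) :
    coordDeriv a (coordDeriv b f) = coordDeriv b (coordDeriv a f) := by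
  have hd : Differentiable ℝ (fderiv ℝ f) :=
    (hf.fderiv_right (m := ∞) (by simp)).differentiable (by simp)
  have hsnd (u v x : Phase d) :
      fderiv ℝ (fun y => fderiv ℝ f y u) x v = fderiv ℝ (fderiv ℝ f) x v u := by
    simp [fderiv_clm_apply (hd x) (differentiableAt_const _)]
  ext x
  exact (hsnd _ _ x).trans (((isSymmSndFDerivAt_of_contDiff hf x).eq _ _).trans (hsnd _ _ x).symm)

theorem wordDeriv_perm {w w' : List (Fin d ⊕ Fin d)} (h : w.Perm w') {f : Phase d → ℝ}
    (hf : ContDiff ℝ ∞ f) : wordDeriv w f = wordDeriv w' f := by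
  induction h with
  | nil => rfl
  | cons a _ ih => exact congrArg (coordDeriv a) ih
  | swap a b l => exact coordDeriv_comm b a (contDiff_wordDeriv l hf)
  | trans _ _ ih ih' => exact ih.trans ih'

theorem foldr_iterate_eq_wordDeriv (D : Fin d → Fin d ⊕ Fin d) (α : Fin d → ℕ) (l : List (Fin d))
    (f : Phase d → ℝ) : l.foldr (fun j g => (coordDeriv (D j))^[α j] g) f =
      wordDeriv (l.flatMap fun j => List.replicate (α j) (D j)) f := by
  have hrep (a : Fin d ⊕ Fin d) (n : ℕ) (g : Phase d → ℝ) :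
      (coordDeriv a)^[n] g = wordDeriv (List.replicate n a) g := by
    induction n with
    | zero => rfl
    | succ n ih => rw [Function.iterate_succ_apply', ih]; rfl
  induction l with
  | nil => rfl
  | cons j l ih => rw [List.foldr_cons, ih, List.flatMap_cons, wordDeriv_append, hrep]

theorem mixedPartial_eq_wordDeriv (α β : Fin d → ℕ) (f : Phase d → ℝ) :
    mixedPartial α β f = wordDeriv (multiWord α β) f := by
  rw [multiWord, wordDeriv_append, ← foldr_iterate_eq_wordDeriv, ← foldr_iterate_eq_wordDeriv]
  rfl

theorem coe_multiWord (α β : Fin d → ℕ) : (multiWord α β : Multiset (Fin d ⊕ Fin d)) =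
    ∑ j, α j • {Sum.inl j} + ∑ j, β j • {Sum.inr j} := by
  simp_rw [Multiset.nsmul_singleton, ← Multiset.coe_replicate]
  rw [multiWord, ← Multiset.coe_add, ← Multiset.coe_bind, ← Multiset.coe_bind]
  rfl

theorem exists_multiWord_perm (w : List (Fin d ⊕ Fin d)) : ∃ α β, (multiWord α β).Perm w := by
  let s : Multiset (Fin d ⊕ Fin d) := w
  refine ⟨fun j => s.count (Sum.inl j), fun j => s.count (Sum.inr j), ?_⟩
  rw [← Multiset.coe_eq_coe, coe_multiWord,
    ← Fintype.sum_sum_type fun a => s.count a • ({a} : Multiset (Fin d ⊕ Fin d)),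
    ← Finset.sum_subset s.toFinset.subset_univ (by simp +contextual),
    Multiset.toFinset_sum_count_nsmul_eq]

theorem countP_isLeft_multiWord (α β : Fin d → ℕ) :
    (multiWord α β).countP Sum.isLeft = ∑ j, α j := by
  rw [multiWord, List.countP_append, List.countP_flatMap, List.countP_flatMap]
  simp [Function.comp_def, List.countP_replicate, ← List.ofFn_eq_map, List.sum_ofFn]

theorem sum_coordProj_smul_coordDir (x : Phase d) : ∑ a, coordProj a x • coordDir a = x := by
  rw [Fintype.sum_sum_type]
  refine Prod.ext ?_ ?_ <;> ext j <;>
    simp [coordProj, coordDir, Finset.sum_apply, Pi.single_apply, Prod.fst_sum, Prod.snd_sum]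

variable {ι : Type*} {n : ℕ}

theorem eq_sum_smulRight_coordProj {V : Type} [NormedAddCommGroup V] [NormedSpace ℝ V]
    (L : Phase d →L[ℝ] V) : L = ∑ a, (coordProj a).smulRight (L (coordDir a)) := by
  refine ContinuousLinearMap.ext fun x => ?_
  conv_lhs => rw [← sum_coordProj_smul_coordDir x]
  simp [map_sum]

theorem unifBdd_of_wordDeriv {F : ι → Phase d → ℝ} (hF : ∀ i, ContDiff ℝ ∞ (F i))
    (h : ∀ w, ∃ C : ℝ≥0, ∀ i x, |wordDeriv w (F i) x| ≤ C) : UnifBdd n F := by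
  have hd (i : ι) : Differentiable ℝ (F i) := (hF i).differentiable (by simp)
  induction n generalizing F with
  | zero =>
    choose C hC using h
    refine ⟨⟨C [], hC []⟩, ∑ a, ‖coordProj (d := d) a‖₊ * C [a], fun i =>
      lipschitzWith_of_nnnorm_fderiv_le (hd i) fun x => ?_⟩
    rw [eq_sum_smulRight_coordProj (fderiv ℝ (F i) x), ← NNReal.coe_le_coe, coe_nnnorm]
    push_cast
    refine norm_sum_le_of_le _ fun a _ => ?_
    rw [ContinuousLinearMap.norm_smulRight_apply]
    exact mul_le_mul_of_nonneg_left (hC [a] i x) (norm_nonneg _)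
  | succ n ih =>
    have hcoord (a : Fin d ⊕ Fin d) : UnifBdd n (fun i => coordDeriv a (F i)) :=
      ih (fun i => contDiff_coordDeriv a (hF i))
        (fun w => by simpa only [wordDeriv_append] using! h (w ++ [a]))
        fun i => (contDiff_coordDeriv a (hF i)).differentiable (by simp)
    refine .of_hasFDerivAt (h []) (fun i x => (hd i x).hasFDerivAt) ?_
    rw [funext fun i => funext fun x => eq_sum_smulRight_coordProj (fderiv ℝ (F i) x)]
    exact .sum _ fun a _ =>
      (hcoord a).clm (ContinuousLinearMap.smulRightL ℝ (Phase d) ℝ (coordProj a))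

theorem UnifSmooth.coordDeriv {F : ι → Phase d → ℝ} (h : UnifSmooth F) (a : Fin d ⊕ Fin d) :
    UnifSmooth (fun i => coordDeriv a (F i)) :=
  fun n => (h.fderiv n).clm (ContinuousLinearMap.apply ℝ ℝ (coordDir a))

theorem UnifSmooth.wordDeriv {F : ι → Phase d → ℝ} (h : UnifSmooth F)
    (w : List (Fin d ⊕ Fin d)) : UnifSmooth (fun i => wordDeriv w (F i)) := by
  induction w with
  | nil => exact h
  | cons a w ih => exact ih.coordDeriv a

end CoordinateDerivatives

section ActionScaling

variable {d : ℕ}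

/-- The rescaling `(p, q) ↦ (r p, q)`. -/
def scale (r : ℝ) : Phase d →L[ℝ] Phase d :=
  (r • ContinuousLinearMap.id ℝ (Fin d → ℝ)).prodMap (ContinuousLinearMap.id ℝ (Fin d → ℝ))

@[simp] theorem scale_apply (r : ℝ) (x : Phase d) : scale r x = (r • x.1, x.2) := rfl

theorem scale_scale {r s : ℝ} (h : r * s = 1) (x : Phase d) : scale r (scale s x) = x := by
  simp [smul_smul, h]

theorem rpow_mul_rpow_neg {ε : ℝ} (hε : 0 < ε) (δ : ℝ) : ε ^ δ * ε ^ (-δ) = 1 := by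
  rw [← Real.rpow_add hε, add_neg_cancel, Real.rpow_zero]

theorem scale_rpow_scale_rpow_neg {ε : ℝ} (hε : 0 < ε) (δ : ℝ) (x : Phase d) :
    scale (ε ^ δ) (scale (ε ^ (-δ)) x) = x :=
  scale_scale (rpow_mul_rpow_neg hε δ) x

theorem scale_coordDir (r : ℝ) (a : Fin d ⊕ Fin d) :
    scale r (coordDir a) = r ^ (if a.isLeft then 1 else 0) • coordDir a := by
  cases a <;> simp [coordDir]

theorem wordDeriv_const_mul_comp_scale (w : List (Fin d ⊕ Fin d)) (c r : ℝ) {f : Phase d → ℝ}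
    (hf : ContDiff ℝ ∞ f) : wordDeriv w (fun x => c * f (scale r x)) =
      fun x => c * r ^ w.countP Sum.isLeft * wordDeriv w f (scale r x) := by
  induction w with
  | nil => simp [wordDeriv]
  | cons a w ih =>
    have hd : Differentiable ℝ (wordDeriv w f) :=
      (contDiff_wordDeriv w hf).differentiable (by simp)
    change coordDeriv a (wordDeriv w _) = fun x => _ * coordDeriv a (wordDeriv w f) _
    ext x
    have hx : HasFDerivAt (fun x => wordDeriv w f (scale r x)) _ x :=
      (hd (scale r x)).hasFDerivAt.comp x (scale r).hasFDerivAt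
    rw [ih, coordDeriv, (hx.const_mul _).fderiv, List.countP_cons, pow_add]
    simp only [smul_apply, ContinuousLinearMap.comp_apply, scale_coordDir, map_smul, smul_eq_mul,
      coordDeriv]
    ring

theorem scale_add_shift (r : ℝ) (x : Phase d) (k : Fin d → ℤ) :
    scale r (x + shift k) = scale r x + shift k := by
  simp [shift]

theorem IsPeriodic.comp_scale {f : Phase d → ℝ} (hf : IsPeriodic f) (r : ℝ) :
    IsPeriodic (fun x => f (scale r x)) := fun k x => by
  simp only [scale_add_shift, hf k]

theorem wordDeriv_rescaled {ε : ℝ} (hε : 0 < ε) {f : Phase d → ℝ} (hf : ContDiff ℝ ∞ f)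
    (w : List (Fin d ⊕ Fin d)) (δ m : ℝ) (y : Phase d) :
    wordDeriv w (fun y => ε ^ (-m) * f (scale (ε ^ δ) y)) y =
      wordDeriv w f (scale (ε ^ δ) y) / ε ^ m * ε ^ (((w.countP Sum.isLeft : ℕ) : ℝ) * δ) := by
  rw [wordDeriv_const_mul_comp_scale w _ _ hf, Real.rpow_neg hε.le, mul_comm _ δ,
    Real.rpow_mul hε.le, Real.rpow_natCast]
  ring

end ActionScaling

section TorusAverage

open MeasureTheory ProbabilityTheory
open scoped Pointwise

attribute [local instance] instMeasureSpaceUnitAddCircle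

/-- The normalized Lebesgue measure of the cell `[0, 2π]^d`, so that integrating a periodic function
against it means averaging over `𝕋^d`. -/
def torusMeasure (d : ℕ) : Measure (Fin d → ℝ) :=
  cond volume (Icc 0 fun _ => 2 * Real.pi)

/-- `f` is a function on `𝕋^d`. -/
def TorusPeriodic {d : ℕ} {V : Type*} (f : (Fin d → ℝ) → V) : Prop :=
  ∀ (k : Fin d → ℤ) (θ : Fin d → ℝ), f (θ + fun j => 2 * Real.pi * (k j : ℝ)) = f θ

/-- The projection `ℝ^d → 𝕋^d`, with `𝕋^d` modelled on Mathlib's `(ℝ/ℤ)^d`. -/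
def toTorus {d : ℕ} (θ : Fin d → ℝ) : UnitAddTorus (Fin d) :=
  fun j => ((θ j / (2 * Real.pi) : ℝ) : UnitAddCircle)

variable {d : ℕ} {V : Type*} [NormedAddCommGroup V]

theorem volume_two_pi_cell :
    volume (Icc (0 : Fin d → ℝ) fun _ => 2 * Real.pi) = ENNReal.ofReal ((2 * Real.pi) ^ d) := by
  rw [Real.volume_Icc_pi]
  simp [ENNReal.ofReal_pow Real.two_pi_pos.le]

instance : IsProbabilityMeasure (torusMeasure d) := by
  refine cond_isProbabilityMeasure_of_finite ?_ isCompact_Icc.measure_lt_top.ne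
  rw [volume_two_pi_cell, ENNReal.ofReal_ne_zero_iff]
  positivity

theorem integral_torusMeasure_eq_setIntegral [NormedSpace ℝ V] (f : (Fin d → ℝ) → V) :
    ∫ θ, f θ ∂torusMeasure d =
      (1 / (2 * Real.pi) ^ d : ℝ) • ∫ θ in Icc (0 : Fin d → ℝ) (fun _ => 2 * Real.pi), f θ := by
  rw [torusMeasure, ProbabilityTheory.cond, integral_smul_measure, volume_two_pi_cell,
    ENNReal.toReal_inv, ENNReal.toReal_ofReal (by positivity), one_div]

theorem integrable_torusMeasure {f : (Fin d → ℝ) → V} (hf : Continuous f) :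
    Integrable f (torusMeasure d) := by
  refine Integrable.smul_measure (hf.continuousOn.integrableOn_compact isCompact_Icc) ?_
  rw [volume_two_pi_cell, ENNReal.inv_ne_top, ENNReal.ofReal_ne_zero_iff]
  positivity

theorem toTorus_add (θ s : Fin d → ℝ) : toTorus (θ + s) = toTorus θ + toTorus s := by
  ext j; simp [toTorus, add_div]

theorem toTorus_sub (θ s : Fin d → ℝ) : toTorus (θ - s) = toTorus θ - toTorus s := by
  ext j; simp [toTorus, sub_div]

theorem toTorus_two_pi_smul (u : Fin d → ℝ) :
    toTorus ((2 * Real.pi) • u) = fun j => (u j : UnitAddCircle) := by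
  ext j; simp [toTorus, Real.two_pi_pos.ne']

theorem isOpenQuotientMap_toTorus :
    IsOpenQuotientMap (toTorus : (Fin d → ℝ) → UnitAddTorus (Fin d)) :=
  (IsOpenQuotientMap.piMap fun _ => QuotientAddGroup.isOpenQuotientMap_mk).comp
    (Homeomorph.piCongrRight fun _ =>
      Homeomorph.mulRight₀ (2 * Real.pi)⁻¹ (inv_ne_zero Real.two_pi_pos.ne')).isOpenQuotientMap

theorem TorusPeriodic.apply_eq_of_toTorus_eq {V : Type*} {f : (Fin d → ℝ) → V}
    (hf : TorusPeriodic f) {θ θ' : Fin d → ℝ} (h : toTorus θ = toTorus θ') : f θ = f θ' := by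
  have hk : ∀ j, ∃ k : ℤ, θ' j = θ j + 2 * Real.pi * k := fun j => by
    obtain ⟨k, hk⟩ := AddSubgroup.mem_zmultiples_iff.1 (QuotientAddGroup.eq.1 (congrFun h j))
    refine ⟨k, ?_⟩
    have := Real.pi_pos
    rw [zsmul_one] at hk
    rw [hk]
    field_simp
    ring
  choose k hk using hk
  rw [← hf k θ]
  exact congrArg f (funext fun j => (hk j).symm)

theorem TorusPeriodic.exists_toTorus_factor {V : Type*} [TopologicalSpace V]
    {f : (Fin d → ℝ) → V} (hf : TorusPeriodic f) (hc : Continuous f) :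
    ∃ F : C(UnitAddTorus (Fin d), V), ∀ θ, F (toTorus θ) = f θ :=
  let π : C(Fin d → ℝ, UnitAddTorus (Fin d)) := ⟨toTorus, isOpenQuotientMap_toTorus.continuous⟩
  have hπ : Topology.IsQuotientMap π := isOpenQuotientMap_toTorus.isQuotientMap
  have hfac : Function.FactorsThrough (⟨f, hc⟩ : C(Fin d → ℝ, V)) π := fun _ _ h =>
    hf.apply_eq_of_toTorus_eq h
  ⟨hπ.lift ⟨f, hc⟩ hfac, DFunLike.congr_fun (hπ.lift_comp ⟨f, hc⟩ hfac)⟩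

theorem integral_comp_toTorus [NormedSpace ℝ V] (F : UnitAddTorus (Fin d) → V) :
    ∫ θ, F (toTorus θ) ∂torusMeasure d = ∫ t, F t := by
  have h2 : (0 : ℝ) < 2 * Real.pi := Real.two_pi_pos
  have hunit : {x : Fin d → ℝ | ∀ i, x i ∈ Ioc ((0 : Fin d → ℝ) i) ((0 : Fin d → ℝ) i + 1)} =
      univ.pi fun _ => Ioc (0 : ℝ) 1 := by
    ext x; simp
  have hcell : (2 * Real.pi) • (univ.pi fun _ : Fin d => Ioc (0 : ℝ) 1) =
      univ.pi fun _ : Fin d => Ioc (0 : ℝ) (2 * Real.pi) := by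
    ext x
    simp only [mem_smul_set_iff_inv_smul_mem₀ h2.ne', mem_univ_pi, Pi.smul_apply, smul_eq_mul,
      mem_Ioc, inv_mul_le_iff₀ h2, mul_one, mul_pos_iff_of_pos_left (inv_pos.2 h2)]
  rw [UnitAddTorus.integral_preimage _ (0 : Fin d → ℝ), hunit, integral_torusMeasure_eq_setIntegral]
  rw [show (fun x : Fin d → ℝ => F fun i => (x i : UnitAddCircle)) =
    fun x => F (toTorus ((2 * Real.pi) • x)) from funext fun x => by rw [toTorus_two_pi_smul],
    Measure.setIntegral_comp_smul_of_pos volume (fun θ => F (toTorus θ)) _ h2, hcell, volume_pi,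
    setIntegral_congr_set (Measure.univ_pi_Ioc_ae_eq_Icc
      (f := fun _ : Fin d => (0 : ℝ)) (g := fun _ => 2 * Real.pi)),
    Module.finrank_fintype_fun_eq_card, Fintype.card_fin, one_div]
  rfl

theorem isAddHaarMeasure_unitAddTorus :
    (volume : Measure (UnitAddTorus (Fin d))).IsAddHaarMeasure :=
  have : (volume : Measure UnitAddCircle).IsAddHaarMeasure :=
    inferInstanceAs AddCircle.haarAddCircle.IsAddHaarMeasure
  Measure.pi.isAddHaarMeasure _

theorem TorusPeriodic.integral_add_right_eq [NormedSpace ℝ V] {f : (Fin d → ℝ) → V}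
    (hf : TorusPeriodic f) (hc : Continuous f) (s : Fin d → ℝ) :
    ∫ θ, f (θ + s) ∂torusMeasure d = ∫ θ, f θ ∂torusMeasure d := by
  have := isAddHaarMeasure_unitAddTorus (d := d)
  obtain ⟨F, hF⟩ := hf.exists_toTorus_factor hc
  simp_rw [← hF, toTorus_add]
  rw [integral_comp_toTorus fun t => F (t + toTorus s), integral_comp_toTorus F,
    integral_add_right_eq_self]

theorem TorusPeriodic.integral_sub_left_eq [NormedSpace ℝ V] {f : (Fin d → ℝ) → V}
    (hf : TorusPeriodic f) (hc : Continuous f) (s : Fin d → ℝ) :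
    ∫ θ, f (s - θ) ∂torusMeasure d = ∫ θ, f θ ∂torusMeasure d := by
  have := isAddHaarMeasure_unitAddTorus (d := d)
  have : (volume : Measure (UnitAddTorus (Fin d))).IsNegInvariant :=
    Measure.IsAddHaarMeasure.isNegInvariant_of_regular _
  obtain ⟨F, hF⟩ := hf.exists_toTorus_factor hc
  simp_rw [← hF, toTorus_sub]
  rw [integral_comp_toTorus fun t => F (toTorus s - t), integral_comp_toTorus F,
    integral_sub_left_eq_self]

theorem mFourier_toTorus (k : Fin d → ℤ) (θ : Fin d → ℝ) :
    UnitAddTorus.mFourier k (toTorus θ) = Complex.exp (Complex.I * (dotInt θ k : ℂ)) := by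
  have hπ : (Real.pi : ℂ) ≠ 0 := Complex.ofReal_ne_zero.2 Real.pi_ne_zero
  simp only [UnitAddTorus.mFourier, ContinuousMap.coe_mk, toTorus, fourier_coe_apply,
    ← Complex.exp_sum, dotInt]
  congr 1
  push_cast
  rw [Finset.mul_sum]
  refine Finset.sum_congr rfl fun j _ => ?_
  field_simp

theorem TorusPeriodic.hasSum_fourier {f : (Fin d → ℝ) → ℂ} (hf : TorusPeriodic f)
    (hc : Continuous f)
    (hs : Summable fun k : Fin d → ℤ =>
      ∫ θ, f θ * Complex.exp (-Complex.I * (dotInt θ k : ℂ)) ∂torusMeasure d) (q : Fin d → ℝ) :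
    HasSum (fun k : Fin d → ℤ =>
      (∫ θ, f θ * Complex.exp (-Complex.I * (dotInt θ k : ℂ)) ∂torusMeasure d)
        * Complex.exp (Complex.I * (dotInt q k : ℂ))) (f q) := by
  obtain ⟨F, hF⟩ := hf.exists_toTorus_factor hc
  have hcoef : ∀ k : Fin d → ℤ, UnitAddTorus.mFourierCoeff F k =
      ∫ θ, f θ * Complex.exp (-Complex.I * (dotInt θ k : ℂ)) ∂torusMeasure d := fun k => by
    rw [UnitAddTorus.mFourierCoeff, ← integral_comp_toTorus]
    simp only [mFourier_toTorus, hF, smul_eq_mul, dotInt, Pi.neg_apply, Int.cast_neg, mul_neg,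
      Finset.sum_neg_distrib, Complex.ofReal_neg, neg_mul, mul_comm]
  simpa only [hcoef, hF, mFourier_toTorus, smul_eq_mul] using
    UnitAddTorus.hasSum_mFourier_series_apply_of_summable (f := F)
      (by simpa only [← hcoef] using! hs) (toTorus q)

end TorusAverage

section Modes

open MeasureTheory

variable {ι κ : Type*} {d n : ℕ} {V : Type} [NormedAddCommGroup V] [NormedSpace ℝ V]

theorem IsPeriodic.coordDeriv {F : Phase d → ℝ} (hF : IsPeriodic F) (a : Fin d ⊕ Fin d) :
    IsPeriodic (coordDeriv a F) := by
  intro k x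
  have : (fun y => F (y + shift k)) = F := funext fun y => hF k y
  rw [NormalFormLemma.coordDeriv, NormalFormLemma.coordDeriv, ← fderiv_comp_add_right, this]

theorem IsPeriodic.wordDeriv {F : Phase d → ℝ} (hF : IsPeriodic F) (w : List (Fin d ⊕ Fin d)) :
    IsPeriodic (wordDeriv w F) := by
  induction w with
  | nil => exact hF
  | cons a w ih => exact ih.coordDeriv a

theorem IsPeriodic.torusPeriodic {F : Phase d → ℝ} (hF : IsPeriodic F) (p : Fin d → ℝ) :
    TorusPeriodic fun θ => F (p, θ) := by
  intro k θ
  simpa [shift] using hF k (p, θ)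

/-- The average of `F (p, q - θ)` over `θ ∈ 𝕋^d` with weight `w`. -/
def modeAvg (w : (Fin d → ℝ) → ℝ) (F : Phase d → V) (x : Phase d) : V :=
  ∫ θ, w θ • F (x - (0, θ)) ∂torusMeasure d

theorem continuous_modeAvg_integrand {w : (Fin d → ℝ) → ℝ} (hw : Continuous w) {F : Phase d → V}
    (hF : Continuous F) (x : Phase d) : Continuous fun θ => w θ • F (x - (0, θ)) := by
  fun_prop

theorem norm_weight_smul_le {w : (Fin d → ℝ) → ℝ} (hw : ∀ θ, |w θ| ≤ 1) {v : V} {C : ℝ}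
    (hv : ‖v‖ ≤ C) (θ : Fin d → ℝ) : ‖w θ • v‖ ≤ C := by
  rw [norm_smul]
  exact (mul_le_of_le_one_left (norm_nonneg v) (hw θ)).trans hv

theorem norm_integral_torusMeasure_le {f : (Fin d → ℝ) → V} {C : ℝ} (hC : ∀ θ, ‖f θ‖ ≤ C) :
    ‖∫ θ, f θ ∂torusMeasure d‖ ≤ C := by
  simpa using norm_integral_le_of_norm_le_const (μ := torusMeasure d) (.of_forall hC)

theorem norm_modeAvg_le {w : (Fin d → ℝ) → ℝ} (hw : ∀ θ, |w θ| ≤ 1) {F : Phase d → V} {C : ℝ}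
    (hC : ∀ x, ‖F x‖ ≤ C) (x : Phase d) : ‖modeAvg w F x‖ ≤ C :=
  norm_integral_torusMeasure_le fun θ => norm_weight_smul_le hw (hC _) θ

theorem lipschitzWith_modeAvg {w : (Fin d → ℝ) → ℝ} (hwc : Continuous w) (hw : ∀ θ, |w θ| ≤ 1)
    {F : Phase d → V} {K : ℝ≥0} (hF : LipschitzWith K F) : LipschitzWith K (modeAvg w F) := by
  refine LipschitzWith.of_dist_le_mul fun x y => ?_
  rw [dist_eq_norm, modeAvg, modeAvg, ← integral_sub
    (integrable_torusMeasure (continuous_modeAvg_integrand hwc hF.continuous x))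
    (integrable_torusMeasure (continuous_modeAvg_integrand hwc hF.continuous y))]
  refine norm_integral_torusMeasure_le fun θ => ?_
  rw [← smul_sub]
  refine norm_weight_smul_le hw ?_ θ
  have := hF.dist_le_mul (x - (0, θ)) (y - (0, θ))
  rwa [dist_eq_norm, dist_sub_right] at this

theorem hasFDerivAt_modeAvg {w : (Fin d → ℝ) → ℝ} (hwc : Continuous w) (hw : ∀ θ, |w θ| ≤ 1)
    {F : ι → Phase d → V} (hF : UnifBdd (n + 1) F) (i : ι) (x : Phase d) :
    HasFDerivAt (modeAvg w (F i)) (modeAvg w (fderiv ℝ (F i)) x) x := by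
  obtain ⟨C, hC⟩ := hF.fderiv.bounded
  have hc : Continuous (F i) := (hF.unifMap.contDiff i).continuous
  have hc' : Continuous (fderiv ℝ (F i)) := (hF.fderiv.unifMap.contDiff i).continuous
  refine hasFDerivAt_integral_of_dominated_of_fderiv_le (μ := torusMeasure d)
    (F := fun y θ => w θ • F i (y - (0, θ)))
    (F' := fun y θ => w θ • fderiv ℝ (F i) (y - (0, θ))) (bound := fun _ => C) univ_mem
    (.of_forall fun y => (continuous_modeAvg_integrand hwc hc y).aestronglyMeasurable)
    (integrable_torusMeasure (continuous_modeAvg_integrand hwc hc x))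
    (continuous_modeAvg_integrand hwc hc' x).aestronglyMeasurable
    (.of_forall fun θ y _ => norm_weight_smul_le hw (hC i _) θ)
    (integrable_const _) (.of_forall fun θ y _ => ?_)
  exact ((hasFDerivAt_comp_sub (f := F i) (0, θ)).2 (hF.hasFDerivAt i _)).fun_const_smul (w θ)

theorem UnifBdd.modeAvg {w : κ → (Fin d → ℝ) → ℝ} (hwc : ∀ k, Continuous (w k))
    (hw : ∀ k θ, |w k θ| ≤ 1) {F : ι → Phase d → V} (h : UnifBdd n F) :
    UnifBdd n (fun (a : ι × κ) => modeAvg (w a.2) (F a.1)) := by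
  have hb : ∃ C : ℝ≥0, ∀ (a : ι × κ) x, ‖NormalFormLemma.modeAvg (w a.2) (F a.1) x‖ ≤ C :=
    h.bounded.imp fun _ hC a => norm_modeAvg_le (hw a.2) (hC a.1)
  induction n generalizing V with
  | zero =>
    obtain ⟨K, hK⟩ := h.unifMap
    exact ⟨hb, K, fun a => lipschitzWith_modeAvg (hwc a.2) (hw a.2) (hK a.1)⟩
  | succ n ih =>
    exact .of_hasFDerivAt hb (fun a => hasFDerivAt_modeAvg (hwc a.2) (hw a.2) h a.1)
      (ih h.fderiv (h.fderiv.bounded.imp fun _ hC a => norm_modeAvg_le (hw a.2) (hC a.1)))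

theorem isPeriodic_modeAvg (w : (Fin d → ℝ) → ℝ) {F : Phase d → ℝ} (hF : IsPeriodic F) :
    IsPeriodic (modeAvg w F) := by
  intro k x
  simp only [modeAvg, add_sub_right_comm, hF k]

theorem modeAvg_translate {w : (Fin d → ℝ) → ℝ} (hwc : Continuous w) (hw : TorusPeriodic w)
    {F : Phase d → ℝ} (hFc : Continuous F) (hF : IsPeriodic F) (x : Phase d) (s : Fin d → ℝ) :
    modeAvg w F (x + (0, s)) = modeAvg (fun θ => w (θ + s)) F x := by
  have hper : TorusPeriodic fun θ => w θ • F (x + (0, s) - (0, θ)) := fun k θ => by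
    have hx : x + (0, s) - (0, θ) =
        x + (0, s) - (0, θ + fun j => 2 * Real.pi * (k j : ℝ)) + shift k := by
      simp only [shift, sub_add, Prod.mk_sub_mk, sub_zero, add_sub_cancel_right]
    beta_reduce
    rw [hw k θ, hx, hF k]
  rw [modeAvg, ← hper.integral_add_right_eq (by fun_prop) s, modeAvg]
  have hx : ∀ θ : Fin d → ℝ, x + (0, s) - (0, θ + s) = x - (0, θ) := fun θ => by ext j <;> simp
  simp only [hx]

theorem coordDeriv_modeAvg {w : (Fin d → ℝ) → ℝ} (hwc : Continuous w) (hw : ∀ θ, |w θ| ≤ 1)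
    {F : ι → Phase d → ℝ} (h : UnifSmooth F) (i : ι) (a : Fin d ⊕ Fin d) :
    coordDeriv a (modeAvg w (F i)) = modeAvg w (coordDeriv a (F i)) := by
  ext x
  rw [coordDeriv, (hasFDerivAt_modeAvg hwc hw (h 1) i x).fderiv]
  exact ((ContinuousLinearMap.apply ℝ ℝ (coordDir a)).integral_comp_comm
    (integrable_torusMeasure (continuous_modeAvg_integrand hwc
      ((h 1).fderiv.unifMap.contDiff i).continuous x))).symm

theorem modeAvg_linear {w w' : (Fin d → ℝ) → ℝ} (hw : Continuous w) (hw' : Continuous w')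
    (a b : ℝ) {F : Phase d → ℝ} (hF : Continuous F) (x : Phase d) :
    modeAvg (fun θ => a * w θ + b * w' θ) F x = a * modeAvg w F x + b * modeAvg w' F x := by
  simp only [modeAvg, smul_eq_mul, add_mul, mul_assoc]
  rw [integral_add (integrable_torusMeasure (by fun_prop))
    (integrable_torusMeasure (by fun_prop)), integral_const_mul, integral_const_mul]

theorem modeAvg_const_mul (w : (Fin d → ℝ) → ℝ) (c : ℝ) (F : Phase d → ℝ) (x : Phase d) :
    modeAvg w (fun x => c * F x) x = c * modeAvg w F x := by
  simp only [modeAvg, smul_eq_mul, mul_left_comm _ c, integral_const_mul]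

theorem dotInt_add (θ s : Fin d → ℝ) (k : Fin d → ℤ) :
    dotInt (θ + s) k = dotInt θ k + dotInt s k := by
  simp [dotInt, add_mul, Finset.sum_add_distrib]

theorem dotInt_smul (r : ℝ) (θ : Fin d → ℝ) (k : Fin d → ℤ) :
    dotInt (r • θ) k = r * dotInt θ k := by
  simp [dotInt, Finset.mul_sum, mul_assoc]

theorem dotInt_single (j : Fin d) (k : Fin d → ℤ) : dotInt (Pi.single j 1) k = k j := by
  simp [dotInt, Pi.single_apply]

theorem dotInt_neg (θ : Fin d → ℝ) (k : Fin d → ℤ) : dotInt θ (-k) = -dotInt θ k := by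
  simp [dotInt]

@[fun_prop]
theorem continuous_dotInt (k : Fin d → ℤ) : Continuous fun θ : Fin d → ℝ => dotInt θ k := by
  unfold dotInt; fun_prop

theorem dotInt_two_pi_mul (l k : Fin d → ℤ) :
    dotInt (fun j => 2 * Real.pi * (l j : ℝ)) k = ((∑ j, l j * k j : ℤ) : ℝ) * (2 * Real.pi) := by
  simp only [dotInt]
  push_cast
  rw [Finset.sum_mul]
  exact Finset.sum_congr rfl fun j _ => by ring

/-- `Re (F̂_k(p) e^{i k·q})`. -/
def cosMode (k : Fin d → ℤ) (F : Phase d → V) : Phase d → V :=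
  modeAvg (fun θ => Real.cos (dotInt θ k)) F

/-- `Im (F̂_k(p) e^{i k·q})`. -/
def sinMode (k : Fin d → ℤ) (F : Phase d → V) : Phase d → V :=
  modeAvg (fun θ => Real.sin (dotInt θ k)) F

theorem UnifBdd.cosMode {F : ι → Phase d → V} (h : UnifBdd n F) :
    UnifBdd n (fun (a : ι × (Fin d → ℤ)) => cosMode a.2 (F a.1)) :=
  UnifBdd.modeAvg (w := fun k θ => Real.cos (dotInt θ k)) (by fun_prop)
    (fun _ _ => Real.abs_cos_le_one _) h

theorem UnifBdd.sinMode {F : ι → Phase d → V} (h : UnifBdd n F) :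
    UnifBdd n (fun (a : ι × (Fin d → ℤ)) => sinMode a.2 (F a.1)) :=
  UnifBdd.modeAvg (w := fun k θ => Real.sin (dotInt θ k)) (by fun_prop)
    (fun _ _ => Real.abs_sin_le_one _) h

theorem cosMode_translate {F : Phase d → ℝ} (hc : Continuous F) (hF : IsPeriodic F)
    (k : Fin d → ℤ) (x : Phase d) (s : Fin d → ℝ) :
    cosMode k F (x + (0, s)) =
      Real.cos (dotInt s k) * cosMode k F x + -Real.sin (dotInt s k) * sinMode k F x := by
  have hper : TorusPeriodic fun θ : Fin d → ℝ => Real.cos (dotInt θ k) := fun l θ => by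
    beta_reduce
    rw [dotInt_add, dotInt_two_pi_mul, Real.cos_add_int_mul_two_pi]
  rw [cosMode, modeAvg_translate (by fun_prop) hper hc hF, sinMode,
    ← modeAvg_linear (by fun_prop) (by fun_prop) _ _ hc]
  congr 1 with θ
  rw [dotInt_add, Real.cos_add]
  ring

theorem sinMode_translate {F : Phase d → ℝ} (hc : Continuous F) (hF : IsPeriodic F)
    (k : Fin d → ℤ) (x : Phase d) (s : Fin d → ℝ) :
    sinMode k F (x + (0, s)) =
      Real.sin (dotInt s k) * cosMode k F x + Real.cos (dotInt s k) * sinMode k F x := by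
  have hper : TorusPeriodic fun θ : Fin d → ℝ => Real.sin (dotInt θ k) := fun l θ => by
    beta_reduce
    rw [dotInt_add, dotInt_two_pi_mul, Real.sin_add_int_mul_two_pi]
  rw [sinMode, modeAvg_translate (by fun_prop) hper hc hF, cosMode,
    ← modeAvg_linear (by fun_prop) (by fun_prop) _ _ hc]
  congr 1 with θ
  rw [dotInt_add, Real.sin_add]
  ring

theorem hasDerivAt_comp_add_angle {G : Phase d → ℝ} (hG : Differentiable ℝ G) (x : Phase d)
    (j : Fin d) :
    HasDerivAt (fun s : ℝ => G (x + (0, s • Pi.single j 1))) (coordDeriv (Sum.inr j) G x) 0 := by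
  have hline := (hG x).hasFDerivAt.hasLineDerivAt (coordDir (Sum.inr j))
  simpa [HasLineDerivAt, coordDir, Prod.smul_mk] using! hline

theorem coordDeriv_cosMode {F : ι → Phase d → ℝ} (h : UnifSmooth F) {i : ι}
    (hp : IsPeriodic (F i)) (k : Fin d → ℤ) (j : Fin d) (x : Phase d) :
    coordDeriv (Sum.inr j) (cosMode k (F i)) x = -(k j : ℝ) * sinMode k (F i) x := by
  refine (hasDerivAt_comp_add_angle ((h 1).cosMode.differentiable (i, k)) x j).unique ?_
  simp only [cosMode_translate (h.contDiff i).continuous hp, dotInt_smul, dotInt_single]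
  have hlin := hasDerivAt_mul_const (x := 0) (k j : ℝ)
  simpa using! (hlin.cos.mul_const (cosMode k (F i) x)).add
    (hlin.sin.neg.mul_const (sinMode k (F i) x))

theorem coordDeriv_sinMode {F : ι → Phase d → ℝ} (h : UnifSmooth F) {i : ι}
    (hp : IsPeriodic (F i)) (k : Fin d → ℤ) (j : Fin d) (x : Phase d) :
    coordDeriv (Sum.inr j) (sinMode k (F i)) x = (k j : ℝ) * cosMode k (F i) x := by
  refine (hasDerivAt_comp_add_angle ((h 1).sinMode.differentiable (i, k)) x j).unique ?_
  simp only [sinMode_translate (h.contDiff i).continuous hp, dotInt_smul, dotInt_single]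
  have hlin := hasDerivAt_mul_const (x := 0) (k j : ℝ)
  simpa using! (hlin.sin.mul_const (cosMode k (F i) x)).add
    (hlin.cos.mul_const (sinMode k (F i) x))

theorem coordDeriv_cosMode_comm {F : ι → Phase d → ℝ} (h : UnifSmooth F) (i : ι)
    (k : Fin d → ℤ) (a : Fin d ⊕ Fin d) :
    coordDeriv a (cosMode k (F i)) = cosMode k (coordDeriv a (F i)) :=
  coordDeriv_modeAvg (by fun_prop) (fun _ => Real.abs_cos_le_one _) h i a

theorem coordDeriv_sinMode_comm {F : ι → Phase d → ℝ} (h : UnifSmooth F) (i : ι)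
    (k : Fin d → ℤ) (a : Fin d ⊕ Fin d) :
    coordDeriv a (sinMode k (F i)) = sinMode k (coordDeriv a (F i)) :=
  coordDeriv_modeAvg (by fun_prop) (fun _ => Real.abs_sin_le_one _) h i a

/-- `1 + |k_1| + ⋯ + |k_d|`, the weight measuring the decay of Fourier modes. -/
def bracket (k : Fin d → ℤ) : ℝ := 1 + ∑ j, |(k j : ℝ)|

theorem bracket_pos (k : Fin d → ℤ) : 0 < bracket k := by
  rw [bracket]; positivity

theorem bracket_mul (k : Fin d → ℤ) (r : ℝ) :
    bracket k * r = r + ∑ j, (SignType.sign (k j : ℝ) : ℝ) * ((k j : ℝ) * r) := by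
  simp only [bracket, add_mul, one_mul, Finset.sum_mul, ← mul_assoc, sign_mul_self]

-- Each factor `k_j` is traded for a derivative `∂_{q_j}`, which exchanges cosine and sine modes.
theorem unifBdd_bracket_pow_modes (M : ℕ) {F : ι → Phase d → ℝ} (h : UnifSmooth F)
    (hp : ∀ i, IsPeriodic (F i)) (n : ℕ) :
    UnifBdd n (fun (a : ι × (Fin d → ℤ)) x => bracket a.2 ^ M * cosMode a.2 (F a.1) x) ∧
    UnifBdd n (fun (a : ι × (Fin d → ℤ)) x => bracket a.2 ^ M * sinMode a.2 (F a.1) x) := by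
  induction M generalizing F with
  | zero => simpa using ⟨(h n).cosMode, (h n).sinMode⟩
  | succ M ih =>
    have hsign : ∀ j (a : ι × (Fin d → ℤ)), |(SignType.sign (a.2 j : ℝ) : ℝ)| ≤ 1 := by
      intro j a
      cases SignType.sign (a.2 j : ℝ) <;> simp
    have ihj := fun j => ih (h.coordDeriv (Sum.inr j)) fun i => (hp i).coordDeriv (Sum.inr j)
    constructor
    · convert (ih h hp).1.add (.sum Finset.univ fun j _ => (ihj j).2.const_smul (hsign j))
        using 3 with a x
      simp only [smul_eq_mul, ← coordDeriv_sinMode_comm h, coordDeriv_sinMode h (hp a.1),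
        mul_left_comm _ (bracket a.2 ^ M), ← Finset.mul_sum, ← mul_add, ← bracket_mul, pow_succ,
        mul_assoc]
    · convert (ih h hp).2.sub (.sum Finset.univ fun j _ => (ihj j).1.const_smul (hsign j))
        using 3 with a x
      simp only [smul_eq_mul, ← coordDeriv_cosMode_comm h, coordDeriv_cosMode h (hp a.1),
        mul_left_comm _ (bracket a.2 ^ M), ← Finset.mul_sum, ← mul_add, neg_mul,
        mul_neg, Finset.sum_neg_distrib, sub_neg_eq_add, ← bracket_mul, pow_succ, mul_assoc]

theorem norm_le_bracket (k : Fin d → ℤ) : ‖fun j => (k j : ℝ)‖ ≤ bracket k := by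
  refine (pi_norm_le_iff_of_nonneg (bracket_pos k).le).2 fun j => ?_
  have := Finset.single_le_sum (f := fun j => |(k j : ℝ)|) (fun j _ => abs_nonneg _)
    (Finset.mem_univ j)
  rw [bracket, Real.norm_eq_abs]
  linarith

theorem summable_bracket_pow : Summable fun k : Fin d → ℤ => (bracket k ^ (d + 1))⁻¹ := by
  let b := (Pi.basisFun ℝ (Fin d)).restrictScalars ℤ
  have hb : ∀ k : Fin d → ℤ, ‖b.equivFun.symm k‖ = ‖fun j => (k j : ℝ)‖ := fun k => by
    rw [Submodule.coe_norm]
    congr 1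
    ext j
    simp [b, Module.Basis.equivFun_symm_apply, Finset.sum_apply, Pi.single_apply]
  have hrank : Module.finrank ℤ (Submodule.span ℤ (range (Pi.basisFun ℝ (Fin d)))) < d + 1 := by
    rw [Module.finrank_eq_card_basis b, Fintype.card_fin]
    exact d.lt_succ_self
  have hsum := (ZLattice.summable_norm_pow_inv _ _ hrank).comp_injective b.equivFun.symm.injective
  refine hsum.of_norm_bounded_eventually ((finite_singleton 0).subset fun k hk => ?_)
  contrapose! hk
  simp only [mem_singleton_iff] at hk
  have hk' : 0 < ‖fun j => (k j : ℝ)‖ := norm_pos_iff.2 fun h =>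
    hk (funext fun j => by simpa using congrFun h j)
  simp only [mem_compl_iff, mem_ofPred_eq, not_not, Function.comp_apply, hb]
  rw [Real.norm_of_nonneg (by have := bracket_pos k; positivity), ← inv_pow]
  gcongr
  · exact inv_nonneg.2 (bracket_pos k).le
  · exact norm_le_bracket k

end Modes

section Fourier

open MeasureTheory

variable {ι : Type*} {d : ℕ}

theorem fourierCoef_eq_integral (F : Phase d → ℝ) (k : Fin d → ℤ) (p : Fin d → ℝ) :
    fourierCoef F k p =
      ∫ θ, (F (p, θ) : ℂ) * Complex.exp (-Complex.I * (dotInt θ k : ℂ)) ∂torusMeasure d := by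
  rw [integral_torusMeasure_eq_setIntegral, Complex.real_smul, fourierCoef]

theorem torusPeriodic_exp_dotInt (k : Fin d → ℤ) :
    TorusPeriodic fun θ : Fin d → ℝ => Complex.exp (Complex.I * (dotInt θ k : ℂ)) := by
  refine fun l θ => Complex.exp_eq_exp_iff_exists_int.2 ⟨∑ j, l j * k j, ?_⟩
  rw [dotInt_add, dotInt_two_pi_mul]
  push_cast
  ring

theorem fourierCoef_eq_modes {F : Phase d → ℝ} (hF : IsPeriodic F) (hc : Continuous F)
    (k : Fin d → ℤ) (p : Fin d → ℝ) :
    fourierCoef F k p = cosMode k F (p, 0) + Complex.I * sinMode k F (p, 0) := by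
  have hper : TorusPeriodic fun θ : Fin d → ℝ =>
      (F (p, θ) : ℂ) * Complex.exp (-Complex.I * (dotInt θ k : ℂ)) := fun l θ => by
    have hexp := torusPeriodic_exp_dotInt (-k) l θ
    simp only [dotInt_neg, Complex.ofReal_neg, mul_neg, ← neg_mul] at hexp
    have hFp := hF.torusPeriodic p l θ
    beta_reduce at hFp ⊢
    rw [hexp, hFp]
  rw [fourierCoef_eq_integral, ← hper.integral_sub_left_eq (by fun_prop) 0, cosMode, sinMode,
    modeAvg, modeAvg, ← integral_complex_ofReal, ← integral_complex_ofReal, ← integral_const_mul,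
    ← integral_add (integrable_torusMeasure (by fun_prop)) (integrable_torusMeasure (by fun_prop))]
  congr 1 with θ
  have hdot : -Complex.I * (dotInt (0 - θ) k : ℂ) = dotInt θ k * Complex.I := by
    rw [zero_sub, ← neg_one_smul ℝ θ, dotInt_smul]
    push_cast
    ring
  rw [hdot, Complex.exp_mul_I, Prod.mk_sub_mk, sub_zero]
  push_cast [smul_eq_mul]
  ring

theorem fourierCoef_mul_exp {F : Phase d → ℝ} (hF : IsPeriodic F) (hc : Continuous F)
    (k : Fin d → ℤ) (p q : Fin d → ℝ) :
    fourierCoef F k p * Complex.exp (Complex.I * (dotInt q k : ℂ)) =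
      cosMode k F (p, q) + Complex.I * sinMode k F (p, q) := by
  have hx : ((p, q) : Phase d) = (p, 0) + (0, q) := by simp
  rw [fourierCoef_eq_modes hF hc, hx, cosMode_translate hc hF, sinMode_translate hc hF,
    mul_comm Complex.I (dotInt q k : ℂ), Complex.exp_mul_I]
  push_cast
  linear_combination ((sinMode k F (p, 0) : ℝ) * Complex.sin (dotInt q k)) * Complex.I_sq

theorem summable_fourierCoef {F : ι → Phase d → ℝ} (h : UnifSmooth F)
    (hp : ∀ i, IsPeriodic (F i)) (i : ι) (p : Fin d → ℝ) :
    Summable fun k : Fin d → ℤ => fourierCoef (F i) k p := by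
  obtain ⟨C, hC⟩ := (unifBdd_bracket_pow_modes (d + 1) h hp 0).1.bounded
  obtain ⟨S, hS⟩ := (unifBdd_bracket_pow_modes (d + 1) h hp 0).2.bounded
  refine .of_norm_bounded (g := fun k => (C + S) * (bracket k ^ (d + 1))⁻¹)
    (summable_bracket_pow.mul_left _) fun k => ?_
  have hb : 0 < bracket k ^ (d + 1) := pow_pos (bracket_pos k) _
  have hCk := hC (i, k) (p, 0)
  have hSk := hS (i, k) (p, 0)
  rw [Real.norm_eq_abs, abs_mul, abs_of_pos hb] at hCk hSk
  rw [fourierCoef_eq_modes (hp i) (h.contDiff i).continuous, ← div_eq_mul_inv, le_div_iff₀ hb]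
  calc _ ≤ (|cosMode k (F i) (p, 0)| + |sinMode k (F i) (p, 0)|) * bracket k ^ (d + 1) := by
        gcongr
        refine (norm_add_le _ _).trans_eq ?_
        simp
    _ ≤ C + S := by linarith

theorem hasSum_cosMode {F : ι → Phase d → ℝ} (h : UnifSmooth F) (hp : ∀ i, IsPeriodic (F i))
    (i : ι) (x : Phase d) : HasSum (fun k : Fin d → ℤ => cosMode k (F i) x) (F i x) := by
  have hc := (h.contDiff i).continuous
  have hper : TorusPeriodic fun θ => (F i (x.1, θ) : ℂ) := fun k θ =>
    congrArg _ ((hp i).torusPeriodic x.1 k θ)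
  have hsum := summable_fourierCoef h hp i x.1
  simp only [fourierCoef_eq_integral] at hsum
  have hseries := hper.hasSum_fourier (by fun_prop) hsum x.2
  simp only [← fourierCoef_eq_integral, fourierCoef_mul_exp (hp i) hc] at hseries
  simpa using Complex.hasSum_re hseries

theorem lt_bracket_of_notMem_modes {K : ℕ} {k : Fin d → ℤ} (hk : k ∉ modes d K) :
    (K : ℝ) < bracket k := by
  rw [mem_modes, not_le] at hk
  have hsq : (K : ℝ) ^ 2 < ∑ j, |(k j : ℝ)| ^ 2 := by
    simp only [sq_abs]
    exact_mod_cast hk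
  have hsum : ∑ j, |(k j : ℝ)| ^ 2 ≤ (∑ j, |(k j : ℝ)|) ^ 2 :=
    Finset.sum_sq_le_sq_sum_of_nonneg fun j _ => abs_nonneg _
  have hlt : (K : ℝ) < ∑ j, |(k j : ℝ)| :=
    lt_of_pow_lt_pow_left₀ 2 (by positivity) (hsq.trans_le hsum)
  rw [bracket]
  linarith

/-- The part of `F` with frequencies `|k| > K`. -/
def fourierTail (K : ℕ) (F : Phase d → ℝ) (x : Phase d) : ℝ :=
  F x - ∑ k ∈ modes d K, cosMode k F x

theorem hasSum_fourierTail {F : ι → Phase d → ℝ} (h : UnifSmooth F) (hp : ∀ i, IsPeriodic (F i))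
    (K : ℕ) (i : ι) (x : Phase d) :
    HasSum (indicator {k | k ∉ modes d K} fun k => cosMode k (F i) x)
      (fourierTail K (F i) x) := by
  have hsum := hasSum_cosMode h hp i x
  rw [← sub_add_cancel (F i x) (∑ k ∈ modes d K, cosMode k (F i) x),
    ← Finset.hasSum_compl_iff] at hsum
  exact hasSum_subtype_iff_indicator.1 hsum

theorem exists_pow_mul_fourierTail_le {F : ι → Phase d → ℝ} (h : UnifSmooth F)
    (hp : ∀ i, IsPeriodic (F i)) (M : ℕ) :
    ∃ C : ℝ≥0, ∀ i (K : ℕ) x, (K : ℝ) ^ M * |fourierTail K (F i) x| ≤ C := by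
  obtain ⟨C, hC⟩ := (unifBdd_bracket_pow_modes (M + (d + 1)) h hp 0).1.bounded
  have hpos : ∀ k : Fin d → ℤ, 0 ≤ (bracket k ^ (d + 1))⁻¹ := fun k =>
    (inv_pos.2 (pow_pos (bracket_pos k) _)).le
  lift (∑' k : Fin d → ℤ, (bracket k ^ (d + 1))⁻¹) to ℝ≥0 using tsum_nonneg hpos with S hS
  refine ⟨C * S, fun i K x => ?_⟩
  have htail := (hasSum_fourierTail h hp K i x).mul_left ((K : ℝ) ^ M)
  rw [← abs_of_nonneg (by positivity : (0 : ℝ) ≤ K ^ M), ← abs_mul, ← htail.tsum_eq,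
    NNReal.coe_mul, hS, ← Real.norm_eq_abs]
  refine tsum_of_norm_bounded (summable_bracket_pow.hasSum.mul_left (C : ℝ)) fun k => ?_
  by_cases hk : k ∈ modes d K
  · simpa [hk] using mul_nonneg C.2 (hpos k)
  have hCk := hC (i, k) x
  rw [norm_mul, pow_add, norm_mul, Real.norm_of_nonneg (pow_pos (bracket_pos k) _).le,
    Real.norm_of_nonneg (pow_pos (bracket_pos k) _).le] at hCk
  rw [indicator_of_mem hk, norm_mul, Real.norm_of_nonneg (by positivity),
    ← div_eq_mul_inv, le_div_iff₀ (pow_pos (bracket_pos k) _), mul_right_comm]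
  refine le_trans ?_ hCk
  have := bracket_pos k
  gcongr
  exact (lt_bracket_of_notMem_modes hk).le

theorem coordDeriv_fourierTail {F : ι → Phase d → ℝ} (h : UnifSmooth F) (i : ι) (c : ℝ)
    (K : ℕ) (a : Fin d ⊕ Fin d) :
    coordDeriv a (fun x => c * fourierTail K (F i) x) =
      fun x => c * fourierTail K (coordDeriv a (F i)) x := by
  ext x
  have htail := (((h 1).hasFDerivAt i x).fun_sub (HasFDerivAt.fun_sum (u := modes d K)
    fun k _ => (h 1).cosMode.hasFDerivAt (i, k) x)).const_mul c
  have hmode : ∀ k, fderiv ℝ (cosMode k (F i)) x (coordDir a) = cosMode k (coordDeriv a (F i)) x :=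
    fun k => congrFun (coordDeriv_cosMode_comm h i k a) x
  unfold fourierTail
  rw [coordDeriv, htail.fderiv]
  simp [hmode, coordDeriv]

theorem wordDeriv_fourierTail {F : ι → Phase d → ℝ} (h : UnifSmooth F) (i : ι) (c : ℝ)
    (K : ℕ) (w : List (Fin d ⊕ Fin d)) :
    wordDeriv w (fun x => c * fourierTail K (F i) x) =
      fun x => c * fourierTail K (wordDeriv w (F i)) x := by
  induction w with
  | nil => rfl
  | cons a w ih =>
    change coordDeriv a (wordDeriv w _) = _
    rw [ih]
    exact coordDeriv_fourierTail (h.wordDeriv w) i c K a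

theorem unifSmooth_fourierTail {F : ι → Phase d → ℝ} (h : UnifSmooth F)
    (hp : ∀ i, IsPeriodic (F i)) (K : ι → ℕ) (M : ℕ) :
    UnifSmooth fun i x => (K i : ℝ) ^ M * fourierTail (K i) (F i) x := by
  refine fun n => unifBdd_of_wordDeriv (fun i => ?_) fun w => ?_
  · exact contDiff_const.mul ((h.contDiff i).sub
      (ContDiff.sum fun k _ => UnifSmooth.contDiff (fun n => (h n).cosMode) (i, k)))
  · obtain ⟨C, hC⟩ := exists_pow_mul_fourierTail_le (h.wordDeriv w) (fun i => (hp i).wordDeriv w) M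
    refine ⟨C, fun i x => ?_⟩
    rw [wordDeriv_fourierTail h, abs_mul, abs_of_nonneg (by positivity)]
    exact hC i (K i) x

theorem integral_exp_dotInt (l : Fin d → ℤ) :
    ∫ θ : Fin d → ℝ, Complex.exp (Complex.I * (dotInt θ l : ℂ)) ∂torusMeasure d =
      if l = 0 then 1 else 0 := by
  split_ifs with hl
  · simp [hl, dotInt]
  obtain ⟨j, hj⟩ : ∃ j, l j ≠ 0 := Function.ne_iff.1 hl
  -- The translation by `s` changes the sign of the integrand.
  let s : Fin d → ℝ := (Real.pi / l j) • Pi.single j 1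
  have hs : dotInt s l = Real.pi := by
    rw [dotInt_smul, dotInt_single, div_mul_cancel₀ _ (Int.cast_ne_zero.2 hj)]
  have hinv := (torusPeriodic_exp_dotInt l).integral_add_right_eq (by fun_prop) s
  simp only [dotInt_add, hs, Complex.ofReal_add, mul_add, Complex.exp_add,
    mul_comm Complex.I (Real.pi : ℂ), Complex.exp_pi_mul_I, mul_neg_one, integral_neg] at hinv
  exact self_eq_neg.1 hinv.symm

theorem fourierCoef_of_eq_sum {Z : Phase d → ℝ} {p : Fin d → ℝ} {s : Finset (Fin d → ℤ)}
    {c : (Fin d → ℤ) → ℂ}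
    (hZ : ∀ q, (Z (p, q) : ℂ) = ∑ l ∈ s, c l * Complex.exp (Complex.I * (dotInt q l : ℂ)))
    (k : Fin d → ℤ) : fourierCoef Z k p = if k ∈ s then c k else 0 := by
  have hexp : ∀ θ l, c l * Complex.exp (Complex.I * (dotInt θ l : ℂ)) *
      Complex.exp (-Complex.I * (dotInt θ k : ℂ)) =
        c l * Complex.exp (Complex.I * (dotInt θ (l - k) : ℂ)) := fun θ l => by
    rw [mul_assoc, ← Complex.exp_add, show dotInt θ (l - k) = dotInt θ l - dotInt θ k by
      simp [dotInt, mul_sub]]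
    push_cast
    ring_nf
  simp only [fourierCoef_eq_integral, hZ, Finset.sum_mul, hexp]
  rw [integral_finsetSum _ fun l _ => integrable_torusMeasure (by fun_prop)]
  simp only [integral_const_mul, integral_exp_dotInt, sub_eq_zero, mul_ite, mul_one, mul_zero,
    Finset.sum_ite_eq']

theorem sinMode_neg (k : Fin d → ℤ) (F : Phase d → ℝ) (x : Phase d) :
    sinMode (-k) F x = -sinMode k F x := by
  simp only [sinMode, modeAvg, dotInt_neg, Real.sin_neg, neg_smul, integral_neg]

theorem neg_mem_modes {K : ℕ} {k : Fin d → ℤ} : -k ∈ modes d K ↔ k ∈ modes d K := by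
  simp [mem_modes]

theorem sum_mul_sinMode_eq_zero (F : Phase d → ℝ) (K : ℕ) {c : (Fin d → ℤ) → ℝ}
    (hcn : ∀ k, c (-k) = c k) (x : Phase d) : ∑ k ∈ modes d K, c k * sinMode k F x = 0 := by
  refine self_eq_neg.1 ?_
  rw [← Finset.sum_neg_distrib]
  refine Finset.sum_nbij' Neg.neg Neg.neg (fun k hk => neg_mem_modes.2 hk)
    (fun k hk => neg_mem_modes.2 hk) (fun k _ => neg_neg k) (fun k _ => neg_neg k) fun k _ => ?_
  rw [sinMode_neg, hcn, mul_neg, neg_neg]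

theorem sum_mul_cosMode_eq {F : Phase d → ℝ} (hF : IsPeriodic F) (hc : Continuous F) (K : ℕ)
    {c : (Fin d → ℤ) → ℝ} (hcn : ∀ k, c (-k) = c k) (p q : Fin d → ℝ) :
    ((∑ k ∈ modes d K, c k * cosMode k F (p, q) : ℝ) : ℂ) =
      ∑ k ∈ modes d K, c k * fourierCoef F k p * Complex.exp (Complex.I * (dotInt q k : ℂ)) := by
  have hsin : ∑ k ∈ modes d K, (c k : ℂ) * sinMode k F (p, q) = 0 := by
    exact_mod_cast sum_mul_sinMode_eq_zero F K hcn (p, q)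
  simp only [mul_assoc, fourierCoef_mul_exp hF hc, mul_add, Finset.sum_add_distrib,
    mul_left_comm _ Complex.I, ← Finset.mul_sum, hsin, mul_zero, add_zero, Complex.ofReal_sum,
    Complex.ofReal_mul]

end Fourier

section Cutoff

variable {ι : Type*} {E E' V : Type} [NormedAddCommGroup E] [NormedSpace ℝ E]
  [NormedAddCommGroup E'] [NormedSpace ℝ E'] [NormedAddCommGroup V] [NormedSpace ℝ V] {n : ℕ}

theorem unifSmooth_of_hasCompactSupport {f : E → V} (hf : ContDiff ℝ ∞ f)
    (hs : HasCompactSupport f) : UnifSmooth fun _ : Unit => f := by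
  have exists_bound {W : Type} [NormedAddCommGroup W] {g : E → W} (hg : Continuous g)
      (hs : HasCompactSupport g) : ∃ C : ℝ≥0, ∀ x, ‖g x‖ ≤ C := by
    obtain ⟨C, hC⟩ := hs.exists_bound_of_continuous hg
    exact ⟨C.toNNReal, fun x => (hC x).trans (Real.le_coe_toNNReal C)⟩
  intro n
  have hb := exists_bound hf.continuous hs
  induction n generalizing V with
  | zero =>
    obtain ⟨K, hK⟩ := exists_bound (hf.continuous_fderiv (by simp)) (hs.fderiv (𝕜 := ℝ))
    exact ⟨hb.imp fun _ hC _ => hC, K, fun _ =>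
      lipschitzWith_of_nnnorm_fderiv_le (hf.differentiable (by simp)) hK⟩
  | succ n ih =>
    have hf' : ContDiff ℝ ∞ (fderiv ℝ f) := hf.fderiv_right (by simp)
    have hs' := hs.fderiv (𝕜 := ℝ)
    exact .of_hasFDerivAt (hb.imp fun _ hC _ => hC)
      (fun _ x => (hf.differentiable (by simp) x).hasFDerivAt)
      (ih hf' hs' (exists_bound hf'.continuous hs'))

theorem unifSmooth_of_riccati {f g : ℝ → ℝ} (hf : Differentiable ℝ f)
    (hfb : ∃ C : ℝ≥0, ∀ s, ‖f s‖ ≤ C) (hg : UnifSmooth fun _ : Unit => g)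
    (hode : ∀ s, deriv f s = g s - f s * f s) : UnifSmooth fun _ : Unit => f := by
  intro n
  obtain ⟨C, hC⟩ := hfb
  induction n with
  | zero =>
    obtain ⟨K, hK⟩ := (hg 0).bounded
    refine ⟨⟨C, fun _ => hC⟩, K + C * C, fun _ => lipschitzWith_of_nnnorm_deriv_le hf fun s => ?_⟩
    rw [← NNReal.coe_le_coe, coe_nnnorm, hode]
    exact norm_sub_le_of_le (hK () s) (norm_mul_le_of_le (hC s) (hC s))
  | succ n ih =>
    refine .of_hasFDerivAt ⟨C, fun _ => hC⟩ (fun _ s => (hf s).hasDerivAt.hasFDerivAt) ?_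
    simp only [hode]
    exact ((hg n).sub (ih.mul ih)).clm
      ((ContinuousLinearMap.toSpanSingletonCLE (𝕜 := ℝ) (E := ℝ)) : ℝ →L[ℝ] ℝ →L[ℝ] ℝ)

theorem exists_norm_le_of_eq_inv {f : ℝ → ℝ} (hf : Continuous f)
    (hinv : ∀ s, 1 ≤ |s| → f s = s⁻¹) : ∃ C : ℝ≥0, ∀ s, ‖f s‖ ≤ C := by
  obtain ⟨C, hC⟩ := (isCompact_Icc (a := (-1 : ℝ)) (b := 1)).exists_bound_of_continuousOn
    hf.continuousOn
  refine ⟨(max C 1).toNNReal, fun s => le_trans ?_ (Real.le_coe_toNNReal _)⟩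
  rcases le_total |s| 1 with hs | hs
  · exact (hC s (abs_le.1 hs)).trans (le_max_left _ _)
  · rw [hinv s hs, norm_inv, Real.norm_eq_abs]
    exact (inv_le_one_of_one_le₀ hs).trans (le_max_right _ _)

theorem unifSmooth_of_eq_inv {f : ℝ → ℝ} (hf : ContDiff ℝ ∞ f)
    (hinv : ∀ s, 1 ≤ |s| → f s = s⁻¹) : UnifSmooth fun _ : Unit => f := by
  -- `s⁻¹` solves `f' + f ^ 2 = 0`, so `f' + f ^ 2` is compactly supported.
  have hg : ContDiff ℝ ∞ fun s => deriv f s + f s * f s :=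
    (contDiff_infty_iff_deriv.1 hf).2.add (hf.mul hf)
  have hsupp : HasCompactSupport fun s => deriv f s + f s * f s := by
    refine .intro (isCompact_Icc (a := -1) (b := 1)) fun s hs => ?_
    have hs : 1 < |s| := not_le.1 fun h => hs (abs_le.1 h)
    have hev : f =ᶠ[𝓝 s] fun s => s⁻¹ := by
      filter_upwards [(isOpen_lt continuous_const continuous_abs).mem_nhds hs] with t ht
      exact hinv t (le_of_lt ht)
    rw [hev.deriv_eq, hev.eq_of_nhds, deriv_inv, pow_two, mul_inv]
    exact neg_add_cancel _
  exact unifSmooth_of_riccati (hf.differentiable (by simp))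
    (exists_norm_le_of_eq_inv hf.continuous hinv) (unifSmooth_of_hasCompactSupport hg hsupp)
    fun s => (add_sub_cancel_right _ _).symm

/-- The profile of the resonant cutoff: `1` on `[-1/2, 1/2]` and `0` outside `(-1, 1)`. -/
def cutoffBump : ContDiffBump (0 : ℝ) := ⟨1 / 2, 1, by norm_num, by norm_num⟩

/-- The regularised divisor `(1 - χ(s)) / s`, where `χ` is `cutoffBump`. -/
def regDivisor (s : ℝ) : ℝ := s⁻¹ * (1 - cutoffBump s)

theorem cutoffBump_eq_zero {s : ℝ} (hs : 1 ≤ |s|) : cutoffBump s = 0 :=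
  cutoffBump.zero_of_le_dist (by simpa [cutoffBump] using hs)

theorem cutoffBump_eventuallyEq_one : cutoffBump =ᶠ[𝓝 (0 : ℝ)] 1 := cutoffBump.eventuallyEq_one

theorem mul_regDivisor (s : ℝ) : s * regDivisor s = 1 - cutoffBump s := by
  rcases eq_or_ne s 0 with rfl | hs
  · simp [cutoffBump_eventuallyEq_one.eq_of_nhds]
  · rw [regDivisor, mul_inv_cancel_left₀ hs]

theorem contDiff_regDivisor : ContDiff ℝ ∞ regDivisor := by
  refine contDiff_iff_contDiffAt.2 fun s => ?_
  rcases eq_or_ne s 0 with rfl | hs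
  · refine contDiffAt_const (c := 0) |>.congr_of_eventuallyEq ?_
    filter_upwards [cutoffBump_eventuallyEq_one] with t ht
    simp [regDivisor, ht]
  · exact (contDiffAt_inv ℝ hs).mul (contDiffAt_const.sub cutoffBump.contDiffAt)

theorem unifSmooth_cutoffBump : UnifSmooth fun _ : Unit => (cutoffBump : ℝ → ℝ) :=
  unifSmooth_of_hasCompactSupport cutoffBump.contDiff cutoffBump.hasCompactSupport

theorem unifSmooth_regDivisor : UnifSmooth fun _ : Unit => regDivisor :=
  unifSmooth_of_eq_inv contDiff_regDivisor fun s hs => by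
    rw [regDivisor, cutoffBump_eq_zero hs, sub_zero, mul_one]

theorem norm_inv_pow_smul_le {c : ℝ} (hc : 1 ≤ c) (m : ℕ) {v : V} {C : ℝ} (hv : ‖v‖ ≤ C) :
    ‖(c ^ m)⁻¹ • v‖ ≤ C := by
  have hcm : 1 ≤ c ^ m := one_le_pow₀ hc
  rw [norm_smul, norm_inv, Real.norm_of_nonneg (by positivity)]
  exact (mul_le_of_le_one_left (norm_nonneg _) (inv_le_one_of_one_le₀ hcm)).trans hv

theorem UnifBdd.comp_clm {L : ι → E →L[ℝ] E'} {c : ι → ℝ} (hc : ∀ i, 1 ≤ c i)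
    (hL : ∀ i, ‖L i‖ ≤ c i) {f : ι → E' → V} (hf : UnifBdd n f) :
    UnifBdd n (fun i x => (c i ^ (n + 1))⁻¹ • f i (L i x)) := by
  have hb : ∃ C : ℝ≥0, ∀ i x, ‖(c i ^ (n + 1))⁻¹ • f i (L i x)‖ ≤ C :=
    hf.bounded.imp fun C hC i x => norm_inv_pow_smul_le (hc i) _ (hC i _)
  induction n generalizing V with
  | zero =>
    obtain ⟨K, hK⟩ := hf.unifMap
    refine ⟨hb, K, fun i => LipschitzWith.of_dist_le_mul fun x y => ?_⟩
    have hci : 0 < c i := zero_lt_one.trans_le (hc i)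
    rw [dist_smul₀, zero_add, pow_one, norm_inv, Real.norm_of_nonneg hci.le, inv_mul_le_iff₀ hci]
    calc dist (f i (L i x)) (f i (L i y)) ≤ K * dist (L i x) (L i y) := (hK i).dist_le_mul _ _
      _ ≤ K * (c i * dist x y) := by
        gcongr
        rw [dist_eq_norm, dist_eq_norm, ← map_sub]
        exact (L i).le_of_opNorm_le (hL i) _
      _ = c i * (K * dist x y) := mul_left_comm _ _ _
  | succ n ih =>
    have hL' : UnifBdd n (fun i (_ : E) => (c i)⁻¹ • L i) := .const (C := 1) fun i => by
      have hci : 0 < c i := zero_lt_one.trans_le (hc i)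
      rw [norm_smul, norm_inv, Real.norm_of_nonneg hci.le, inv_mul_le_iff₀ hci, mul_one]
      exact hL i
    have hf' : UnifBdd n fun i x => (c i ^ (n + 1))⁻¹ • fderiv ℝ (f i) (L i x) :=
      ih hf.fderiv (hf.fderiv.bounded.imp fun C hC i x => norm_inv_pow_smul_le (hc i) _ (hC i _))
    refine .of_hasFDerivAt hb (fun i x => ?_)
      (UnifBdd.bilin (ContinuousLinearMap.compL ℝ E E' V) hf' hL')
    have hchain := ((hf.hasFDerivAt i (L i x)).comp x (L i).hasFDerivAt).fun_const_smul
      (c i ^ (n + 1 + 1))⁻¹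
    refine hchain.congr_fderiv ?_
    rw [ContinuousLinearMap.compL_apply, ContinuousLinearMap.comp_smul,
      ContinuousLinearMap.smul_comp, smul_smul, pow_succ _ (n + 1), mul_inv, mul_comm]

end Cutoff

section Homological

variable {ι : Type*} {d : ℕ}

theorem one_le_bracket (k : Fin d → ℤ) : 1 ≤ bracket k :=
  le_add_of_nonneg_right (Finset.sum_nonneg fun _ _ => abs_nonneg _)

/-- The linear functional `(p, q) ↦ p · k`, the small divisor of the mode `k`. -/
def actionDot (k : Fin d → ℤ) : Phase d →L[ℝ] ℝ := ∑ j, (k j : ℝ) • coordProj (Sum.inl j)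

theorem actionDot_apply (k : Fin d → ℤ) (x : Phase d) : actionDot k x = dotInt x.1 k := by
  simp [actionDot, coordProj, dotInt, mul_comm]

theorem norm_actionDot_le (k : Fin d → ℤ) : ‖actionDot k‖ ≤ bracket k := by
  refine ContinuousLinearMap.opNorm_le_bound _ (bracket_pos k).le fun x => ?_
  rw [actionDot_apply, dotInt]
  calc ‖∑ j, x.1 j * (k j : ℝ)‖ ≤ ∑ j, ‖x.1 j * (k j : ℝ)‖ := norm_sum_le _ _
    _ ≤ ∑ j, |(k j : ℝ)| * ‖x‖ := by
      gcongr with j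
      rw [norm_mul, mul_comm, Real.norm_eq_abs (k j : ℝ)]
      gcongr
      exact (norm_le_pi_norm x.1 j).trans (norm_fst_le x)
    _ ≤ bracket k * ‖x‖ := by
      rw [← Finset.sum_mul, bracket]
      gcongr
      linarith

/-- The resonant part of `F`: its modes `|k| ≤ K`, localised to `|p · k| < 1`. -/
def resPart (K : ℕ) (F : Phase d → ℝ) (y : Phase d) : ℝ :=
  ∑ k ∈ modes d K, cutoffBump (dotInt y.1 k) * cosMode k F y

/-- The solution `g` of the homological equation `p · ∂_q g = F - resPart K F - fourierTail K F`. -/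
def homSol (K : ℕ) (F : Phase d → ℝ) (y : Phase d) : ℝ :=
  ∑ k ∈ modes d K, regDivisor (dotInt y.1 k) * sinMode k F y

-- Derivatives of `f (p · k)` grow polynomially in `k`; the decay of the modes absorbs this.
theorem unifSmooth_multiplier {f : ℝ → ℝ} (hf : UnifSmooth fun _ : Unit => f)
    {G : ι × (Fin d → ℤ) → Phase d → ℝ}
    (hG : ∀ M n : ℕ, UnifBdd n (fun a x => bracket a.2 ^ M * G a x)) (K : ι → ℕ) :
    UnifSmooth fun i y => ∑ k ∈ modes d (K i), f (dotInt y.1 k) * G (i, k) y := by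
  intro n
  have hfactor := (UnifBdd.comp_clm one_le_bracket norm_actionDot_le
    ((hf n).reindex fun _ : Fin d → ℤ => ())).reindex (Prod.snd : ι × (Fin d → ℤ) → Fin d → ℤ)
  have hinv : ∀ k : Fin d → ℤ, 0 ≤ (bracket k ^ (d + 1))⁻¹ := fun k =>
    inv_nonneg.2 (pow_nonneg (bracket_pos k).le _)
  have hM : ∀ i, ∑ k ∈ modes d (K i), |(bracket k ^ (d + 1))⁻¹| ≤
      (⟨∑' k : Fin d → ℤ, (bracket k ^ (d + 1))⁻¹, tsum_nonneg hinv⟩ : ℝ≥0) := fun i => by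
    simp only [abs_of_nonneg (hinv _)]
    exact summable_bracket_pow.sum_le_tsum _ fun k _ => hinv k
  convert UnifBdd.weighted_sum hM (hfactor.mul (hG (d + 1 + (n + 1)) n)) using 3 with i y
  refine Finset.sum_congr rfl fun k _ => ?_
  have := bracket_pos k
  simp only [actionDot_apply, smul_eq_mul, pow_add]
  field_simp

theorem unifSmooth_resPart {F : ι → Phase d → ℝ} (h : UnifSmooth F) (hp : ∀ i, IsPeriodic (F i))
    (K : ι → ℕ) : UnifSmooth fun i => resPart (K i) (F i) :=
  unifSmooth_multiplier unifSmooth_cutoffBump (G := fun a => cosMode a.2 (F a.1))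
    (fun M n => (unifBdd_bracket_pow_modes M h hp n).1) K

theorem unifSmooth_homSol {F : ι → Phase d → ℝ} (h : UnifSmooth F) (hp : ∀ i, IsPeriodic (F i))
    (K : ι → ℕ) : UnifSmooth fun i => homSol (K i) (F i) :=
  unifSmooth_multiplier unifSmooth_regDivisor (G := fun a => sinMode a.2 (F a.1))
    (fun M n => (unifBdd_bracket_pow_modes M h hp n).2) K

theorem add_shift_fst (k : Fin d → ℤ) (x : Phase d) : (x + shift k).1 = x.1 := by simp [shift]

theorem isPeriodic_resPart (K : ℕ) {F : Phase d → ℝ} (hF : IsPeriodic F) :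
    IsPeriodic (resPart K F) := fun k x => by
  simp only [resPart, add_shift_fst, cosMode, isPeriodic_modeAvg _ hF k x]

theorem isPeriodic_homSol (K : ℕ) {F : Phase d → ℝ} (hF : IsPeriodic F) :
    IsPeriodic (homSol K F) := fun k x => by
  simp only [homSol, add_shift_fst, sinMode, isPeriodic_modeAvg _ hF k x]

theorem coordDeriv_homSol {F : ι → Phase d → ℝ} (h : UnifSmooth F) {i : ι}
    (hp : IsPeriodic (F i)) (K : ℕ) (j : Fin d) (y : Phase d) :
    coordDeriv (Sum.inr j) (homSol K (F i)) y =
      ∑ k ∈ modes d K, regDivisor (dotInt y.1 k) * ((k j : ℝ) * cosMode k (F i) y) := by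
  have hdiv : ∀ k, HasFDerivAt (fun y : Phase d => regDivisor (dotInt y.1 k))
      ((fderiv ℝ regDivisor (actionDot k y)).comp (actionDot k)) y := fun k => by
    simpa only [Function.comp_def, actionDot_apply] using
      ((unifSmooth_regDivisor 1).hasFDerivAt () (actionDot k y)).comp y (actionDot k).hasFDerivAt
  have hsin : ∀ k, HasFDerivAt (sinMode k (F i)) (fderiv ℝ (sinMode k (F i)) y) y := fun k =>
    (h 1).sinMode.hasFDerivAt (i, k) y
  have hsum := HasFDerivAt.fun_sum (u := modes d K) fun k _ => (hdiv k).fun_mul (hsin k)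
  have hzero : ∀ k, actionDot k (coordDir (Sum.inr j)) = 0 := fun k => by
    simp [actionDot_apply, coordDir, dotInt]
  change fderiv ℝ (fun y => ∑ k ∈ modes d K, regDivisor (dotInt y.1 k) * sinMode k (F i) y) y
    (coordDir (Sum.inr j)) = _
  rw [hsum.fderiv, sum_apply]
  refine Finset.sum_congr rfl fun k _ => ?_
  rw [← coordDeriv_sinMode h hp]
  simp [hzero, coordDeriv]

theorem sum_mul_coordDeriv_homSol {F : ι → Phase d → ℝ} (h : UnifSmooth F) {i : ι}
    (hp : IsPeriodic (F i)) (K : ℕ) (y : Phase d) :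
    ∑ j, y.1 j * coordDeriv (Sum.inr j) (homSol K (F i)) y =
      F i y - resPart K (F i) y - fourierTail K (F i) y := by
  have hmode : ∀ k, ∑ j, y.1 j * (regDivisor (dotInt y.1 k) * ((k j : ℝ) * cosMode k (F i) y)) =
      cosMode k (F i) y - cutoffBump (dotInt y.1 k) * cosMode k (F i) y := fun k => by
    rw [← one_sub_mul, ← mul_regDivisor]
    nth_rewrite 2 [dotInt]
    simp only [Finset.sum_mul]
    exact Finset.sum_congr rfl fun j _ => by ring
  simp only [coordDeriv_homSol h hp, Finset.mul_sum]
  rw [Finset.sum_comm]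
  simp only [hmode, Finset.sum_sub_distrib, resPart, fourierTail]
  ring

theorem resPart_scale_eq_sum {F : Phase d → ℝ} (hp : IsPeriodic F) (hc : Continuous F)
    (K : ℕ) (r : ℝ) (p q : Fin d → ℝ) :
    (resPart K F (scale r (p, q)) : ℂ) = ∑ k ∈ modes d K, cutoffBump (dotInt (r • p) k) *
      fourierCoef F k (r • p) * Complex.exp (Complex.I * (dotInt q k : ℂ)) :=
  sum_mul_cosMode_eq hp hc K (c := fun k => cutoffBump (dotInt (r • p) k))
    (fun k => by rw [dotInt_neg, cutoffBump.neg]) _ q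

theorem fourierCoef_resPart_scale {F : Phase d → ℝ} (hp : IsPeriodic F) (hc : Continuous F)
    (K : ℕ) (r : ℝ) (p : Fin d → ℝ) (k : Fin d → ℤ) :
    fourierCoef (fun x => resPart K F (scale r x)) k p =
      if k ∈ modes d K then cutoffBump (dotInt (r • p) k) * fourierCoef F k (r • p) else 0 :=
  fourierCoef_of_eq_sum (Z := fun x => resPart K F (scale r x))
    (c := fun k => cutoffBump (dotInt (r • p) k) * fourierCoef F k (r • p))
    (resPart_scale_eq_sum hp hc K r p) k

theorem isNormalForm_resPart {ε₀ δ β : ℝ} {F : ℝ → Phase d → ℝ}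
    (hp : ∀ ε ∈ Ioo 0 ε₀, IsPeriodic (F ε)) (hc : ∀ ε ∈ Ioo 0 ε₀, Continuous (F ε)) :
    IsNormalForm ε₀ δ β (fun ε x => resPart (cutoff β ε) (F ε) (scale (ε ^ (-δ)) x)) := by
  intro ε hε
  refine ⟨fun p q => ?_, fun k p _ hk => ?_⟩
  · rw [resPart_scale_eq_sum (hp ε hε) (hc ε hε)]
    refine Finset.sum_congr rfl fun k hk => ?_
    rw [fourierCoef_resPart_scale (hp ε hε) (hc ε hε), if_pos hk]
  · rw [fourierCoef_resPart_scale (hp ε hε) (hc ε hε)] at hk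
    have hlt : |dotInt (ε ^ (-δ) • p) k| < 1 := lt_of_not_ge fun hle => hk <| by
      simp [cutoffBump_eq_zero hle]
    rw [dotInt_smul, abs_mul, abs_of_pos (Real.rpow_pos_of_pos hε.1 _), Real.rpow_neg hε.1.le,
      inv_mul_lt_iff₀ (Real.rpow_pos_of_pos hε.1 δ), mul_one] at hlt
    exact hlt.le

end Homological

section SymplecticForm

variable {d : ℕ}

/-- The linear map `ℓ ↦ (-ℓ_q, ℓ_p)` from covectors to vectors, so that `X_g = symplGrad (dg)`. -/
def symplGrad : (Phase d →L[ℝ] ℝ) →L[ℝ] Phase d :=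
  (ContinuousLinearMap.pi fun j => -ContinuousLinearMap.apply ℝ ℝ (coordDir (Sum.inr j))).prod
    (ContinuousLinearMap.pi fun j => ContinuousLinearMap.apply ℝ ℝ (coordDir (Sum.inl j)))

theorem hamVF_eq_symplGrad (g : Phase d → ℝ) (x : Phase d) :
    hamVF g x = symplGrad (fderiv ℝ g x) := rfl

theorem hamVF_fst (g : Phase d → ℝ) (x : Phase d) (j : Fin d) :
    (hamVF g x).1 j = -coordDeriv (Sum.inr j) g x := rfl

theorem hamVF_snd (g : Phase d → ℝ) (x : Phase d) (j : Fin d) :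
    (hamVF g x).2 j = coordDeriv (Sum.inl j) g x := rfl

theorem IsPeriodic.hamVF_add_shift {g : Phase d → ℝ} (hg : IsPeriodic g) (x : Phase d)
    (k : Fin d → ℤ) : hamVF g (x + shift k) = hamVF g x :=
  Prod.ext (funext fun j => congrArg Neg.neg (hg.coordDeriv (Sum.inr j) k x))
    (funext fun j => hg.coordDeriv (Sum.inl j) k x)

theorem symp_swap (u v : Phase d) : symp u v = -symp v u := by
  simp only [symp, ← Finset.sum_neg_distrib]
  exact Finset.sum_congr rfl fun j _ => by ring

theorem symp_symplGrad (ℓ : Phase d →L[ℝ] ℝ) (v : Phase d) : symp (symplGrad ℓ) v = -ℓ v := by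
  conv_rhs => rw [eq_sum_smulRight_coordProj ℓ, Fintype.sum_sum_type]
  simp only [symp, symplGrad, coordProj, add_apply, sum_apply, smul_eq_mul,
    ContinuousLinearMap.smulRight_apply, ContinuousLinearMap.prod_apply,
    ContinuousLinearMap.coe_pi', neg_apply, ContinuousLinearMap.apply_apply,
    ContinuousLinearMap.comp_apply, ContinuousLinearMap.proj_apply,
    ContinuousLinearMap.coe_fst', ContinuousLinearMap.coe_snd',
    ← Finset.sum_add_distrib, ← Finset.sum_neg_distrib]
  exact Finset.sum_congr rfl fun j _ => by ring

theorem symp_fderiv_hamVF {g : Phase d → ℝ} (hg : ContDiff ℝ ∞ g) (x u v : Phase d) :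
    symp (fderiv ℝ (hamVF g) x u) v + symp u (fderiv ℝ (hamVF g) x v) = 0 := by
  have hd : DifferentiableAt ℝ (fderiv ℝ g) x :=
    (hg.fderiv_right (m := ∞) (by simp)).differentiable (by simp) x
  have hX : fderiv ℝ (hamVF g) x = symplGrad.comp (fderiv ℝ (fderiv ℝ g) x) :=
    (symplGrad.hasFDerivAt.comp x hd.hasFDerivAt).fderiv
  simp only [symp_swap u, hX, ContinuousLinearMap.comp_apply, symp_symplGrad,
    (isSymmSndFDerivAt_of_contDiff hg x).eq u v]
  ring

theorem hasDerivWithinAt_symp {a b : ℝ → Phase d} {a' b' : Phase d} {s : Set ℝ} {t : ℝ}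
    (ha : HasDerivWithinAt a a' s t) (hb : HasDerivWithinAt b b' s t) :
    HasDerivWithinAt (fun t => symp (a t) (b t)) (symp a' (b t) + symp (a t) b') s t := by
  have hproj (c : Fin d ⊕ Fin d) {y : ℝ → Phase d} {y' : Phase d}
      (hy : HasDerivWithinAt y y' s t) :
      HasDerivWithinAt (fun t => coordProj c (y t)) (coordProj c y') s t :=
    (coordProj c).hasFDerivAt.comp_hasDerivWithinAt t hy
  have hsum := HasDerivWithinAt.fun_sum (u := Finset.univ) fun (j : Fin d) _ =>
    ((hproj (Sum.inl j) ha).fun_mul (hproj (Sum.inr j) hb)).fun_sub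
      ((hproj (Sum.inr j) ha).fun_mul (hproj (Sum.inl j) hb))
  refine hsum.congr_deriv ?_
  rw [symp, symp, ← Finset.sum_add_distrib]
  refine Finset.sum_congr rfl fun j _ => ?_
  simp only [coordProj, ContinuousLinearMap.comp_apply, ContinuousLinearMap.proj_apply,
    ContinuousLinearMap.coe_fst', ContinuousLinearMap.coe_snd']
  ring

/-- The Poisson bracket `∑ (∂_q f ∂_p g - ∂_p f ∂_q g)`. -/
def poisson (f g : Phase d → ℝ) (x : Phase d) : ℝ := fderiv ℝ f x (hamVF g x)

end SymplecticForm

section HamiltonianFlows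

variable {ι : Type*} {d : ℕ} {g : Phase d → ℝ} {Φ : ℝ → Phase d → Phase d}

theorem hamVF_integralCurve_unique {K : ℝ≥0} (hg : LipschitzWith K (hamVF g)) {γ η : ℝ → Phase d}
    (hγ : ∀ t, HasDerivAt γ (hamVF g (γ t)) t) (hη : ∀ t, HasDerivAt η (hamVF g (η t)) t)
    (h₀ : γ 0 = η 0) : γ = η :=
  ODE_solution_unique_univ (v := fun _ => hamVF g) (s := fun _ => univ)
    (fun _ => hg.lipschitzOnWith) (fun t => ⟨hγ t, trivial⟩) (fun t => ⟨hη t, trivial⟩) h₀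

theorem IsHamFlow.add_time {K : ℝ≥0} (hΦ : IsHamFlow g Φ) (hg : LipschitzWith K (hamVF g))
    (s t : ℝ) (x : Phase d) : Φ (t + s) x = Φ t (Φ s x) :=
  congrFun (hamVF_integralCurve_unique hg (γ := fun t => Φ (t + s) x) (η := fun t => Φ t (Φ s x))
    (fun t => ((hΦ x).2 (t + s)).comp_add_const t s) (hΦ _).2
    (by rw [zero_add, (hΦ _).1])) t

theorem IsHamFlow.add_shift {K : ℝ≥0} (hΦ : IsHamFlow g Φ) (hg : LipschitzWith K (hamVF g))
    (hp : IsPeriodic g) (t : ℝ) (x : Phase d) (k : Fin d → ℤ) :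
    Φ t (x + shift k) = Φ t x + shift k :=
  congrFun (hamVF_integralCurve_unique hg (γ := fun t => Φ t (x + shift k))
    (η := fun t => Φ t x + shift k) (hΦ _).2
    (fun t => by rw [hp.hamVF_add_shift]; exact ((hΦ x).2 t).add_const _)
    (by rw [(hΦ _).1, (hΦ _).1])) t

theorem IsHamFlow.neg_time (hΦ : IsHamFlow g Φ) :
    IsHamFlow (fun x => -g x) (fun t => Φ (-t)) := fun x => by
  refine ⟨by simpa using (hΦ x).1, fun t => ?_⟩
  rw [hamVF_eq_symplGrad, fderiv_fun_neg, map_neg, ← hamVF_eq_symplGrad]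
  simpa using! ((hΦ x).2 (-t)).scomp t (hasDerivAt_neg t)

theorem IsHamFlow.hasDerivAt_comp {f : Phase d → ℝ} (hΦ : IsHamFlow g Φ)
    (hf : Differentiable ℝ f) (x : Phase d) (t : ℝ) :
    HasDerivAt (fun s => f (Φ s x)) (poisson f g (Φ t x)) t :=
  (hf (Φ t x)).hasFDerivAt.comp_hasDerivAt t ((hΦ x).2 t)

variable {G : ι → Phase d → ℝ}

theorem UnifSmooth.hamVF (h : UnifSmooth G) : UnifSmooth (fun i => hamVF (G i)) :=
  fun n => (h.fderiv n).clm symplGrad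

theorem UnifSmooth.exists_isHamFlow (h : UnifSmooth G) (i : ι) : ∃ Φ, IsHamFlow (G i) Φ := by
  obtain ⟨L, hL⟩ := (h.hamVF 0).bounded
  obtain ⟨K, hK⟩ := (h.hamVF 0).unifMap
  exact exists_global_flow ((h.hamVF 1).unifMap.contDiff i) (hL i) (hK i)

variable {Φ : ι → ℝ → Phase d → Phase d}

theorem IsHamFlow.isIntegralCurveOn (hΦ : ∀ i, IsHamFlow (G i) (Φ i)) (i : ι) (x : Phase d) :
    IsIntegralCurveOn (fun t => Φ i t x) (fun _ => NormalFormLemma.hamVF (G i)) (Icc 0 1) :=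
  fun t _ => ((hΦ i x).2 t).hasDerivWithinAt

theorem IsHamFlow.unifMap (hΦ : ∀ i, IsHamFlow (G i) (Φ i)) (h : UnifSmooth G) (n : ℕ) :
    UnifMap n (timeFamily Φ) :=
  unifMap_flow h.hamVF (fun i x => (hΦ i x).1) (isIntegralCurveOn hΦ) n

theorem IsHamFlow.contDiff (hΦ : ∀ i, IsHamFlow (G i) (Φ i)) (h : UnifSmooth G) (i : ι) :
    ContDiff ℝ ∞ (Φ i 1) :=
  contDiff_infty.2 fun n => (unifMap hΦ h n).contDiff (i, ⟨1, right_mem_Icc.2 zero_le_one⟩)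

theorem IsHamFlow.symp_fderiv (hΦ : ∀ i, IsHamFlow (G i) (Φ i)) (h : UnifSmooth G) (i : ι)
    (x u v : Phase d) : symp (fderiv ℝ (Φ i 1) x u) (fderiv ℝ (Φ i 1) x v) = symp u v := by
  obtain ⟨-, hode⟩ := flow_differentiable_and_fderiv (n := 0) (h.hamVF 2)
    (fun i x => (hΦ i x).1) (isIntegralCurveOn hΦ)
  have hcurve (w : Phase d) : ∀ t ∈ Icc (0 : ℝ) 1,
      HasDerivWithinAt (fun s => fderiv ℝ (Φ i s) x w)
        (fderiv ℝ (NormalFormLemma.hamVF (G i)) (Φ i t x) (fderiv ℝ (Φ i t) x w)) (Icc 0 1) t :=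
    fun t ht => by
      simpa using! (ContinuousLinearMap.apply ℝ (Phase d) w).hasFDerivAt.comp_hasDerivWithinAt t
        (hode.isIntegralCurveOn i x t ht)
  have hconst : ∀ t ∈ Icc (0 : ℝ) 1, HasDerivWithinAt
      (fun s => symp (fderiv ℝ (Φ i s) x u) (fderiv ℝ (Φ i s) x v)) 0 (Icc 0 1) t :=
    fun t ht => (hasDerivWithinAt_symp (hcurve u t ht) (hcurve v t ht)).congr_deriv
      (symp_fderiv_hamVF (h.contDiff i) _ _ _)
  have hbound := (convex_Icc (0 : ℝ) 1).norm_image_sub_le_of_norm_hasDerivWithin_le hconst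
    (C := 0) (fun _ _ => by simp) (left_mem_Icc.2 zero_le_one) (right_mem_Icc.2 zero_le_one)
  rw [zero_mul, norm_le_zero_iff, sub_eq_zero] at hbound
  rw [hbound, show Φ i 0 = id from funext fun z => (hΦ i z).1, fderiv_id]
  rfl

theorem IsHamFlow.isCanonical (hΦ : ∀ i, IsHamFlow (G i) (Φ i)) (h : UnifSmooth G)
    (hp : ∀ i, IsPeriodic (G i)) (i : ι) : IsCanonical (Φ i 1) := by
  obtain ⟨K, hK⟩ := (h.hamVF 0).unifMap
  refine ⟨contDiff hΦ h i, fun x k => ⟨k, (hΦ i).add_shift (hK i) (hp i) 1 x k⟩,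
    ⟨Φ i (-1), contDiff (fun i => (hΦ i).neg_time) (fun n => (h n).neg) i,
      fun x k => ⟨k, (hΦ i).add_shift (hK i) (hp i) (-1) x k⟩, fun x => ?_, fun x => ?_⟩,
    symp_fderiv hΦ h i⟩
  · rw [← (hΦ i).add_time (hK i), neg_add_cancel, (hΦ i x).1]
  · rw [← (hΦ i).add_time (hK i), add_neg_cancel, (hΦ i x).1]

end HamiltonianFlows

section CanonicalMaps

variable {d : ℕ} {S T : Phase d → Phase d} {r s : ℝ}

theorem Descends.comp (hS : Descends S) (hT : Descends T) : Descends (S ∘ T) := fun x k => by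
  obtain ⟨l, hl⟩ := hT x k
  obtain ⟨l', hl'⟩ := hS (T x) l
  exact ⟨l', by simp only [Function.comp, hl, hl']⟩

theorem IsCanonical.comp (hS : IsCanonical S) (hT : IsCanonical T) : IsCanonical (S ∘ T) := by
  obtain ⟨S', hS', hdS', hlS, hrS⟩ := hS.exists_inverse
  obtain ⟨T', hT', hdT', hlT, hrT⟩ := hT.exists_inverse
  refine ⟨hS.smooth.comp hT.smooth, hS.descends.comp hT.descends,
    ⟨T' ∘ S', hT'.comp hS', hdT'.comp hdS', hlS.comp hlT, hrS.comp hrT⟩, fun x u v => ?_⟩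
  rw [fderiv_comp x (hS.smooth.differentiable (by simp) _) (hT.smooth.differentiable (by simp) x)]
  simp only [ContinuousLinearMap.comp_apply, hS.symplectic, hT.symplectic]

theorem isCanonical_id : IsCanonical (id : Phase d → Phase d) :=
  ⟨contDiff_id, fun _ k => ⟨k, rfl⟩,
    ⟨id, contDiff_id, fun _ k => ⟨k, rfl⟩, fun _ => rfl, fun _ => rfl⟩, fun x u v => by simp⟩

theorem symp_scale (r : ℝ) (u v : Phase d) : symp (scale r u) (scale r v) = r * symp u v := by
  simp only [symp, scale_apply, Pi.smul_apply, smul_eq_mul, Finset.mul_sum]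
  exact Finset.sum_congr rfl fun j _ => by ring

theorem Descends.conj_scale (hT : Descends T) (r s : ℝ) :
    Descends (fun x => scale r (T (scale s x))) := fun x k => by
  obtain ⟨l, hl⟩ := hT (scale s x) k
  exact ⟨l, by simp only [scale_add_shift, hl]⟩

theorem IsCanonical.conj_scale (hT : IsCanonical T) (hrs : r * s = 1) :
    IsCanonical (fun x => scale r (T (scale s x))) := by
  have hsr : s * r = 1 := mul_comm r s ▸ hrs
  obtain ⟨S, hS, hdS, hl, hr⟩ := hT.exists_inverse
  refine ⟨(scale r).contDiff.comp (hT.smooth.comp (scale s).contDiff), hT.descends.conj_scale r s,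
    ⟨fun x => scale r (S (scale s x)), (scale r).contDiff.comp (hS.comp (scale s).contDiff),
      hdS.conj_scale r s, fun x => ?_, fun x => ?_⟩, fun x u v => ?_⟩
  · simp only [scale_scale hsr, hl _, scale_scale hrs]
  · simp only [scale_scale hsr, hr _, scale_scale hrs]
  · have hd : HasFDerivAt (fun x => scale r (T (scale s x))) _ x :=
      (scale r).hasFDerivAt.comp x ((hT.smooth.differentiable (by simp) _).hasFDerivAt.comp x
        (scale s).hasFDerivAt)
    simp only [hd.fderiv, ContinuousLinearMap.comp_apply, symp_scale, hT.symplectic, ← mul_assoc,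
      hrs, one_mul]

theorem coordDeriv_const_mul_comp_scale (a : Fin d ⊕ Fin d) (c r : ℝ) {f : Phase d → ℝ}
    (hf : ContDiff ℝ ∞ f) (x : Phase d) : coordDeriv a (fun x => c * f (scale r x)) x =
      c * r ^ (if a.isLeft then 1 else 0) * coordDeriv a f (scale r x) := by
  have h := congrFun (wordDeriv_const_mul_comp_scale [a] c r hf) x
  rwa [List.countP_singleton] at h

theorem hamVF_conj_scale {g : Phase d → ℝ} (hg : ContDiff ℝ ∞ g) (hrs : r * s = 1) (y : Phase d) :
    hamVF (fun x => r * g (scale s x)) (scale r y) = scale r (hamVF g y) := by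
  have hsr : s * r = 1 := mul_comm r s ▸ hrs
  refine Prod.ext ?_ ?_ <;> ext j
  · simp only [hamVF_fst, coordDeriv_const_mul_comp_scale _ _ _ hg, scale_scale hsr]
    simp [hamVF_fst]
  · simp only [hamVF_snd, coordDeriv_const_mul_comp_scale _ _ _ hg, scale_scale hsr]
    simp [hamVF_snd, hrs]

theorem IsHamFlow.conj_scale {g : Phase d → ℝ} {Φ : ℝ → Phase d → Phase d} (hΦ : IsHamFlow g Φ)
    (hg : ContDiff ℝ ∞ g) (hrs : r * s = 1) :
    IsHamFlow (fun x => r * g (scale s x)) (fun t x => scale r (Φ t (scale s x))) := fun x => by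
  refine ⟨by beta_reduce; rw [(hΦ _).1, scale_scale hrs], fun t => ?_⟩
  rw [hamVF_conj_scale hg hrs]
  exact (scale r).hasFDerivAt.comp_hasDerivAt t ((hΦ _).2 t)

end CanonicalMaps

section Orders

variable {ι κ : Type*} {E V W U : Type} [NormedAddCommGroup E] [NormedSpace ℝ E]
  [NormedAddCommGroup V] [NormedSpace ℝ V] [NormedAddCommGroup W] [NormedSpace ℝ W]
  [NormedAddCommGroup U] [NormedSpace ℝ U] {e : ι → ℝ} {m m' s : ℝ}

/-- `F i = O(e i ^ m)` with all its derivatives, uniformly in the index and in space. -/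
def HasOrder (e : ι → ℝ) (m : ℝ) (F : ι → E → V) : Prop :=
  UnifSmooth fun i x => e i ^ (-m) • F i x

namespace HasOrder

variable {F G : ι → E → V}

theorem add (hF : HasOrder e m F) (hG : HasOrder e m G) :
    HasOrder e m (fun i x => F i x + G i x) := fun n => by
  simpa only [smul_add] using (hF n).add (hG n)

theorem sub (hF : HasOrder e m F) (hG : HasOrder e m G) :
    HasOrder e m (fun i x => F i x - G i x) := fun n => by
  simpa only [smul_sub] using (hF n).sub (hG n)

theorem clm (hF : HasOrder e m F) (L : V →L[ℝ] W) : HasOrder e m (fun i x => L (F i x)) :=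
  fun n => by simpa only [map_smul] using (hF n).clm L

theorem rpow_smul (hF : HasOrder e m F) (he : ∀ i, 0 < e i) (s : ℝ) :
    HasOrder e (m + s) (fun i x => e i ^ s • F i x) := fun n => by
  simpa only [smul_smul, ← Real.rpow_add (he _), neg_add, neg_add_cancel_right] using hF n

theorem mono {b : ℝ} (hF : HasOrder e m F) (he : ∀ i, 0 < e i) (hb : ∀ i, e i ≤ b)
    (hm : m' ≤ m) : HasOrder e m' F := fun n => by
  have hgain : ∀ i, |e i ^ (m - m')| ≤ b ^ (m - m') := fun i => by
    rw [abs_of_pos (Real.rpow_pos_of_pos (he i) _)]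
    exact Real.rpow_le_rpow (he i).le (hb i) (sub_nonneg.2 hm)
  simpa only [smul_smul, ← Real.rpow_add (he _), show m - m' + -m = -m' by ring] using
    (hF n).const_smul hgain

theorem unifSmooth {b : ℝ} (hF : HasOrder e m F) (he : ∀ i, 0 < e i) (hb : ∀ i, e i ≤ b)
    (hm : 0 ≤ m) : UnifSmooth F := fun n => by
  simpa using hF.mono he hb hm n

theorem contDiff (hF : HasOrder e m F) (he : ∀ i, 0 < e i) (i : ι) : ContDiff ℝ ∞ (F i) := by
  simpa only [smul_smul, rpow_mul_rpow_neg (he i), one_smul] using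
    (UnifSmooth.contDiff hF i).const_smul (e i ^ m)

protected theorem differentiable (hF : HasOrder e m F) (he : ∀ i, 0 < e i) (i : ι) :
    Differentiable ℝ (F i) :=
  (hF.contDiff he i).differentiable (by simp)

theorem exists_bound (hF : HasOrder e m F) (he : ∀ i, 0 < e i) :
    ∃ C, 0 < C ∧ ∀ i x, ‖F i x‖ ≤ C * e i ^ m := by
  obtain ⟨C, hC⟩ := (hF 0).bounded
  refine ⟨C + 1, by positivity, fun i x => ?_⟩
  have hpos := Real.rpow_pos_of_pos (he i) m
  have hbound := (hC i x).trans (le_add_of_nonneg_right zero_le_one)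
  rwa [norm_smul, Real.rpow_neg (he i).le, norm_inv, Real.norm_of_nonneg hpos.le,
    inv_mul_le_iff₀ hpos, mul_comm] at hbound

protected theorem fderiv (hF : HasOrder e m F) (he : ∀ i, 0 < e i) :
    HasOrder e m (fun i => fderiv ℝ (F i)) := fun n => by
  convert UnifSmooth.fderiv hF n using 3 with i x
  exact (fderiv_fun_const_smul (hF.differentiable he i x) _).symm

theorem bilin {H : ι → E → W} (hF : HasOrder e m F) (hH : HasOrder e m' H) (he : ∀ i, 0 < e i)
    (B : V →L[ℝ] W →L[ℝ] U) : HasOrder e (m + m') (fun i x => B (F i x) (H i x)) := fun n => by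
  simpa only [map_smul, smul_apply, smul_smul, ← Real.rpow_add (he _), ← neg_add, add_comm m'] using
    UnifBdd.bilin B (hF n) (hH n)

theorem comp {F : ι → W → V} (hF : HasOrder e m F) (r : κ → ι) {φ : κ → E → W}
    (hφ : ∀ n, UnifMap n φ) : HasOrder (fun k => e (r k)) m (fun k x => F (r k) (φ k x)) :=
  fun n => ((hF n).reindex r).comp (hφ n)

theorem reindex (hF : HasOrder e m F) (r : κ → ι) :
    HasOrder (fun k => e (r k)) m (fun k => F (r k)) := fun n => (hF n).reindex r

theorem time_one {w : ι → ℝ → E → V}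
    (hw : HasOrder (fun a : ι × Icc (0 : ℝ) 1 => e a.1) m (timeFamily w)) :
    HasOrder e m (fun i => w i 1) :=
  hw.reindex fun i => (i, ⟨1, right_mem_Icc.2 zero_le_one⟩)

theorem timeIntegral [FiniteDimensional ℝ E] [FiniteDimensional ℝ V] {b w : ι → ℝ → E → V}
    (hb : HasOrder (fun a : ι × Icc (0 : ℝ) 1 => e a.1) m (timeFamily b))
    (hbc : ∀ i x, ContinuousOn (fun t => b i t x) (Icc 0 1)) (hw₀ : ∀ i x, w i 0 x = 0)
    (hw : ∀ i x, ∀ t ∈ Icc (0 : ℝ) 1,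
      HasDerivWithinAt (fun s => w i s x) (b i t x) (Icc 0 1) t) :
    HasOrder (fun a : ι × Icc (0 : ℝ) 1 => e a.1) m (timeFamily w) :=
  UnifSmooth.timeIntegral (b := fun i t x => e i ^ (-m) • b i t x)
    (w := fun i t x => e i ^ (-m) • w i t x) hb (fun i x => (hbc i x).const_smul _)
    (fun i x => by rw [hw₀, smul_zero]) fun i x t ht => (hw i x t ht).const_smul _

end HasOrder

end Orders

section HamiltonianOrders

variable {ι : Type*} {d : ℕ} {e : ι → ℝ} {m s : ℝ}

theorem HasOrder.hamVF {Γ : ι → Phase d → ℝ} (hΓ : HasOrder e s Γ) (he : ∀ i, 0 < e i) :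
    HasOrder e s (fun i => hamVF (Γ i)) :=
  (hΓ.fderiv he).clm symplGrad

theorem HasOrder.poisson {f Γ : ι → Phase d → ℝ} (hf : HasOrder e m f) (hΓ : HasOrder e s Γ)
    (he : ∀ i, 0 < e i) : HasOrder e (m + s) (fun i => poisson (f i) (Γ i)) :=
  (hf.fderiv he).bilin (hΓ.hamVF he) he (ContinuousLinearMap.id ℝ (Phase d →L[ℝ] ℝ))

theorem continuous_poisson {f g : Phase d → ℝ} (hf : ContDiff ℝ ∞ f) (hg : ContDiff ℝ ∞ g) :
    Continuous (poisson f g) :=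
  (hf.continuous_fderiv (by simp)).clm_apply
    (symplGrad.continuous.comp (hg.continuous_fderiv (by simp)))

theorem IsHamFlow.continuous_comp {g f : Phase d → ℝ} {Φ : ℝ → Phase d → Phase d}
    (hΦ : IsHamFlow g Φ) (hf : Continuous f) (x : Phase d) : Continuous fun t => f (Φ t x) :=
  hf.comp (continuous_iff_continuousAt.2 fun t => ((hΦ x).2 t).continuousAt)

variable {Γ : ι → Phase d → ℝ} {Ψ : ι → ℝ → Phase d → Phase d}

theorem HasOrder.comp_flow_sub {f : ι → Phase d → ℝ} (hf : HasOrder e m f) (hΓ : HasOrder e s Γ)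
    (he : ∀ i, 0 < e i) (hΓs : UnifSmooth Γ) (hΨ : ∀ i, IsHamFlow (Γ i) (Ψ i)) :
    HasOrder (fun a : ι × Icc (0 : ℝ) 1 => e a.1) (m + s)
      (timeFamily fun i t x => f i (Ψ i t x) - f i x) :=
  .timeIntegral (b := fun i t x => NormalFormLemma.poisson (f i) (Γ i) (Ψ i t x))
    ((hf.poisson hΓ he).comp Prod.fst (IsHamFlow.unifMap hΨ hΓs))
    (fun i x => ((hΨ i).continuous_comp
      (continuous_poisson (hf.contDiff he i) (hΓ.contDiff he i)) x).continuousOn)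
    (fun i x => by rw [(hΨ i x).1, sub_self])
    fun i x t _ => (((hΨ i).hasDerivAt_comp (hf.differentiable he i) x t).sub_const
      _).hasDerivWithinAt

/-- The function `h` need not itself have an order, only its bracket with the generator: the free
Hamiltonian is unbounded. -/
theorem HasOrder.comp_flow_sub_sub {h B : ι → Phase d → ℝ} (hB : HasOrder e m B)
    (hΓ : HasOrder e s Γ) (he : ∀ i, 0 < e i) (hΓs : UnifSmooth Γ)
    (hΨ : ∀ i, IsHamFlow (Γ i) (Ψ i)) (hh : ∀ i, Differentiable ℝ (h i))
    (hbracket : ∀ i x, NormalFormLemma.poisson (h i) (Γ i) x = B i x) :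
    HasOrder (fun a : ι × Icc (0 : ℝ) 1 => e a.1) (m + s)
      (timeFamily fun i t x => h i (Ψ i t x) - h i x - t * B i x) :=
  .timeIntegral (b := fun i t x => B i (Ψ i t x) - B i x) (hB.comp_flow_sub hΓ he hΓs hΨ)
    (fun i x => (((hΨ i).continuous_comp (hB.contDiff he i).continuous x).sub
      continuous_const).continuousOn)
    (fun i x => by rw [(hΨ i x).1, sub_self, zero_mul, sub_zero])
    fun i x t _ => by
      have hderiv := (((hΨ i).hasDerivAt_comp (hh i) x t).sub_const (h i x)).fun_sub
        ((hasDerivAt_id t).mul_const (B i x))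
      rw [hbracket, one_mul] at hderiv
      exact hderiv.hasDerivWithinAt

theorem IsHamFlow.exists_norm_sub_le (hΨ : ∀ i, IsHamFlow (Γ i) (Ψ i)) (hΓ : HasOrder e s Γ)
    (he : ∀ i, 0 < e i) : ∃ C, 0 < C ∧ ∀ i x, ‖Ψ i 1 x - x‖ ≤ C * e i ^ s := by
  obtain ⟨C, hC₀, hC⟩ := (hΓ.hamVF he).exists_bound he
  refine ⟨C, hC₀, fun i x => ?_⟩
  have hspeed := norm_image_sub_le_of_norm_deriv_le_segment_01' (f := fun t => Ψ i t x)
    (fun t _ => ((hΨ i x).2 t).hasDerivWithinAt) (fun t _ => hC i _)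
  rwa [(hΨ i x).1] at hspeed

end HamiltonianOrders

section NormalizationStep

variable {ι : Type*} {d : ℕ} {e : ι → ℝ} {m : ℝ} {F : ι → Phase d → ℝ}

theorem IsPeriodic.const_mul {f : Phase d → ℝ} (hf : IsPeriodic f) (c : ℝ) :
    IsPeriodic (fun x => c * f x) := fun k x => congrArg (c * ·) (hf k x)

theorem HasOrder.resPart (hF : HasOrder e m F) (hp : ∀ i, IsPeriodic (F i)) (K : ι → ℕ) :
    HasOrder e m (fun i => resPart (K i) (F i)) := fun n => by
  convert unifSmooth_resPart hF (fun i => (hp i).const_mul _) K n using 3 with i x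
  simp only [NormalFormLemma.resPart, smul_eq_mul, cosMode, modeAvg_const_mul, Finset.mul_sum,
    mul_left_comm]

theorem HasOrder.homSol (hF : HasOrder e m F) (hp : ∀ i, IsPeriodic (F i)) (K : ι → ℕ) :
    HasOrder e m (fun i => homSol (K i) (F i)) := fun n => by
  convert unifSmooth_homSol hF (fun i => (hp i).const_mul _) K n using 3 with i x
  simp only [NormalFormLemma.homSol, smul_eq_mul, sinMode, modeAvg_const_mul, Finset.mul_sum,
    mul_left_comm]

theorem HasOrder.fourierTail {s C : ℝ} {K : ι → ℕ} {M : ℕ} (hF : HasOrder e m F)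
    (hp : ∀ i, IsPeriodic (F i)) (he : ∀ i, 0 < e i) (hK₀ : ∀ i, 0 < K i)
    (hK : ∀ i, e i ^ (-s) ≤ C * (K i : ℝ) ^ M) :
    HasOrder e (m + s) (fun i => fourierTail (K i) (F i)) := fun n => by
  have hKpos : ∀ i, (0 : ℝ) < (K i : ℝ) ^ M := fun i => pow_pos (Nat.cast_pos.2 (hK₀ i)) M
  have hgain : ∀ i, |e i ^ (-s) / (K i : ℝ) ^ M| ≤ C := fun i => by
    rw [abs_of_nonneg (div_nonneg (Real.rpow_nonneg (he i).le _) (hKpos i).le),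
      div_le_iff₀ (hKpos i)]
    exact hK i
  convert (unifSmooth_fourierTail hF (fun i => (hp i).const_mul _) K M n).const_smul hgain
    using 3 with i x
  simp only [NormalFormLemma.fourierTail, smul_eq_mul, cosMode, modeAvg_const_mul,
    ← Finset.mul_sum, ← mul_sub]
  rw [neg_add, Real.rpow_add (he i)]
  field_simp [(hKpos i).ne']

theorem hasFDerivAt_freeHam (x : Phase d) :
    HasFDerivAt freeHam (∑ j, x.1 j • coordProj (Sum.inl j)) x := by
  refine HasFDerivAt.fun_sum fun j _ => ?_
  have hsq : HasDerivAt (fun t : ℝ => t ^ 2 / 2) (x.1 j) (coordProj (Sum.inl j) x) :=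
    ((hasDerivAt_pow 2 _).div_const 2).congr_deriv (by simp [coordProj])
  exact hsq.comp_hasFDerivAt x (coordProj (Sum.inl j)).hasFDerivAt

theorem poisson_freeHam (g : Phase d → ℝ) (x : Phase d) :
    poisson freeHam g x = -∑ j, x.1 j * coordDeriv (Sum.inr j) g x := by
  simp [poisson, (hasFDerivAt_freeHam x).fderiv, coordProj, hamVF_fst]

theorem isPeriodic_freeHam : IsPeriodic (freeHam (d := d)) := fun k x => by
  simp [freeHam, shift]

/-- The generator `ε ^ (-2δ) g` of the normalizing transformation in the rescaled variables, where
the free Hamiltonian is `ε ^ (2δ) freeHam` and `g` solves the homological equation. -/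
def stepGenerator (δ ε : ℝ) (K : ℕ) (F : Phase d → ℝ) (y : Phase d) : ℝ :=
  ε ^ (-(2 * δ)) * homSol K F y

theorem isPeriodic_stepGenerator (δ ε : ℝ) (K : ℕ) {F : Phase d → ℝ} (hF : IsPeriodic F) :
    IsPeriodic (stepGenerator δ ε K F) :=
  (isPeriodic_homSol K hF).const_mul _

theorem HasOrder.stepGenerator (hF : HasOrder e m F) (hp : ∀ i, IsPeriodic (F i))
    (he : ∀ i, 0 < e i) (δ : ℝ) (K : ι → ℕ) :
    HasOrder e (m - 2 * δ) (fun i => stepGenerator δ (e i) (K i) (F i)) :=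
  (hF.homSol hp K).rpow_smul he (-(2 * δ))

theorem poisson_const_mul_freeHam_stepGenerator (h : UnifSmooth F) {i : ι}
    (hp : IsPeriodic (F i)) {ε : ℝ} (hε : 0 < ε) (δ : ℝ) (K : ℕ) (y : Phase d) :
    poisson (fun x => ε ^ (2 * δ) * freeHam x) (stepGenerator δ ε K (F i)) y =
      resPart K (F i) y + fourierTail K (F i) y - F i y := by
  have hfree : poisson (fun x => ε ^ (2 * δ) * freeHam x) (stepGenerator δ ε K (F i)) y =
      ε ^ (2 * δ) * poisson freeHam (stepGenerator δ ε K (F i)) y := by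
    rw [poisson, ((hasFDerivAt_freeHam y).const_mul _).fderiv, poisson,
      (hasFDerivAt_freeHam y).fderiv, smul_apply, smul_eq_mul]
  have hderiv (j : Fin d) : coordDeriv (Sum.inr j) (stepGenerator δ ε K (F i)) y =
      ε ^ (-(2 * δ)) * coordDeriv (Sum.inr j) (homSol K (F i)) y := by
    have hd := (unifSmooth_homSol (K := fun _ : Unit => K) (F := fun _ => F i)
      (fun n => (h n).reindex fun _ => i) (fun _ => hp)).contDiff () |>.differentiable (by simp) y
    exact congrArg (· (coordDir (Sum.inr j))) (fderiv_const_mul hd _)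
  simp only [hfree, poisson_freeHam, hderiv, mul_left_comm _ (ε ^ (-(2 * δ))), ← Finset.mul_sum]
  rw [← mul_neg, ← mul_assoc, rpow_mul_rpow_neg hε, one_mul, sum_mul_coordDeriv_homSol h hp]
  ring

/-- One step of the normalization in the rescaled variables: the term `F` of order `m` is replaced
by its resonant part, up to an error of order `m + (1 - 2δ)`. -/
theorem hasOrder_normalization_error {b δ C : ℝ} {K : ι → ℕ} {M : ℕ} {W : ι → Phase d → ℝ}
    {Ψ : ι → ℝ → Phase d → Phase d} (he : ∀ i, 0 < e i) (hb : ∀ i, e i ≤ b) (hδ : 2 * δ ≤ 1)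
    (hm : 1 ≤ m) (hK₀ : ∀ i, 0 < K i) (hK : ∀ i, e i ^ (-(1 - 2 * δ)) ≤ C * (K i : ℝ) ^ M)
    (hW : HasOrder e 1 W) (hF : HasOrder e m F) (hp : ∀ i, IsPeriodic (F i))
    (hΨ : ∀ i, IsHamFlow (stepGenerator δ (e i) (K i) (F i)) (Ψ i)) :
    HasOrder e (m + (1 - 2 * δ)) (fun i y =>
      e i ^ (2 * δ) * freeHam (Ψ i 1 y) + W i (Ψ i 1 y) + F i (Ψ i 1 y) -
        (e i ^ (2 * δ) * freeHam y + W i y + resPart (K i) (F i) y)) := by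
  have hΓ := hF.stepGenerator hp he δ K
  have hΓs := hΓ.unifSmooth he hb (by linarith)
  have htail := hF.fourierTail hp he hK₀ hK
  have hB := ((hF.resPart hp K).add (htail.mono he hb (by linarith))).sub hF
  have hfree := (hB.comp_flow_sub_sub hΓ he hΓs hΨ
    (h := fun i x => e i ^ (2 * δ) * freeHam x)
    (fun i x => ((hasFDerivAt_freeHam x).const_mul _).differentiableAt)
    fun i y => poisson_const_mul_freeHam_stepGenerator (hF.unifSmooth he hb (by linarith)) (hp i)
      (he i) δ (K i) y).time_one.mono he hb (m' := m + (1 - 2 * δ)) (by linarith)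
  have hpert := ((hW.add (hF.mono he hb hm)).comp_flow_sub hΓ he hΓs hΨ).time_one
  rw [show 1 + (m - 2 * δ) = m + (1 - 2 * δ) by ring] at hpert
  convert (hfree.add hpert).add htail using 3 with i y
  ring

end NormalizationStep

section Symbols

variable {d : ℕ} {ε₀ δ m m' : ℝ}

theorem IsSymbol.hasOrder {f : ℝ → Phase d → ℝ} (h : IsSymbol ε₀ δ m f) :
    HasOrder (Subtype.val : Ioo 0 ε₀ → ℝ) m (fun ε y => f ε (scale (ε ^ δ) y)) := fun n =>
  unifBdd_of_wordDeriv
    (fun ε => ((h.smooth ε ε.2).comp (scale _).contDiff).const_smul _) fun w => by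
      obtain ⟨α, β, hw⟩ := exists_multiWord_perm w
      obtain ⟨C, hC₀, hC⟩ := h.bound α β
      refine ⟨⟨C, hC₀.le⟩, fun ε y => ?_⟩
      simp only [smul_eq_mul]
      rw [wordDeriv_rescaled ε.2.1 (h.smooth ε ε.2), ← hw.countP_eq, countP_isLeft_multiWord,
        ← wordDeriv_perm hw (h.smooth ε ε.2), ← mixedPartial_eq_wordDeriv]
      exact hC ε ε.2 _

theorem isSymbol_of_hasOrder {f : ℝ → Phase d → ℝ} (hp : ∀ ε ∈ Ioo 0 ε₀, IsPeriodic (f ε))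
    (h : HasOrder (Subtype.val : Ioo 0 ε₀ → ℝ) m (fun ε y => f ε (scale (ε ^ δ) y))) :
    IsSymbol ε₀ δ m f := by
  have hsmooth : ∀ ε ∈ Ioo 0 ε₀, ContDiff ℝ ∞ (f ε) := fun ε hε => by
    simpa only [Function.comp_def, scale_rpow_scale_rpow_neg hε.1] using
      (h.contDiff (fun ε => ε.2.1) ⟨ε, hε⟩).comp (scale (ε ^ (-δ))).contDiff
  refine ⟨hsmooth, hp, fun α β => ?_⟩
  obtain ⟨C, hC⟩ := (UnifSmooth.wordDeriv h (multiWord α β) 0).bounded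
  refine ⟨C + 1, by positivity, fun ε hε x => ?_⟩
  have hCx := hC ⟨ε, hε⟩ (scale (ε ^ (-δ)) x)
  simp only [smul_eq_mul, wordDeriv_rescaled hε.1 (hsmooth ε hε), scale_rpow_scale_rpow_neg hε.1,
    countP_isLeft_multiWord, ← mixedPartial_eq_wordDeriv] at hCx
  exact hCx.trans (le_add_of_nonneg_right zero_le_one)

theorem scale_rpow_neg_scale_rpow {ε : ℝ} (hε : 0 < ε) (δ : ℝ) (y : Phase d) :
    scale (ε ^ (-δ)) (scale (ε ^ δ) y) = y :=
  scale_scale (by rw [mul_comm, rpow_mul_rpow_neg hε]) y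

theorem isSymbol_comp_scale {G : ℝ → Phase d → ℝ} (hp : ∀ ε ∈ Ioo 0 ε₀, IsPeriodic (G ε))
    (h : HasOrder (Subtype.val : Ioo 0 ε₀ → ℝ) m (fun ε => G ε)) :
    IsSymbol ε₀ δ m (fun ε x => G ε (scale (ε ^ (-δ)) x)) := by
  refine isSymbol_of_hasOrder (fun ε hε => (hp ε hε).comp_scale _) ?_
  convert h using 3 with ε y
  exact congrArg _ (scale_rpow_neg_scale_rpow ε.2.1 δ y)

theorem IsSymbol.mono {f : ℝ → Phase d → ℝ} (h : IsSymbol ε₀ δ m f) (hm : m' ≤ m) :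
    IsSymbol ε₀ δ m' f :=
  isSymbol_of_hasOrder h.periodic (h.hasOrder.mono (fun ε => ε.2.1) (fun ε => ε.2.2.le) hm)

theorem isSymbol_zero : IsSymbol ε₀ δ m (fun _ (_ : Phase d) => 0) :=
  isSymbol_of_hasOrder (fun _ _ _ _ => rfl) fun n => by
    simpa only [smul_zero] using
      UnifBdd.const (ι := Ioo 0 ε₀) (c := fun _ => (0 : ℝ)) (C := 0) (by simp)

theorem IsSymbol.add {f g : ℝ → Phase d → ℝ} (hf : IsSymbol ε₀ δ m f) (hg : IsSymbol ε₀ δ m g) :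
    IsSymbol ε₀ δ m (fun ε x => f ε x + g ε x) :=
  isSymbol_of_hasOrder
    (fun ε hε k x => congrArg₂ (· + ·) (hf.periodic ε hε k x) (hg.periodic ε hε k x))
    (hf.hasOrder.add hg.hasOrder)

theorem IsSymbol.isRemainder {N : ℕ} {R : ℝ → Phase d → ℝ}
    (h : IsSymbol ε₀ δ (1 + N * (1 - 2 * δ)) R) : IsRemainder ε₀ δ N R := by
  refine ⟨h.smooth, h.periodic, fun α β _ => ?_⟩
  obtain ⟨C, hC₀, hC⟩ := h.bound α β
  refine ⟨C, hC₀, fun ε hε x => ?_⟩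
  have hCx := hC ε hε x
  rwa [abs_mul, abs_of_nonneg (Real.rpow_nonneg hε.1.le _)] at hCx

end Symbols

section Cutoff

variable {β ε : ℝ}

theorem rpow_neg_le_cutoff (hε : 0 < ε) : ε ^ (-β) ≤ cutoff β ε := by
  rw [Real.rpow_neg hε.le, ← one_div, cutoff, Nat.cast_succ]
  exact (Nat.lt_floor_add_one _).le

theorem exists_rpow_neg_le_cutoff_pow (hβ : 0 < β) (ε₀ a : ℝ) :
    ∃ (M : ℕ) (C : ℝ), ∀ ε : Ioo 0 ε₀, (ε : ℝ) ^ (-a) ≤ C * (cutoff β ε : ℝ) ^ M := by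
  obtain ⟨M, hM⟩ := exists_nat_ge (a / β)
  rw [div_le_iff₀ hβ] at hM
  refine ⟨M, ε₀ ^ (M * β - a), fun ⟨ε, hε, hε'⟩ => ?_⟩
  have hε₀ : 0 ≤ ε₀ := (hε.trans hε').le
  calc ε ^ (-a) = ε ^ (M * β - a) * (ε ^ (-β)) ^ M := by
        rw [← Real.rpow_natCast, ← Real.rpow_mul hε.le, ← Real.rpow_add hε]
        ring_nf
    _ ≤ ε₀ ^ (M * β - a) * (cutoff β ε : ℝ) ^ M := by
        gcongr
        exact rpow_neg_le_cutoff hε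

end Cutoff

section NearIdentity

variable {d : ℕ} {ε₀ δ : ℝ}

/-- A family of canonical transformations that moves the symbols of order `m` by
`O(ε ^ (m + 1 - 2δ))` and the actions by `O(ε ^ (1 - δ))`. -/
structure IsNearIdentity (ε₀ δ : ℝ) (T : ℝ → Phase d → Phase d) : Prop where
  canonical : ∀ ε ∈ Ioo 0 ε₀, IsCanonical (T ε)
  symbol : ∀ (m : ℝ) (f : ℝ → Phase d → ℝ), IsSymbol ε₀ δ m f →
    ∃ C > 0, ∀ ε ∈ Ioo 0 ε₀, ∀ x : Phase d, |f ε (T ε x) - f ε x| ≤ C * ε ^ (m + 1 - 2 * δ)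
  action : ∀ j : Fin d, ∃ C > 0, ∀ ε ∈ Ioo 0 ε₀, ∀ x : Phase d,
    |(T ε x).1 j - x.1 j| ≤ C * ε ^ (1 - δ)

theorem isNearIdentity_id : IsNearIdentity ε₀ δ (fun _ => (id : Phase d → Phase d)) := by
  refine ⟨fun _ _ => isCanonical_id, fun m f _ => ⟨1, one_pos, fun ε hε x => ?_⟩,
    fun j => ⟨1, one_pos, fun ε hε x => ?_⟩⟩ <;>
  simpa only [id, sub_self, abs_zero, one_mul] using Real.rpow_nonneg hε.1.le _

theorem IsNearIdentity.comp {S T : ℝ → Phase d → Phase d} (hS : IsNearIdentity ε₀ δ S)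
    (hT : IsNearIdentity ε₀ δ T) : IsNearIdentity ε₀ δ (fun ε => S ε ∘ T ε) where
  canonical ε hε := (hS.canonical ε hε).comp (hT.canonical ε hε)
  symbol m f hf := by
    obtain ⟨C, hC₀, hC⟩ := hS.symbol m f hf
    obtain ⟨C', hC'₀, hC'⟩ := hT.symbol m f hf
    refine ⟨C + C', by positivity, fun ε hε x => ?_⟩
    rw [add_mul]
    exact (abs_sub_le _ (f ε (T ε x)) _).trans (add_le_add (hC ε hε _) (hC' ε hε x))
  action j := by
    obtain ⟨C, hC₀, hC⟩ := hS.action j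
    obtain ⟨C', hC'₀, hC'⟩ := hT.action j
    refine ⟨C + C', by positivity, fun ε hε x => ?_⟩
    rw [add_mul]
    exact (abs_sub_le _ ((T ε x).1 j) _).trans (add_le_add (hC ε hε _) (hC' ε hε x))

/-- The map which reads `T` in the rescaled variables, where the actions are divided by `ε ^ δ`. -/
def unscaled (δ ε : ℝ) (T : Phase d → Phase d) (x : Phase d) : Phase d :=
  scale (ε ^ δ) (T (scale (ε ^ (-δ)) x))

theorem isNearIdentity_of_isHamFlow {Γ : ℝ → Phase d → ℝ} {Ψ : ℝ → ℝ → Phase d → Phase d}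
    (hδ : 2 * δ ≤ 1) (hΓ : HasOrder (Subtype.val : Ioo 0 ε₀ → ℝ) (1 - 2 * δ) (fun ε => Γ ε))
    (hp : ∀ ε ∈ Ioo 0 ε₀, IsPeriodic (Γ ε)) (hΨ : ∀ ε ∈ Ioo 0 ε₀, IsHamFlow (Γ ε) (Ψ ε)) :
    IsNearIdentity ε₀ δ (fun ε => unscaled δ ε (Ψ ε 1)) := by
  have he : ∀ ε : Ioo 0 ε₀, 0 < (ε : ℝ) := fun ε => ε.2.1
  have hΓs := hΓ.unifSmooth he (fun ε => ε.2.2.le) (by linarith)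
  have hΨ' : ∀ ε : Ioo 0 ε₀, IsHamFlow (Γ ε) (Ψ ε) := fun ε => hΨ ε ε.2
  refine ⟨fun ε hε => ?_, fun m f hf => ?_, fun j => ?_⟩
  · exact (IsHamFlow.isCanonical hΨ' hΓs (fun ε => hp ε ε.2) ⟨ε, hε⟩).conj_scale
      (rpow_mul_rpow_neg hε.1 δ)
  · obtain ⟨C, hC₀, hC⟩ := (hf.hasOrder.comp_flow_sub hΓ he hΓs hΨ').time_one.exists_bound he
    refine ⟨C, hC₀, fun ε hε x => ?_⟩
    have hCx := hC ⟨ε, hε⟩ (scale (ε ^ (-δ)) x)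
    rwa [scale_rpow_scale_rpow_neg hε.1, ← add_sub_assoc] at hCx
  · obtain ⟨C, hC₀, hC⟩ := IsHamFlow.exists_norm_sub_le hΨ' hΓ he
    refine ⟨C, hC₀, fun ε hε x => ?_⟩
    have hεδ := Real.rpow_pos_of_pos hε.1 δ
    have hCx := (norm_le_pi_norm _ j).trans
      ((norm_fst_le _).trans (hC ⟨ε, hε⟩ (scale (ε ^ (-δ)) x)))
    set y := scale (ε ^ (-δ)) x with hy
    calc |(scale (ε ^ δ) (Ψ ε 1 y)).1 j - x.1 j|
        = |(scale (ε ^ δ) (Ψ ε 1 y)).1 j - (scale (ε ^ δ) y).1 j| := by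
          rw [hy, scale_rpow_scale_rpow_neg hε.1]
      _ = ε ^ δ * |(Ψ ε 1 y).1 j - y.1 j| := by
          simp only [scale_apply, Pi.smul_apply, smul_eq_mul, ← mul_sub, abs_mul, abs_of_pos hεδ]
      _ ≤ ε ^ δ * (C * ε ^ (1 - 2 * δ)) := mul_le_mul_of_nonneg_left hCx hεδ.le
      _ = C * ε ^ (1 - δ) := by
          rw [mul_left_comm, ← Real.rpow_add hε.1]
          ring_nf

end NearIdentity

section Normalization

variable {d : ℕ} {ε₀ δ β m : ℝ} {W R P : ℝ → Phase d → ℝ}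

/-- The Lie transform `L` generated by `g` removes from `freeHam + W + R` the nonresonant part of
the order-`m` symbol `R`, leaving the term `Z` in normal form and the higher-order `R'`. -/
structure IsNormalizingStep (ε₀ δ β m : ℝ) (W R g : ℝ → Phase d → ℝ) (L : ℝ → Phase d → Phase d)
    (Z R' : ℝ → Phase d → ℝ) : Prop where
  generator : IsSymbol ε₀ δ (m - δ) g
  isLieTransform : ∀ ε ∈ Ioo 0 ε₀, IsLieTransform (g ε) (L ε)
  isNearIdentity : IsNearIdentity ε₀ δ L
  resonant : IsSymbol ε₀ δ m Z
  isNormalForm : IsNormalForm ε₀ δ β Z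
  remainder : IsSymbol ε₀ δ (m + (1 - 2 * δ)) R'
  conj : ∀ ε ∈ Ioo 0 ε₀, ∀ x, freeHam (L ε x) + W ε (L ε x) + R ε (L ε x) =
    freeHam x + W ε x + Z ε x + R' ε x

theorem freeHam_scale_rpow {ε : ℝ} (hε : 0 < ε) (δ : ℝ) (y : Phase d) :
    freeHam (scale (ε ^ δ) y) = ε ^ (2 * δ) * freeHam y := by
  rw [mul_comm 2 δ, Real.rpow_mul hε.le, Real.rpow_ofNat]
  simp only [freeHam, scale_apply, Pi.smul_apply, smul_eq_mul, Finset.mul_sum]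
  exact Finset.sum_congr rfl fun j _ => by ring

theorem isSymbol_normalization_remainder {Ψ : ℝ → ℝ → Phase d → Phase d} (hδ : 2 * δ ≤ 1)
    (hβ : 0 < β) (hm : 1 ≤ m) (hW : IsSymbol ε₀ δ 1 W) (hR : IsSymbol ε₀ δ m R)
    (hΨ : ∀ ε ∈ Ioo 0 ε₀, IsHamFlow
      (stepGenerator δ ε (cutoff β ε) (fun y => R ε (scale (ε ^ δ) y))) (Ψ ε)) :
    IsSymbol ε₀ δ (m + (1 - 2 * δ)) (fun ε x =>
      freeHam (unscaled δ ε (Ψ ε 1) x) + W ε (unscaled δ ε (Ψ ε 1) x) +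
          R ε (unscaled δ ε (Ψ ε 1) x) -
        (freeHam x + W ε x +
          resPart (cutoff β ε) (fun y => R ε (scale (ε ^ δ) y)) (scale (ε ^ (-δ)) x))) := by
  have he : ∀ ε : Ioo 0 ε₀, 0 < (ε : ℝ) := fun ε => ε.2.1
  have hb : ∀ ε : Ioo 0 ε₀, (ε : ℝ) ≤ ε₀ := fun ε => ε.2.2.le
  have hp : ∀ ε ∈ Ioo 0 ε₀, IsPeriodic (fun y => R ε (scale (ε ^ δ) y)) := fun ε hε =>
    (hR.periodic ε hε).comp_scale _
  obtain ⟨M, C, hK⟩ := exists_rpow_neg_le_cutoff_pow hβ ε₀ (1 - 2 * δ)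
  refine isSymbol_of_hasOrder (fun ε hε k x => ?_) ?_
  · have hΓ := hR.hasOrder.stepGenerator (fun ε => hp ε ε.2) he δ fun ε => cutoff β ε
    obtain ⟨_, hlip⟩ := ((hΓ.unifSmooth he hb (by linarith)).hamVF 0).unifMap.lipschitz
    simp only [unscaled, scale_add_shift, isPeriodic_freeHam k _, hW.periodic ε hε k _,
      (hΨ ε hε).add_shift (hlip ⟨ε, hε⟩) (isPeriodic_stepGenerator _ _ _ (hp ε hε)),
      hR.periodic ε hε k _, isPeriodic_resPart _ (hp ε hε) k _]
  · have herror := hasOrder_normalization_error (K := fun ε : Ioo 0 ε₀ => cutoff β ε) he hb hδ hm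
      (fun ε => Nat.succ_pos _) hK hW.hasOrder hR.hasOrder (fun ε => hp ε ε.2) fun ε => hΨ ε ε.2
    convert herror using 3 with ε y
    simp only [unscaled, scale_rpow_neg_scale_rpow ε.2.1, freeHam_scale_rpow ε.2.1]

theorem exists_isNormalizingStep (hδ : 2 * δ ≤ 1) (hβ : 0 < β) (hm : 1 ≤ m)
    (hW : IsSymbol ε₀ δ 1 W) (hR : IsSymbol ε₀ δ m R) :
    ∃ g L Z R', IsNormalizingStep ε₀ δ β m W R g L Z R' := by
  have he : ∀ ε : Ioo 0 ε₀, 0 < (ε : ℝ) := fun ε => ε.2.1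
  have hb : ∀ ε : Ioo 0 ε₀, (ε : ℝ) ≤ ε₀ := fun ε => ε.2.2.le
  let F : ℝ → Phase d → ℝ := fun ε y => R ε (scale (ε ^ δ) y)
  have hFp : ∀ ε ∈ Ioo 0 ε₀, IsPeriodic (F ε) := fun ε hε => (hR.periodic ε hε).comp_scale _
  have hF : HasOrder Subtype.val m (fun ε : Ioo 0 ε₀ => F ε) := hR.hasOrder
  let Γ : ℝ → Phase d → ℝ := fun ε => stepGenerator δ ε (cutoff β ε) (F ε)
  have hΓp : ∀ ε ∈ Ioo 0 ε₀, IsPeriodic (Γ ε) := fun ε hε =>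
    isPeriodic_stepGenerator _ _ _ (hFp ε hε)
  have hΓ : HasOrder Subtype.val (m - 2 * δ) (fun ε : Ioo 0 ε₀ => Γ ε) :=
    hF.stepGenerator (fun ε => hFp ε ε.2) he δ fun ε => cutoff β ε
  choose! Ψ hΨ using fun ε (hε : ε ∈ Ioo 0 ε₀) =>
    (hΓ.unifSmooth he hb (by linarith)).exists_isHamFlow ⟨ε, hε⟩
  have hg : IsSymbol ε₀ δ (m - δ) (fun ε x => ε ^ δ * Γ ε (scale (ε ^ (-δ)) x)) := by
    refine isSymbol_comp_scale (G := fun ε y => ε ^ δ * Γ ε y)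
      (fun ε hε => (hΓp ε hε).const_mul _) ?_
    have hgΓ := hΓ.rpow_smul he δ
    rwa [show m - 2 * δ + δ = m - δ by ring] at hgΓ
  exact ⟨_, fun ε => unscaled δ ε (Ψ ε 1), _, _,
    { generator := hg
      isLieTransform := fun ε hε =>
        ⟨_, (hΨ ε hε).conj_scale (hΓ.contDiff he ⟨ε, hε⟩) (rpow_mul_rpow_neg hε.1 δ), rfl⟩
      isNearIdentity := isNearIdentity_of_isHamFlow hδ (hΓ.mono he hb (by linarith)) hΓp hΨ
      resonant := isSymbol_comp_scale (fun ε hε => isPeriodic_resPart _ (hFp ε hε))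
        (hF.resPart (fun ε => hFp ε ε.2) fun ε => cutoff β ε)
      isNormalForm := isNormalForm_resPart hFp fun ε hε => (hF.contDiff he ⟨ε, hε⟩).continuous
      remainder := isSymbol_normalization_remainder hδ hβ hm hW hR hΨ
      conj := fun ε _ x => (add_sub_cancel _ _).symm }⟩

theorem exists_seq_isNormalizingStep (hδ : 2 * δ ≤ 1) (hβ : 0 < β) (hP : IsSymbol ε₀ δ 1 P) :
    ∃ (g : ℕ → ℝ → Phase d → ℝ) (L : ℕ → ℝ → Phase d → Phase d) (Z R : ℕ → ℝ → Phase d → ℝ),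
      R 0 = P ∧ ∀ n : ℕ, IsNormalizingStep ε₀ δ β (1 + n * (1 - 2 * δ))
        (fun ε x => ∑ j ∈ Finset.Icc 1 n, Z j ε x) (R n) (g (n + 1)) (L (n + 1)) (Z (n + 1))
        (R (n + 1)) := by
  have hm (n : ℕ) : 1 ≤ 1 + n * (1 - 2 * δ) :=
    le_add_of_nonneg_right (mul_nonneg n.cast_nonneg (by linarith))
  have hsucc (n : ℕ) : 1 + n * (1 - 2 * δ) + (1 - 2 * δ) = 1 + (n + 1 : ℕ) * (1 - 2 * δ) := by
    push_cast
    ring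
  let State (n : ℕ) := {S : (ℝ → Phase d → ℝ) × (ℝ → Phase d → ℝ) //
    IsSymbol ε₀ δ 1 S.1 ∧ IsSymbol ε₀ δ (1 + n * (1 - 2 * δ)) S.2}
  choose g L Z R' hstep using fun (n : ℕ) (S : State n) =>
    exists_isNormalizingStep hδ hβ (hm n) S.2.1 S.2.2
  let S : ∀ n, State n := Nat.rec ⟨(fun _ _ => 0, P), isSymbol_zero, by simpa using hP⟩ fun n S =>
    ⟨(fun ε x => S.1.1 ε x + Z n S ε x, R' n S),
      S.2.1.add ((hstep n S).resonant.mono (hm n)), hsucc n ▸ (hstep n S).remainder⟩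
  have hW (n : ℕ) : (S n).1.1 =
      fun ε x => ∑ j ∈ Finset.Icc 1 n, Z (j - 1) (S (j - 1)) ε x := by
    induction n with
    | zero => rfl
    | succ n ih =>
      ext ε x
      rw [Finset.sum_Icc_succ_top (by simp), ← congrFun (congrFun ih ε) x]
      rfl
  exact ⟨fun j => g (j - 1) (S (j - 1)), fun j => L (j - 1) (S (j - 1)),
    fun j => Z (j - 1) (S (j - 1)), fun n => (S n).1.2, rfl, fun n => hW n ▸ hstep n (S n)⟩

end Normalization

end

end NormalFormLemma

open NormalFormLemma in
theorem lemma2p1_general {d : ℕ} {δ β ε₀ : ℝ} (hδ : 2 * δ ≤ 1) (hβ : 0 < β)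
    {P : ℝ → Phase d → ℝ} (hP : IsSymbol ε₀ δ 1 P) :
    ∃ (g : ℕ → ℝ → Phase d → ℝ) (L : ℕ → ℝ → Phase d → Phase d) (Z R : ℕ → ℝ → Phase d → ℝ),
      (∀ j : ℕ, 1 ≤ j → IsSymbol ε₀ δ (1 + (1 - 2 * δ) * ((j : ℝ) - 1) - δ) (g j) ∧
        ∀ ε ∈ Set.Ioo 0 ε₀, IsLieTransform (g j ε) (L j ε)) ∧
      (∀ j : ℕ, 1 ≤ j →
        IsSymbol ε₀ δ (1 + (1 - 2 * δ) * ((j : ℝ) - 1)) (Z j) ∧ IsNormalForm ε₀ δ β (Z j)) ∧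
      ∀ N : ℕ, IsNearIdentity ε₀ δ (fun ε => compUpTo (fun j => L j ε) N) ∧
        (∀ ε ∈ Set.Ioo 0 ε₀, ∀ x : Phase d,
          freeHam (compUpTo (fun j => L j ε) N x) + P ε (compUpTo (fun j => L j ε) N x) =
            freeHam x + ∑ j ∈ Finset.Icc 1 N, Z j ε x + R N ε x) ∧
        IsSymbol ε₀ δ (1 + N * (1 - 2 * δ)) (R N) := by
  obtain ⟨g, L, Z, R, rfl, hstep⟩ := exists_seq_isNormalizingStep hδ hβ hP
  have horder (n : ℕ) : 1 + (1 - 2 * δ) * (((n + 1 : ℕ) : ℝ) - 1) = 1 + n * (1 - 2 * δ) := by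
    push_cast
    ring
  refine ⟨g, L, Z, R, fun j hj => ?_, fun j hj => ?_, fun N => ?_⟩
  · obtain ⟨n, rfl⟩ := Nat.exists_eq_add_of_le' hj
    exact (horder n).symm ▸ ⟨(hstep n).generator, (hstep n).isLieTransform⟩
  · obtain ⟨n, rfl⟩ := Nat.exists_eq_add_of_le' hj
    exact (horder n).symm ▸ ⟨(hstep n).resonant, (hstep n).isNormalForm⟩
  induction N with
  | zero => exact ⟨isNearIdentity_id, fun ε _ x => by simp [compUpTo], by simpa using hP⟩
  | succ N ih =>
    obtain ⟨hT, hconj, -⟩ := ih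
    refine ⟨hT.comp (hstep N).isNearIdentity, fun ε hε x => ?_, ?_⟩
    · rw [compUpTo, Function.comp_apply, hconj ε hε, (hstep N).conj ε hε,
        Finset.sum_Icc_succ_top (by simp), ← add_assoc]
    · convert (hstep N).remainder using 1
      push_cast
      ring

open NormalFormLemma in
theorem lemma2p1 (d N : ℕ) (δ β ε₀ : ℝ) (hδ : 0 < δ) (hδ' : δ < 1 / 2)
    (hβ : 0 < β) (hβ' : β < 1) (hε₀ : 0 < ε₀)
    (P : ℝ → Phase d → ℝ) (hP : IsSymbol ε₀ δ 1 P) :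
    ∃ (T : ℝ → Phase d → Phase d) (g : ℕ → ℝ → Phase d → ℝ)
      (L : ℕ → ℝ → Phase d → Phase d) (Z : ℕ → ℝ → Phase d → ℝ) (R : ℝ → Phase d → ℝ),
      -- `T ε` is a canonical transformation, a composition of `N` Lie transforms
      (∀ ε ∈ Set.Ioo 0 ε₀, IsCanonical (T ε)) ∧
      (∀ j ∈ Finset.Icc 1 N,
        IsSymbol ε₀ δ (1 + (1 - 2 * δ) * ((j : ℝ) - 1) - δ) (g j) ∧
        ∀ ε ∈ Set.Ioo 0 ε₀, IsLieTransform (g j ε) (L j ε)) ∧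
      (∀ ε ∈ Set.Ioo 0 ε₀, T ε = compUpTo (fun j => L j ε) N) ∧
      -- the normal form
      (∀ ε ∈ Set.Ioo 0 ε₀, ∀ x : Phase d,
        freeHam (T ε x) + P ε (T ε x) = freeHam x + ∑ j ∈ Finset.Icc 1 N, Z j ε x + R ε x) ∧
      (∀ j ∈ Finset.Icc 1 N,
        IsSymbol ε₀ δ (1 + (1 - 2 * δ) * ((j : ℝ) - 1)) (Z j) ∧ IsNormalForm ε₀ δ β (Z j)) ∧
      IsRemainder ε₀ δ N R ∧
      -- the deformation of symbols and of the actions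
      (∀ (m : ℝ) (f : ℝ → Phase d → ℝ), IsSymbol ε₀ δ m f →
        ∃ C > 0, ∀ ε ∈ Set.Ioo 0 ε₀, ∀ x : Phase d,
          |f ε (T ε x) - f ε x| ≤ C * ε ^ (m + 1 - 2 * δ)) ∧
      (∀ j : Fin d, ∃ C > 0, ∀ ε ∈ Set.Ioo 0 ε₀, ∀ x : Phase d,
        |(T ε x).1 j - x.1 j| ≤ C * ε ^ (1 - δ)) := by
  obtain ⟨g, L, Z, R, hg, hZ, hT⟩ := lemma2p1_general (by linarith) hβ hP
  exact ⟨_, g, L, Z, R N, (hT N).1.canonical, fun j hj => hg j (Finset.mem_Icc.1 hj).1,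
    fun _ _ => rfl, (hT N).2.1, fun j hj => hZ j (Finset.mem_Icc.1 hj).1, (hT N).2.2.isRemainder,
    (hT N).1.symbol, (hT N).1.action⟩
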